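/- Let $d\in\{2,3\}$, let $\Omega=\mathbb R^d$ or $\Omega=\mathbb T^d$, and fix $s>d/2$. For functions $F,G$ of the velocity $v\in\mathbb R^d$ define the hard-sphere collision operator $$Q(F,G)=\tfrac12\big(Q^+(F,G)-Q^-(F,G)+Q^+(G,F)-Q^-(G,F)\big),$$ $$Q^+(F,G)(v)=\int_{\mathbb R^d}\int_{\mathbb S^{d-1}}|v-v_*|\,F(v')\,G(v_*')\,d\sigma\,dv_*,\qquad Q^-(F,G)(v)=\int_{\mathbb R^d}\int_{\mathbb S^{d-1}}|v-v_*|\,F(v)\,G(v_*)\,d\sigma\,dv_*,$$ $$v'=\tfrac{v+v_*}2+\tfrac{|v-v_*|}2\sigma,\qquad v_*'=\tfrac{v+v_*}2-\tfrac{|v-v_*|}2\sigma ;$$ for functions $f,g$ of $(x,v)\in\Omega\times\mathbb R^d$ the variable $x$ is a parameter, i.e. $Q(f,g)(x,\cdot)=Q(f(x,\cdot),g(x,\cdot))$. Let $\langle v\rangle=\sqrt{1+|v|^2}$, $M(v)=(2\pi)^{-d/2}e^{-|v|^2/2}$, $\nu(v)=\int_{\mathbb R^d}M(v_*)|v-v_*|\,dv_*$.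 For $p\in[1,\infty]$ and $\alpha>0$ define, for real-valued measurable $f=f(x,v)$, $$\|f\|_{\mathcal E^{p,\alpha}}=\big\|f\langle v\rangle^\alpha\big\|_{L^p_vH^s_x},\qquad \|f\|_{\mathcal E^{p,\alpha}_\nu}=\big\|f\,\nu^{1/p}\big\|_{\mathcal E^{p,\alpha}}\qquad(\nu^{1/\infty}=1).$$ Let $p\in[1,\infty]$ with conjugate exponent $p'$ ($1/p+1/p'=1$), and let $\alpha>\alpha_Q(p):=2+d/p'$. There is a constant $C>0$, depending only on $p$ and $\alpha$ (and on the fixed $d,s,\Omega$), such that for all real-valued measurable $f,g$ for which the norms $\|\cdot\|_{\mathcal E^{p,\alpha}}$ and $\|\cdot\|_{\mathcal E^{p,\alpha}_\nu}$ are finite, the integrals defining $Q(f,g)(x,v)$ converge absolutely for almost every $(x,v)$, $Q(f,g)$ is measurable, and $$\|Q(f,g)\|_{\mathcal E^{p,\alpha-1/p'}}\le C\big(\|f\|_{\mathcal E^{p,\alpha}}\|g\|_{\mathcal E^{p,\alpha}_\nu}+\|f\|_{\mathcal E^{p,\alpha}_\nu}\|g\|_{\mathcal E^{p,\alpha}}\big).$$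 If moreover $p<\infty$, then, with the same $C$, for every real-valued measurable $h$ with $\|h\|_{\mathcal E^{p,\alpha}}$ and $\|h\|_{\mathcal E^{p,\alpha}_\nu}$ finite, the following integrand (read as $0$ where $\|h(\cdot,v)\|_{H^s_x}=0$) is integrable and $$\int_{\mathbb R^d}\big\langle Q(f,g),h\big\rangle_{H^s_x}\,\|h\|_{H^s_x}^{p-2}\,\langle v\rangle^{p\alpha}\,dv\le C\big(\|f\|_{\mathcal E^{p,\alpha}}\|g\|_{\mathcal E^{p,\alpha}_\nu}+\|f\|_{\mathcal E^{p,\alpha}_\nu}\|g\|_{\mathcal E^{p,\alpha}}\big)\,\|h\|_{\mathcal E^{p,\alpha}_\nu}^{p-1}.$$ -/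

import Mathlib

open MeasureTheory
open scoped ENNReal FourierTransform

noncomputable section

/-- The spatial domain: the whole space `ℝ^d` or the torus `𝕋^d`. -/
inductive SpatialDomain where
  | wholeSpace
  | torus

namespace SpatialDomain

/-- The points of the spatial domain: `ℝ^d`, or `𝕋^d = (ℝ/ℤ)^d`. -/
abbrev Pt (d : ℕ) : SpatialDomain → Type
  | wholeSpace => EuclideanSpace ℝ (Fin d)
  | torus => UnitAddTorus (Fin d)

instance instMeasurableSpacePt (d : ℕ) : (Ω : SpatialDomain) → MeasurableSpace (Ω.Pt d)
  | wholeSpace => inferInstanceAs (MeasurableSpace (EuclideanSpace ℝ (Fin d)))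
  | torus => inferInstanceAs (MeasurableSpace (Fin d → UnitAddCircle))

/-- Lebesgue measure on `ℝ^d`, normalized Haar measure on `𝕋^d`. -/
abbrev vol (d : ℕ) : (Ω : SpatialDomain) → Measure (Ω.Pt d)
  | wholeSpace => (volume : Measure (EuclideanSpace ℝ (Fin d)))
  | torus => (Measure.pi fun _ : Fin d => (AddCircle.haarAddCircle : Measure UnitAddCircle))

/-- The Fourier variable: `ℝ^d`, or `ℤ^d`. -/
abbrev Freq (d : ℕ) : SpatialDomain → Type
  | wholeSpace => EuclideanSpace ℝ (Fin d)
  | torus => Fin d → ℤ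

instance instMeasurableSpaceFreq (d : ℕ) : (Ω : SpatialDomain) → MeasurableSpace (Ω.Freq d)
  | wholeSpace => inferInstanceAs (MeasurableSpace (EuclideanSpace ℝ (Fin d)))
  | torus => inferInstanceAs (MeasurableSpace (Fin d → ℤ))

/-- Lebesgue measure on the frequencies `ℝ^d`, counting measure on the frequencies `ℤ^d`. -/
abbrev freqVol (d : ℕ) : (Ω : SpatialDomain) → Measure (Ω.Freq d)
  | wholeSpace => (volume : Measure (EuclideanSpace ℝ (Fin d)))
  | torus => (Measure.count : Measure (Fin d → ℤ))

/-- The squared Euclidean length `|ξ|²` of a frequency. -/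
def freqSq (d : ℕ) : (Ω : SpatialDomain) → Ω.Freq d → ℝ
  | wholeSpace => fun ξ : EuclideanSpace ℝ (Fin d) => ‖ξ‖ ^ 2
  | torus => fun n : Fin d → ℤ => ∑ i, (n i : ℝ) ^ 2

open Classical in
/-- The Fourier transform in `x` of a square-integrable function, for the characters
`x ↦ exp (2πi x·ξ)`: the Fourier–Plancherel transform on `ℝ^d` (zero by convention when `u` is not
square-integrable), the Fourier coefficients on `𝕋^d`. -/
def fourier (d : ℕ) : (Ω : SpatialDomain) → (Ω.Pt d → ℝ) → Ω.Freq d → ℂ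
  | wholeSpace => fun (u : EuclideanSpace ℝ (Fin d) → ℝ) =>
      if hu : MemLp (fun x => (u x : ℂ)) 2 (volume : Measure (EuclideanSpace ℝ (Fin d))) then
        ⇑(𝓕 (hu.toLp (fun x => (u x : ℂ))) :
          Lp ℂ 2 (volume : Measure (EuclideanSpace ℝ (Fin d))))
      else 0
  | torus => fun (u : UnitAddTorus (Fin d) → ℝ) =>
      UnitAddTorus.mFourierCoeff (fun x => (u x : ℂ))

/-- The symbol `(1 + |2πξ|²)^s` of `(1 - Δ)^s`. -/
def besselWeight (d : ℕ) (Ω : SpatialDomain) (s : ℝ) (ξ : Ω.Freq d) : ℝ :=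
  (1 + (2 * Real.pi) ^ 2 * Ω.freqSq d ξ) ^ s

open Classical in
/-- The norm `‖u‖_{H^s_x}`, with value `∞` when `u` does not belong to `H^s_x` (`s ≥ 0`). -/
def hsNorm (d : ℕ) (Ω : SpatialDomain) (s : ℝ) (u : Ω.Pt d → ℝ) : ℝ≥0∞ :=
  if MemLp u 2 (Ω.vol d) then
    (∫⁻ ξ, ENNReal.ofReal (Ω.besselWeight d s ξ) * ‖Ω.fourier d u ξ‖ₑ ^ 2 ∂(Ω.freqVol d))
      ^ (1 / 2 : ℝ)
  else ∞

/-- The inner product `⟨u, w⟩_{H^s_x}` of two real-valued functions of `H^s_x`. -/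
def hsInner (d : ℕ) (Ω : SpatialDomain) (s : ℝ) (u w : Ω.Pt d → ℝ) : ℝ :=
  ∫ ξ, Ω.besselWeight d s ξ * (Ω.fourier d u ξ * starRingEnd ℂ (Ω.fourier d w ξ)).re
    ∂(Ω.freqVol d)

end SpatialDomain

namespace Boltzmann

/-- The velocity space `ℝ^d`. -/
abbrev Vel (d : ℕ) : Type := EuclideanSpace ℝ (Fin d)

/-- The unit sphere `𝕊^{d-1}`. -/
abbrev Sph (d : ℕ) : Type := Metric.sphere (0 : Vel d) 1

/-- The product of Lebesgue measure `dv_*` and of the surface measure `dσ` on the sphere. -/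
def collMeasure (d : ℕ) : Measure (Vel d × Sph d) :=
  (volume : Measure (Vel d)).prod (volume : Measure (Vel d)).toSphere

/-- The pre-collisional velocity `v' = (v + v_*)/2 + |v - v_*| σ / 2`. -/
def vPre {d : ℕ} (v vs : Vel d) (σ : Sph d) : Vel d :=
  (1 / 2 : ℝ) • (v + vs) + (‖v - vs‖ / 2) • (σ : Vel d)

/-- The pre-collisional velocity `v_*' = (v + v_*)/2 - |v - v_*| σ / 2`. -/
def vsPre {d : ℕ} (v vs : Vel d) (σ : Sph d) : Vel d :=
  (1 / 2 : ℝ) • (v + vs) - (‖v - vs‖ / 2) • (σ : Vel d)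

/-- The integrand `|v - v_*| F' G_*'` of the gain part, as a function of `(v_*, σ)`. -/
def gainIntegrand {d : ℕ} (F G : Vel d → ℝ) (v : Vel d) (z : Vel d × Sph d) : ℝ :=
  ‖v - z.1‖ * (F (vPre v z.1 z.2) * G (vsPre v z.1 z.2))

/-- The integrand `|v - v_*| F G_*` of the loss part, as a function of `(v_*, σ)`. -/
def lossIntegrand {d : ℕ} (F G : Vel d → ℝ) (v : Vel d) (z : Vel d × Sph d) : ℝ :=
  ‖v - z.1‖ * (F v * G z.1)

/-- The gain part `Q⁺(F, G)`. -/
def Qgain {d : ℕ} (F G : Vel d → ℝ) (v : Vel d) : ℝ :=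
  ∫ z, gainIntegrand F G v z ∂(collMeasure d)

/-- The loss part `Q⁻(F, G)`. -/
def Qloss {d : ℕ} (F G : Vel d → ℝ) (v : Vel d) : ℝ :=
  ∫ z, lossIntegrand F G v z ∂(collMeasure d)

/-- The (symmetrized) hard-sphere collision operator on functions of the velocity. -/
def Qvel {d : ℕ} (F G : Vel d → ℝ) (v : Vel d) : ℝ :=
  (1 / 2) * (Qgain F G v - Qloss F G v + Qgain G F v - Qloss G F v)

/-- The collision operator on functions of `(x, v)`; it acts on the velocity, `x` is a parameter. -/
def Q {d : ℕ} {X : Type} (f g : X → Vel d → ℝ) (x : X) (v : Vel d) : ℝ :=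
  Qvel (f x) (g x) v

/-- All four integrals defining `Q(F, G)(v)` converge absolutely. -/
def QConverges {d : ℕ} (F G : Vel d → ℝ) (v : Vel d) : Prop :=
  Integrable (gainIntegrand F G v) (collMeasure d) ∧
  Integrable (lossIntegrand F G v) (collMeasure d) ∧
  Integrable (gainIntegrand G F v) (collMeasure d) ∧
  Integrable (lossIntegrand G F v) (collMeasure d)

/-- The bracket `⟨v⟩ = √(1 + |v|²)`. -/
def bracket {d : ℕ} (v : Vel d) : ℝ := Real.sqrt (1 + ‖v‖ ^ 2)

/-- The normal centered distribution `M(v) = (2π)^{-d/2} exp (-|v|²/2)`. -/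
def maxwellian {d : ℕ} (v : Vel d) : ℝ :=
  (2 * Real.pi) ^ (-(d : ℝ) / 2) * Real.exp (-‖v‖ ^ 2 / 2)

/-- The collision frequency `ν(v) = ∫ M(v_*) |v - v_*| dv_*`. -/
def collFreq {d : ℕ} (v : Vel d) : ℝ := ∫ vs : Vel d, maxwellian vs * ‖v - vs‖

/-- The norm of `L^p_v H^s_x` (no weight). -/
def lpHsNorm (d : ℕ) (Ω : SpatialDomain) (s : ℝ) (p : ℝ≥0∞) (f : Ω.Pt d → Vel d → ℝ) : ℝ≥0∞ :=
  eLpNorm (fun v : Vel d => Ω.hsNorm d s (fun x => f x v)) p volume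

/-- The norm `‖f ⟨v⟩^α‖_{L^p_v H^s_x}`. -/
def polyNorm (d : ℕ) (Ω : SpatialDomain) (s : ℝ) (p : ℝ≥0∞) (α : ℝ)
    (f : Ω.Pt d → Vel d → ℝ) : ℝ≥0∞ :=
  lpHsNorm d Ω s p (fun x v => f x v * bracket v ^ α)

/-- The norm `‖f ν^{1/p}‖` with respect to `polyNorm` (where `1/∞ = 0`). -/
def polyNormNu (d : ℕ) (Ω : SpatialDomain) (s : ℝ) (p : ℝ≥0∞) (α : ℝ)
    (f : Ω.Pt d → Vel d → ℝ) : ℝ≥0∞ :=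
  polyNorm d Ω s p α (fun x v => f x v * collFreq v ^ (p⁻¹).toReal)

/-- Joint (a.e. strong) measurability in `(x, v)`. -/
def JointlyMeasurable (d : ℕ) (Ω : SpatialDomain) (f : Ω.Pt d → Vel d → ℝ) : Prop :=
  AEStronglyMeasurable (Function.uncurry f) ((Ω.vol d).prod volume)

/-- `f` is measurable with finite norms `polyNorm` and `polyNormNu`. -/
def MemPolyNu (d : ℕ) (Ω : SpatialDomain) (s : ℝ) (p : ℝ≥0∞) (α : ℝ)
    (f : Ω.Pt d → Vel d → ℝ) : Prop :=
  JointlyMeasurable d Ω f ∧ polyNorm d Ω s p α f < ∞ ∧ polyNormNu d Ω s p α f < ∞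

/-- The integrand `⟨q, h⟩_{H^s_x} ‖h‖_{H^s_x}^{p-2} ⟨v⟩^{pα}` at the velocity `v`. It vanishes where
`‖h‖_{H^s_x} = 0`. -/
def dualIntegrand (d : ℕ) (Ω : SpatialDomain) (s : ℝ) (p : ℝ≥0∞) (α : ℝ)
    (q h : Ω.Pt d → Vel d → ℝ) (v : Vel d) : ℝ :=
  Ω.hsInner d s (fun x => q x v) (fun x => h x v)
    * (Ω.hsNorm d s (fun x => h x v)).toReal ^ (p.toReal - 2) * bracket v ^ (p.toReal * α)

end Boltzmann

end

/-!
For `s > d/2` the space `H^s_x` is a Banach algebra, so Minkowski's inequality in `x` bounds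
`‖Q^±(f, g)(v)‖_{H^s_x}` by the collision integral of the scalar functions `‖f(v)‖_{H^s_x}` and
`‖g(v)‖_{H^s_x}`. Minkowski needs no Bochner integral: `‖·‖_{H^s_x}` is a supremum of countably
many pairings with `L²` functions, and each pairing commutes with the velocity integral.

In the scalar estimate gain and loss enter through the same properties of the maps
`(v, v_*, σ) ↦ (v', v_*')` and `(v, v_*, σ) ↦ (v, v_*)`: both carry `dv dv_* dσ` to
`|S^{d-1}| dv dv_*`, preserve the relative speed, satisfy `⟨v⟩ ≤ ⟨v'⟩⟨v_*'⟩`, and for `β > 2 + d`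
`∫∫ |v - v_*| (⟨v'⟩⟨v_*'⟩)^{-β} dσ dv_* ≤ K ⟨v⟩^{1-β}`.
Hölder's inequality in `(v_*, σ)` against `(⟨v'⟩⟨v_*'⟩)^{-α}` uses this kernel bound with
`β = αp'`, which is admissible since `α > 2 + d/p'`, and produces the factor `⟨v⟩^{1/p' - α}`. The
change of variables and `|v - v_*| ≤ ⟨v'⟩ + ⟨v_*'⟩` then put the remaining power `⟨v⟩^{1/p}` on one
of the two functions, where `ν(v) ≥ c⟨v⟩` turns it into `ν^{1/p}`. The dual bound is Hölder's
inequality in `v` applied to the norm bound.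
-/

noncomputable section

section Polar

variable {E : Type*} [NormedAddCommGroup E] [NormedSpace ℝ E] [FiniteDimensional ℝ E]
  [MeasurableSpace E] [BorelSpace E]

open Set Measure Metric Module

lemma lintegral_eq_lintegral_toSphere_volumeIoiPow [Nontrivial E] (μ : Measure E)
    [μ.IsAddHaarMeasure] {f : E → ℝ≥0∞} (hf : Measurable f) :
    ∫⁻ x, f x ∂μ = ∫⁻ σ : sphere (0 : E) 1, ∫⁻ r : Ioi (0 : ℝ), f ((r : ℝ) • (σ : E))
      ∂(volumeIoiPow (finrank ℝ E - 1)) ∂μ.toSphere := by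
  have hmeas : Measurable fun z : sphere (0 : E) 1 × Ioi (0 : ℝ) => f ((z.2 : ℝ) • (z.1 : E)) :=
    hf.comp (by fun_prop)
  calc ∫⁻ x, f x ∂μ
      = ∫⁻ x : ({(0 : E)}ᶜ : Set E), f x ∂(μ.comap Subtype.val) := by
        rw [lintegral_subtype_comap (measurableSet_singleton _).compl, restrict_compl_singleton]
    _ = ∫⁻ x : ({(0 : E)}ᶜ : Set E), f ((homeomorphUnitSphereProd E).symm
          (homeomorphUnitSphereProd E x)) ∂(μ.comap Subtype.val) := by
        simp only [Homeomorph.symm_apply_apply]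
    _ = _ := by
        rw [← lintegral_prod _ hmeas.aemeasurable]
        exact μ.measurePreserving_homeomorphUnitSphereProd.lintegral_comp hmeas

lemma lintegral_lintegral_toSphere_norm_smul [Nontrivial E] (μ : Measure E) [μ.IsAddHaarMeasure]
    {h : E → ℝ≥0∞} (hh : Measurable h) :
    ∫⁻ u, ∫⁻ σ : sphere (0 : E) 1, h (‖u‖ • (σ : E)) ∂μ.toSphere ∂μ =
      μ.toSphere univ * ∫⁻ u, h u ∂μ := by
  have hmeas : Measurable fun z : E × sphere (0 : E) 1 => h (‖z.1‖ • (z.2 : E)) :=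
    hh.comp (by fun_prop)
  rw [lintegral_eq_lintegral_toSphere_volumeIoiPow μ hmeas.lintegral_prod_right',
    lintegral_eq_lintegral_toSphere_volumeIoiPow μ hh, mul_comm, ← lintegral_const]
  refine lintegral_congr fun ω => ?_
  have hnorm : ∀ r : Ioi (0 : ℝ), ‖(r : ℝ) • (ω : E)‖ = r := fun r => by
    rw [norm_smul, norm_eq_of_mem_sphere, mul_one, Real.norm_of_nonneg r.2.out.le]
  simp only [hnorm]
  exact lintegral_lintegral_swap (hh.comp (by fun_prop)).aemeasurable

lemma lintegral_toSphere_neg (μ : Measure E) [μ.IsAddHaarMeasure]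
    {f : sphere (0 : E) 1 → ℝ≥0∞} (hf : Measurable f) :
    ∫⁻ σ, f (-σ) ∂μ.toSphere = ∫⁻ σ, f σ ∂μ.toSphere := by
  have hneg : MeasurePreserving (fun σ : sphere (0 : E) 1 => -σ) μ.toSphere μ.toSphere := by
    refine ⟨continuous_neg.measurable, Measure.ext fun s hs => ?_⟩
    rw [map_apply continuous_neg.measurable hs, toSphere_apply' _ hs,
      toSphere_apply' _ (continuous_neg.measurable hs)]
    have himage : ((↑) '' ((fun σ : sphere (0 : E) 1 => -σ) ⁻¹' s) : Set E) = -((↑) '' s) := by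
      ext x
      simp only [mem_image, mem_preimage, Set.mem_neg]
      exact ⟨fun ⟨σ, hσ, hx⟩ => ⟨-σ, hσ, by simp [← hx]⟩,
        fun ⟨σ, hσ, hx⟩ => ⟨-σ, by simpa using hσ, by simp [hx]⟩⟩
    rw [himage, Set.smul_neg, measure_neg]
  exact hneg.lintegral_comp hf

lemma lintegral_lintegral_centre_of_mass (μ : Measure E) [μ.IsAddHaarMeasure]
    {G : E → E → ℝ≥0∞} (hG : Measurable (Function.uncurry G)) :
    ∫⁻ v, ∫⁻ w, G v w ∂μ ∂μ =
      ∫⁻ u, ∫⁻ c, G (c + (1 / 2 : ℝ) • u) (c - (1 / 2 : ℝ) • u) ∂μ ∂μ := by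
  calc ∫⁻ v, ∫⁻ w, G v w ∂μ ∂μ
      = ∫⁻ v, ∫⁻ u, G v (v - u) ∂μ ∂μ :=
        lintegral_congr fun v => (lintegral_sub_left_eq_self (fun w => G v w) v).symm
    _ = ∫⁻ u, ∫⁻ v, G v (v - u) ∂μ ∂μ := by
        refine lintegral_lintegral_swap ?_
        exact (hG.comp (f := fun z : E × E => (z.1, z.1 - z.2)) (by fun_prop)).aemeasurable
    _ = _ := by
        refine lintegral_congr fun u => ?_
        rw [← lintegral_add_right_eq_self (fun v => G v (v - u)) ((1 / 2 : ℝ) • u)]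
        refine lintegral_congr fun c => ?_
        congr 1
        module

end Polar

namespace Boltzmann

open Set Metric

variable {d : ℕ}

/-- The total mass of the surface measure of the unit sphere. -/
def sphereMass (d : ℕ) : ℝ≥0∞ := (volume : Measure (Vel d)).toSphere univ

lemma sphereMass_lt_top : sphereMass d < ∞ := measure_lt_top _ _

instance : SFinite (collMeasure d) := Measure.prod.instSFinite

@[fun_prop]
lemma continuous_vPre : Continuous fun z : Vel d × Vel d × Sph d => vPre z.1 z.2.1 z.2.2 := by
  unfold vPre; fun_prop

@[fun_prop]
lemma continuous_vsPre : Continuous fun z : Vel d × Vel d × Sph d => vsPre z.1 z.2.1 z.2.2 := by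
  unfold vsPre; fun_prop

/-- The collision map `(v, v_*, σ) ↦ (v', v_*')`. -/
def collMap (z : Vel d × Vel d × Sph d) : Vel d × Vel d :=
  (vPre z.1 z.2.1 z.2.2, vsPre z.1 z.2.1 z.2.2)

lemma measurable_collMap : Measurable (collMap (d := d)) :=
  (continuous_vPre.prodMk continuous_vsPre).measurable

lemma collMap_centre_of_mass (u c : Vel d) (σ : Sph d) :
    collMap (c + (1 / 2 : ℝ) • u, c - (1 / 2 : ℝ) • u, σ) =
      (c + (1 / 2 : ℝ) • ‖u‖ • (σ : Vel d), c - (1 / 2 : ℝ) • ‖u‖ • (σ : Vel d)) := by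
  have hu : c + (1 / 2 : ℝ) • u - (c - (1 / 2 : ℝ) • u) = u := by module
  simp only [collMap, vPre, vsPre, hu, Prod.mk.injEq]
  constructor <;> module

lemma lintegral_collMap (hd : 0 < d) {H : Vel d × Vel d → ℝ≥0∞} (hH : Measurable H) :
    ∫⁻ z, H (collMap z) ∂(volume.prod (collMeasure d)) =
      sphereMass d * ∫⁻ z, H z ∂((volume : Measure (Vel d)).prod volume) := by
  have : Nonempty (Fin d) := ⟨⟨0, hd⟩⟩
  set S := (volume : Measure (Vel d)).toSphere
  set h : Vel d → ℝ≥0∞ := fun y => ∫⁻ c, H (c + (1 / 2 : ℝ) • y, c - (1 / 2 : ℝ) • y) with hh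
  have hh_meas : Measurable h := Measurable.lintegral_prod_right'
    (f := fun z : Vel d × Vel d => H (z.2 + (1 / 2 : ℝ) • z.1, z.2 - (1 / 2 : ℝ) • z.1))
    (hH.comp (by fun_prop))
  have hHc : Measurable fun z => H (collMap z) := hH.comp measurable_collMap
  calc ∫⁻ z, H (collMap z) ∂(volume.prod (collMeasure d))
      = ∫⁻ v, ∫⁻ w, ∫⁻ σ, H (collMap (v, w, σ)) ∂S := by
        rw [lintegral_prod _ hHc.aemeasurable]
        refine lintegral_congr fun v => ?_
        exact lintegral_prod _ (hHc.comp measurable_prodMk_left).aemeasurable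
    _ = ∫⁻ u : Vel d, ∫⁻ c, ∫⁻ σ,
          H (collMap (c + (1 / 2 : ℝ) • u, c - (1 / 2 : ℝ) • u, σ)) ∂S := by
        refine lintegral_lintegral_centre_of_mass _ ?_
        exact Measurable.lintegral_prod_right' (f := fun z : (Vel d × Vel d) × Sph d =>
          H (collMap (z.1.1, z.1.2, z.2))) (hHc.comp (by fun_prop))
    _ = ∫⁻ u : Vel d, ∫⁻ σ : Sph d, h (‖u‖ • (σ : Vel d)) ∂S := by
        refine lintegral_congr fun u => ?_
        simp only [collMap_centre_of_mass, hh]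
        exact lintegral_lintegral_swap (hH.comp (by fun_prop)).aemeasurable
    _ = sphereMass d * ∫⁻ u, h u := lintegral_lintegral_toSphere_norm_smul _ hh_meas
    _ = _ := by
        rw [lintegral_prod _ hH.aemeasurable,
          lintegral_lintegral_centre_of_mass _ (G := fun v w => H (v, w)) hH]

end Boltzmann

section Scaling

open Module

variable {E : Type*} [NormedAddCommGroup E] [NormedSpace ℝ E] [FiniteDimensional ℝ E]
  [MeasurableSpace E] [BorelSpace E]

lemma lintegral_comp_smul_addHaar (μ : Measure E) [μ.IsAddHaarMeasure] {f : E → ℝ≥0∞}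
    (hf : Measurable f) {r : ℝ} (hr : r ≠ 0) :
    ∫⁻ x, f (r • x) ∂μ = ENNReal.ofReal |(r ^ finrank ℝ E)⁻¹| * ∫⁻ x, f x ∂μ := by
  rw [← lintegral_map hf (measurable_const_smul r), Measure.map_addHaar_smul μ hr,
    lintegral_smul_measure, smul_eq_mul]

lemma lintegral_add_norm_rpow (μ : Measure E) [μ.IsAddHaarMeasure] {a : ℝ} (ha : 0 < a) (γ : ℝ) :
    ∫⁻ x, ENNReal.ofReal ((a + ‖x‖) ^ γ) ∂μ =
      ENNReal.ofReal (a ^ (finrank ℝ E + γ)) * ∫⁻ x, ENNReal.ofReal ((1 + ‖x‖) ^ γ) ∂μ := by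
  have hscale : ∀ x : E, ENNReal.ofReal ((a + ‖x‖) ^ γ) =
      ENNReal.ofReal (a ^ γ) * ENNReal.ofReal ((1 + ‖a⁻¹ • x‖) ^ γ) := fun x => by
    rw [← ENNReal.ofReal_mul (by positivity), ← Real.mul_rpow ha.le (by positivity), norm_smul,
      Real.norm_of_nonneg (by positivity), mul_add, mul_one, mul_inv_cancel_left₀ ha.ne']
  simp only [hscale]
  rw [lintegral_const_mul _ (by fun_prop),
    lintegral_comp_smul_addHaar μ (f := fun x => ENNReal.ofReal ((1 + ‖x‖) ^ γ)) (by fun_prop)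
      (inv_ne_zero ha.ne'), ← mul_assoc, ← ENNReal.ofReal_mul (by positivity),
    inv_pow, inv_inv, abs_of_nonneg (by positivity), add_comm, Real.rpow_add ha, Real.rpow_natCast]

end Scaling

namespace Boltzmann

section Deflection

open Set Module
open scoped RealInnerProductSpace

variable {E : Type*} [NormedAddCommGroup E] [InnerProductSpace ℝ E] {σ : E}

/-- The vector `u - |u|σ`. When `u = v - v_*` is the relative velocity before a collision in the
direction `σ`, it equals `2 (v - v')`. -/
def deflection (σ u : E) : E := u - ‖u‖ • σ

lemma norm_deflection_sq (hσ : ‖σ‖ = 1) (u : E) :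
    ‖deflection σ u‖ ^ 2 = 2 * ‖u‖ * (‖u‖ - ⟪u, σ⟫) := by
  rw [deflection, norm_sub_sq_real, inner_smul_right, norm_smul, hσ, norm_norm]
  ring

lemma injOn_deflection (hσ : ‖σ‖ = 1) : InjOn (deflection σ) {u | deflection σ u ≠ 0} := by
  have key : ∀ u : E, 2 * ‖u‖ * ⟪deflection σ u, σ⟫ = -‖deflection σ u‖ ^ 2 := fun u => by
    rw [norm_deflection_sq hσ, deflection, inner_sub_left, inner_smul_left,
      real_inner_self_eq_norm_sq, hσ]
    simp only [conj_trivial]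
    ring
  intro u hu w _ huw
  have hne : ⟪deflection σ u, σ⟫ ≠ 0 := fun h => by
    simpa [h, sq_eq_zero_iff, norm_eq_zero, hu.out] using key u
  have hnorm : ‖u‖ = ‖w‖ := mul_right_cancel₀ hne (by linarith [key u, huw ▸ key w])
  simpa [deflection, hnorm] using huw

lemma hasFDerivAt_deflection {u : E} (hu : u ≠ 0) :
    HasFDerivAt (deflection σ)
      (ContinuousLinearMap.id ℝ E - (‖u‖⁻¹ • innerSL ℝ u).smulRight σ) u := by
  have hnorm : HasFDerivAt (fun x : E => ‖x‖) (‖u‖⁻¹ • innerSL ℝ u) u := by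
    have hsqrt := (hasStrictFDerivAt_norm_sq u).hasFDerivAt.sqrt (by simpa using hu)
    simp only [Real.sqrt_sq (norm_nonneg _)] at hsqrt
    convert hsqrt using 1
    rw [two_smul, ← two_smul ℝ, smul_smul]
    congr 1
    field_simp
  exact (hasFDerivAt_id u).sub (hnorm.smul_const σ)

variable [FiniteDimensional ℝ E]

lemma det_fderiv_deflection (hσ : ‖σ‖ = 1) {u : E} (hu : u ≠ 0) :
    (ContinuousLinearMap.id ℝ E - (‖u‖⁻¹ • innerSL ℝ u).smulRight σ).det =
      ‖deflection σ u‖ ^ 2 / (2 * ‖u‖ ^ 2) := by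
  have htransvection : ((ContinuousLinearMap.id ℝ E - (‖u‖⁻¹ • innerSL ℝ u).smulRight σ :
      E →L[ℝ] E) : E →ₗ[ℝ] E) =
        LinearMap.transvection (-(‖u‖⁻¹ • innerSL ℝ u : E →L[ℝ] ℝ)).toLinearMap σ := by
    ext x
    simp [LinearMap.transvection.apply, sub_eq_add_neg]
  rw [ContinuousLinearMap.det, htransvection, LinearMap.transvection.det, norm_deflection_sq hσ]
  have : ‖u‖ ≠ 0 := norm_ne_zero_iff.2 hu
  simp only [ContinuousLinearMap.toLinearMap_neg, LinearMap.neg_apply,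
    ContinuousLinearMap.coe_coe, _root_.smul_apply, innerSL_apply_apply, smul_eq_mul]
  field_simp
  ring

variable [MeasurableSpace E] [BorelSpace E]

lemma lintegral_jacobian_mul_comp_deflection_le (μ : Measure E) [μ.IsAddHaarMeasure] (hσ : ‖σ‖ = 1)
    (φ : E → ℝ≥0∞) :
    ∫⁻ u, ENNReal.ofReal (‖deflection σ u‖ ^ 2 / (2 * ‖u‖ ^ 2)) * φ (deflection σ u) ∂μ ≤
      ∫⁻ y, φ y ∂μ := by
  set s : Set E := {u | deflection σ u ≠ 0}
  have hs : MeasurableSet s := by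
    have : Continuous (deflection σ) := by unfold deflection; fun_prop
    exact (this.measurable (measurableSet_singleton 0)).compl
  have hs0 : ∀ u ∈ s, u ≠ 0 := fun u hu h => hu (by simp [deflection, h])
  calc ∫⁻ u, ENNReal.ofReal (‖deflection σ u‖ ^ 2 / (2 * ‖u‖ ^ 2)) * φ (deflection σ u) ∂μ
      = ∫⁻ u in s, ENNReal.ofReal (‖deflection σ u‖ ^ 2 / (2 * ‖u‖ ^ 2)) *
          φ (deflection σ u) ∂μ := by
        refine (setLIntegral_eq_of_support_subset (s := s) fun u hu (h : _ = 0) => hu ?_).symm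
        simp only [h, norm_zero, ne_eq, OfNat.ofNat_ne_zero, not_false_eq_true, zero_pow, zero_div,
          ENNReal.ofReal_zero, zero_mul]
    _ = ∫⁻ u in s, ENNReal.ofReal |(ContinuousLinearMap.id ℝ E -
          (‖u‖⁻¹ • innerSL ℝ u).smulRight σ).det| * φ (deflection σ u) ∂μ := by
        refine setLIntegral_congr_fun hs fun u hu => ?_
        rw [det_fderiv_deflection hσ (hs0 u hu), abs_of_nonneg (by positivity)]
    _ = ∫⁻ y in deflection σ '' s, φ y ∂μ :=
        (lintegral_image_eq_lintegral_abs_det_fderiv_mul μ hs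
          (fun u hu => (hasFDerivAt_deflection (hs0 u hu)).hasFDerivWithinAt)
          (injOn_deflection hσ) φ).symm
    _ ≤ ∫⁻ y, φ y ∂μ := setLIntegral_le_lintegral _ _

end Deflection

section Bracket

variable {d : ℕ}

lemma one_le_bracket (v : Vel d) : 1 ≤ bracket v := by
  rw [bracket, Real.one_le_sqrt]
  linarith [sq_nonneg ‖v‖]

lemma bracket_pos (v : Vel d) : 0 < bracket v := one_pos.trans_le (one_le_bracket v)

lemma bracket_sq (v : Vel d) : bracket v ^ 2 = 1 + ‖v‖ ^ 2 :=
  Real.sq_sqrt (by positivity)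

lemma norm_le_bracket (v : Vel d) : ‖v‖ ≤ bracket v :=
  Real.le_sqrt_of_sq_le (by linarith)

lemma bracket_le_bracket_add_norm_sub (v w : Vel d) : bracket v ≤ bracket w + ‖v - w‖ := by
  refine Real.sqrt_le_iff.2 ⟨by positivity [bracket_pos w], ?_⟩
  have hv : ‖v‖ ≤ ‖w‖ + ‖v - w‖ := by simpa [add_comm] using norm_add_le w (v - w)
  nlinarith [bracket_sq w, norm_le_bracket w, norm_nonneg (v - w), norm_nonneg v]

@[fun_prop]
lemma measurable_bracket : Measurable (bracket (d := d)) := by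
  unfold bracket
  fun_prop

lemma lintegral_bracket_rpow_neg_lt_top {β : ℝ} (hβ : d < β) :
    ∫⁻ v : Vel d, ENNReal.ofReal (bracket v ^ (-β)) < ∞ := by
  have hinteg := (integrable_rpow_neg_one_add_norm_sq (E := Vel d) (μ := volume) (r := β)
    (by simpa using hβ)).lintegral_lt_top
  convert hinteg using 4 with v
  rw [← bracket_sq, ← Real.rpow_natCast, ← Real.rpow_mul (bracket_pos v).le]
  congr 1
  push_cast
  ring

end Bracket

section Kernel

open Set Metric

variable {d : ℕ}

lemma rpow_neg_le_of_div_four_le {a x β : ℝ} (ha : 0 < a) (hβ : 0 ≤ β) (hax : a / 4 ≤ x) :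
    x ^ (-β) ≤ 4 ^ β * a ^ (-β) := by
  calc x ^ (-β) ≤ (a / 4) ^ (-β) :=
        Real.rpow_le_rpow_of_nonpos (by positivity) hax (by linarith)
    _ = 4 ^ β * a ^ (-β) := by
        rw [Real.div_rpow ha.le (by norm_num), div_eq_mul_inv, ← Real.rpow_neg (by norm_num),
          neg_neg, mul_comm]

lemma pow_mul_add_rpow_neg_le {a r β : ℝ} {n : ℕ} (ha : 0 < a) (hr : 0 ≤ r) (hβ : n ≤ β) :
    r ^ n * (a + r) ^ (-β) ≤ a ^ (n - β) := by
  calc r ^ n * (a + r) ^ (-β) ≤ (a + r) ^ n * (a + r) ^ (-β) := by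
        gcongr
        linarith
    _ = (a + r) ^ (n - β) := by
        rw [sub_eq_add_neg, Real.rpow_add (by positivity), Real.rpow_natCast]
    _ ≤ a ^ (n - β) := Real.rpow_le_rpow_of_nonpos ha (by linarith) (by linarith)

lemma norm_mul_rpow_mul_bracket_rpow_le {β : ℝ} (hβ : 3 ≤ β) (σ v u : Vel d) :
    ‖u‖ * (bracket v + ‖u‖) ^ (-β) * bracket (v - (1 / 2 : ℝ) • deflection σ u) ^ (-β) ≤
      2 * bracket v ^ (1 - β) * (‖deflection σ u‖ ^ 2 / (2 * ‖u‖ ^ 2) *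
          bracket (v - (1 / 2 : ℝ) • deflection σ u) ^ (-β)) +
        4 ^ β * bracket v ^ (-β) * (bracket v + ‖u‖) ^ (1 - β) := by
  have ha := bracket_pos v
  have hx := bracket_pos (v - (1 / 2 : ℝ) • deflection σ u)
  have htri := bracket_le_bracket_add_norm_sub v (v - (1 / 2 : ℝ) • deflection σ u)
  rw [sub_sub_cancel, norm_smul, Real.norm_of_nonneg (by norm_num)] at htri
  set a := bracket v
  set x := bracket (v - (1 / 2 : ℝ) • deflection σ u)
  rcases le_total (a / 4) x with hax | hax
  · have hr : ‖u‖ * (a + ‖u‖) ^ (-β) ≤ (a + ‖u‖) ^ (1 - β) := by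
      rw [sub_eq_add_neg, Real.rpow_add (by positivity), Real.rpow_one]
      gcongr
      linarith
    calc ‖u‖ * (a + ‖u‖) ^ (-β) * x ^ (-β)
        ≤ (a + ‖u‖) ^ (1 - β) * (4 ^ β * a ^ (-β)) := by
          gcongr
          exact rpow_neg_le_of_div_four_le ha (by linarith) hax
      _ = 4 ^ β * a ^ (-β) * (a + ‖u‖) ^ (1 - β) := by ring
      _ ≤ _ := le_add_of_nonneg_left (by positivity)
  · have hdefl : a ≤ ‖deflection σ u‖ := by linarith
    have hu : ‖u‖ ≠ 0 := fun h => by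
      simp only [deflection, norm_eq_zero.1 h, zero_smul, sub_zero, norm_zero] at hdefl
      linarith
    have hpow : ‖u‖ ^ 3 * (a + ‖u‖) ^ (-β) ≤ a ^ (1 - β) * ‖deflection σ u‖ ^ 2 := by
      calc ‖u‖ ^ 3 * (a + ‖u‖) ^ (-β) ≤ a ^ (((3 : ℕ) : ℝ) - β) :=
            pow_mul_add_rpow_neg_le ha (norm_nonneg u) (by exact_mod_cast hβ)
        _ = a ^ (1 - β) * a ^ 2 := by
            rw [← Real.rpow_natCast, ← Real.rpow_add ha]
            congr 1
            push_cast
            ring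
        _ ≤ a ^ (1 - β) * ‖deflection σ u‖ ^ 2 := by gcongr
    calc ‖u‖ * (a + ‖u‖) ^ (-β) * x ^ (-β)
        = ‖u‖ ^ 3 * (a + ‖u‖) ^ (-β) / ‖u‖ ^ 2 * x ^ (-β) := by field_simp
      _ ≤ a ^ (1 - β) * ‖deflection σ u‖ ^ 2 / ‖u‖ ^ 2 * x ^ (-β) := by gcongr
      _ = 2 * a ^ (1 - β) * (‖deflection σ u‖ ^ 2 / (2 * ‖u‖ ^ 2) * x ^ (-β)) := by field_simp
      _ ≤ _ := le_add_of_nonneg_right (by positivity)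

lemma lintegral_bracket_sub_half_smul_rpow_neg (v : Vel d) (β : ℝ) :
    ∫⁻ y : Vel d, ENNReal.ofReal (bracket (v - (1 / 2 : ℝ) • y) ^ (-β)) =
      2 ^ d * ∫⁻ y : Vel d, ENNReal.ofReal (bracket y ^ (-β)) := by
  rw [lintegral_comp_smul_addHaar volume
      (f := fun y : Vel d => ENNReal.ofReal (bracket (v - y) ^ (-β))) (by fun_prop) (by norm_num),
    lintegral_sub_left_eq_self (fun y : Vel d => ENNReal.ofReal (bracket y ^ (-β))) v]
  simp [ENNReal.ofReal_pow]

lemma ofReal_bracket_rpow_mul_lintegral_le {β : ℝ} (hβ : d ≤ β) (v : Vel d) :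
    ENNReal.ofReal (bracket v ^ (-β)) *
        ∫⁻ u : Vel d, ENNReal.ofReal ((bracket v + ‖u‖) ^ (1 - β)) ≤
      (∫⁻ u : Vel d, ENNReal.ofReal ((1 + ‖u‖) ^ (1 - β))) *
        ENNReal.ofReal (bracket v ^ (1 - β)) := by
  have hv := bracket_pos v
  rw [lintegral_add_norm_rpow volume hv, finrank_euclideanSpace_fin, ← mul_assoc,
    ← ENNReal.ofReal_mul (by positivity), ← Real.rpow_add hv, mul_comm]
  gcongr
  · exact one_le_bracket v
  · linarith

/-- For a fixed direction `σ`: where `⟨v'⟩ ≥ ⟨v⟩ / 4` the weight of `v'` is small, and elsewhere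
`u ↦ v'` is a change of variables whose Jacobian dominates the kernel. -/
lemma lintegral_norm_mul_rpow_mul_bracket_rpow_le {β : ℝ} (hβ : d + 1 < β) (hβ3 : 3 ≤ β) :
    ∃ K : ℝ≥0∞, K < ∞ ∧ ∀ σ v : Vel d, ‖σ‖ = 1 →
      ∫⁻ u : Vel d, ENNReal.ofReal (‖u‖ * (bracket v + ‖u‖) ^ (-β) *
        bracket (v - (1 / 2 : ℝ) • deflection σ u) ^ (-β)) ≤
          K * ENNReal.ofReal (bracket v ^ (1 - β)) := by
  set I := ∫⁻ y : Vel d, ENNReal.ofReal (bracket y ^ (-β))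
  set J := ∫⁻ u : Vel d, ENNReal.ofReal ((1 + ‖u‖) ^ (1 - β))
  have hI_top : I < ∞ := lintegral_bracket_rpow_neg_lt_top (by linarith)
  have hJ_top : J < ∞ := by
    simpa using finite_integral_one_add_norm (E := Vel d) (μ := volume) (r := β - 1)
      (by rw [finrank_euclideanSpace_fin]; linarith)
  refine ⟨ENNReal.ofReal 2 * (2 ^ d * I) + ENNReal.ofReal (4 ^ β) * J, by finiteness,
    fun σ v hσ => ?_⟩
  have hv := bracket_pos v
  set φ : Vel d → ℝ≥0∞ := fun y => ENNReal.ofReal (bracket (v - (1 / 2 : ℝ) • y) ^ (-β)) with hφ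
  have hchange : ∫⁻ u, ENNReal.ofReal (‖deflection σ u‖ ^ 2 / (2 * ‖u‖ ^ 2)) *
      φ (deflection σ u) ≤ 2 ^ d * I :=
    (lintegral_jacobian_mul_comp_deflection_le volume hσ φ).trans_eq
      (lintegral_bracket_sub_half_smul_rpow_neg v β)
  calc ∫⁻ u : Vel d, ENNReal.ofReal (‖u‖ * (bracket v + ‖u‖) ^ (-β) *
        bracket (v - (1 / 2 : ℝ) • deflection σ u) ^ (-β))
      ≤ ∫⁻ u : Vel d, (ENNReal.ofReal 2 * ENNReal.ofReal (bracket v ^ (1 - β)) *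
          (ENNReal.ofReal (‖deflection σ u‖ ^ 2 / (2 * ‖u‖ ^ 2)) * φ (deflection σ u)) +
        ENNReal.ofReal (4 ^ β) * (ENNReal.ofReal (bracket v ^ (-β)) *
          ENNReal.ofReal ((bracket v + ‖u‖) ^ (1 - β)))) := by
        refine lintegral_mono fun u => ?_
        have := bracket_pos (v - (1 / 2 : ℝ) • deflection σ u)
        grw [norm_mul_rpow_mul_bracket_rpow_le hβ3 σ v u, ENNReal.ofReal_add_le]
        apply le_of_eq
        simp only [hφ]
        repeat rw [ENNReal.ofReal_mul (by positivity)]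
        rw [mul_assoc (ENNReal.ofReal (4 ^ β))]
    _ = ENNReal.ofReal 2 * ENNReal.ofReal (bracket v ^ (1 - β)) *
          (∫⁻ u, ENNReal.ofReal (‖deflection σ u‖ ^ 2 / (2 * ‖u‖ ^ 2)) * φ (deflection σ u)) +
        ENNReal.ofReal (4 ^ β) * (ENNReal.ofReal (bracket v ^ (-β)) *
          ∫⁻ u : Vel d, ENNReal.ofReal ((bracket v + ‖u‖) ^ (1 - β))) := by
        rw [lintegral_add_right _ (by fun_prop), lintegral_const_mul' _ _ (by finiteness),
          lintegral_const_mul' _ _ (by finiteness), lintegral_const_mul' _ _ (by finiteness)]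
    _ ≤ (ENNReal.ofReal 2 * (2 ^ d * I) + ENNReal.ofReal (4 ^ β) * J) *
          ENNReal.ofReal (bracket v ^ (1 - β)) := by
        grw [hchange, ofReal_bracket_rpow_mul_lintegral_le (by linarith) v]
        exact le_of_eq (by ring)

lemma norm_vPre_sub_vsPre (v w : Vel d) (σ : Sph d) : ‖vPre v w σ - vsPre v w σ‖ = ‖v - w‖ := by
  have hsub : vPre v w σ - vsPre v w σ = ‖v - w‖ • (σ : Vel d) := by
    unfold vPre vsPre
    module
  rw [hsub, norm_smul, norm_norm, norm_eq_of_mem_sphere, mul_one]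

lemma norm_sq_vPre_add_norm_sq_vsPre (v w : Vel d) (σ : Sph d) :
    ‖vPre v w σ‖ ^ 2 + ‖vsPre v w σ‖ ^ 2 = ‖v‖ ^ 2 + ‖w‖ ^ 2 := by
  have hpre := parallelogram_law_with_norm ℝ (vPre v w σ) (vsPre v w σ)
  have hpost := parallelogram_law_with_norm ℝ v w
  have hsum : vPre v w σ + vsPre v w σ = v + w := by
    unfold vPre vsPre
    module
  rw [norm_vPre_sub_vsPre, hsum] at hpre
  linarith

lemma bracket_add_norm_sub_sq_le (v w : Vel d) (σ : Sph d) :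
    (bracket v + ‖v - w‖) ^ 2 ≤ 6 * (bracket (vPre v w σ) ^ 2 + bracket (vsPre v w σ) ^ 2) := by
  have henergy := norm_sq_vPre_add_norm_sq_vsPre v w σ
  have hparallelogram := parallelogram_law_with_norm ℝ v w
  have hsq := bracket_sq v
  simp only [bracket_sq]
  nlinarith [sq_nonneg (bracket v - ‖v - w‖), sq_nonneg ‖v + w‖, sq_nonneg ‖w‖]

lemma rpow_neg_mul_rpow_neg_le {x y s β : ℝ} (hx : 0 < x) (hy : 0 < y) (hs : 0 < s) (hβ : 0 ≤ β)
    (h : s ^ 2 ≤ 6 * (x ^ 2 + y ^ 2)) :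
    x ^ (-β) * y ^ (-β) ≤ 4 ^ β * s ^ (-β) * (x ^ (-β) + y ^ (-β)) := by
  wlog hxy : x ≤ y generalizing x y
  · linarith [this hy hx (by linarith) (by linarith)]
  have hy_ge : s / 4 ≤ y := by nlinarith
  calc x ^ (-β) * y ^ (-β) ≤ x ^ (-β) * (4 ^ β * s ^ (-β)) := by
        gcongr
        exact rpow_neg_le_of_div_four_le hs hβ hy_ge
    _ ≤ 4 ^ β * s ^ (-β) * (x ^ (-β) + y ^ (-β)) := by
        rw [mul_comm]
        gcongr
        exact le_add_of_nonneg_right (by positivity)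

lemma vPre_eq_sub_deflection (v w : Vel d) (σ : Sph d) :
    vPre v w σ = v - (1 / 2 : ℝ) • deflection (σ : Vel d) (v - w) := by
  unfold vPre deflection
  module

lemma vPre_neg (v w : Vel d) (σ : Sph d) : vPre v w (-σ) = vsPre v w σ := by
  simp only [vPre, vsPre, coe_neg_sphere, smul_neg, sub_eq_add_neg]

/-- The contribution of the weight at `v_*'` is obtained from this one by changing `σ` to `-σ`. -/
lemma lintegral_norm_mul_bracket_vPre_rpow_le {β : ℝ} (hβ : d + 1 < β) (hβ3 : 3 ≤ β) :
    ∃ K : ℝ≥0∞, K < ∞ ∧ ∀ v : Vel d,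
      ∫⁻ z, ENNReal.ofReal (‖v - z.1‖ * (bracket v + ‖v - z.1‖) ^ (-β) *
        bracket (vPre v z.1 z.2) ^ (-β)) ∂(collMeasure d) ≤
          K * ENNReal.ofReal (bracket v ^ (1 - β)) := by
  obtain ⟨K, hK, hbound⟩ := lintegral_norm_mul_rpow_mul_bracket_rpow_le hβ hβ3
  refine ⟨K * sphereMass d, ENNReal.mul_lt_top hK sphereMass_lt_top, fun v => ?_⟩
  have hmeas : Measurable fun z : Vel d × Sph d => ENNReal.ofReal
      (‖v - z.1‖ * (bracket v + ‖v - z.1‖) ^ (-β) * bracket (vPre v z.1 z.2) ^ (-β)) := by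
    unfold vPre
    fun_prop
  rw [collMeasure, lintegral_prod_symm' _ hmeas]
  calc ∫⁻ σ : Sph d, ∫⁻ w : Vel d, ENNReal.ofReal (‖v - w‖ * (bracket v + ‖v - w‖) ^ (-β) *
        bracket (vPre v w σ) ^ (-β)) ∂volume ∂(volume : Measure (Vel d)).toSphere
      ≤ ∫⁻ _ : Sph d, K * ENNReal.ofReal (bracket v ^ (1 - β))
          ∂(volume : Measure (Vel d)).toSphere := by
        refine lintegral_mono fun σ => ?_
        simp only [vPre_eq_sub_deflection]
        rw [lintegral_sub_left_eq_self (fun u : Vel d => ENNReal.ofReal (‖u‖ *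
          (bracket v + ‖u‖) ^ (-β) * bracket (v - (1 / 2 : ℝ) • deflection (σ : Vel d) u) ^ (-β)))]
        exact hbound σ v (norm_eq_of_mem_sphere σ)
    _ = K * sphereMass d * ENNReal.ofReal (bracket v ^ (1 - β)) := by
        rw [lintegral_const, mul_right_comm, sphereMass]

lemma lintegral_collMeasure_neg {f : Vel d × Sph d → ℝ≥0∞} (hf : Measurable f) :
    ∫⁻ z, f (z.1, -z.2) ∂(collMeasure d) = ∫⁻ z, f z ∂(collMeasure d) := by
  have hneg : Measurable fun z : Vel d × Sph d => f (z.1, -z.2) := hf.comp (by fun_prop)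
  rw [collMeasure, lintegral_prod _ hneg.aemeasurable, lintegral_prod _ hf.aemeasurable]
  exact lintegral_congr fun w => lintegral_toSphere_neg volume (hf.comp measurable_prodMk_left)

lemma lintegral_gain_kernel_le {β : ℝ} (hβ : d + 1 < β) (hβ3 : 3 ≤ β) :
    ∃ K : ℝ≥0∞, K < ∞ ∧ ∀ v : Vel d,
      ∫⁻ z, ENNReal.ofReal (‖v - z.1‖ *
        (bracket (vPre v z.1 z.2) ^ (-β) * bracket (vsPre v z.1 z.2) ^ (-β))) ∂(collMeasure d) ≤
          K * ENNReal.ofReal (bracket v ^ (1 - β)) := by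
  obtain ⟨K, hK, hbound⟩ := lintegral_norm_mul_bracket_vPre_rpow_le hβ hβ3
  refine ⟨ENNReal.ofReal (4 ^ β) * (K + K), by finiteness, fun v => ?_⟩
  set A : Vel d × Sph d → ℝ≥0∞ := fun z => ENNReal.ofReal
    (‖v - z.1‖ * (bracket v + ‖v - z.1‖) ^ (-β) * bracket (vPre v z.1 z.2) ^ (-β)) with hA
  have hA_meas : Measurable A := by
    simp only [hA, vPre]
    fun_prop
  have hpointwise : ∀ z : Vel d × Sph d, ENNReal.ofReal (‖v - z.1‖ *
      (bracket (vPre v z.1 z.2) ^ (-β) * bracket (vsPre v z.1 z.2) ^ (-β))) ≤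
        ENNReal.ofReal (4 ^ β) * (A z + A (z.1, -z.2)) := fun z => by
    have hv := bracket_pos v
    have hx := bracket_pos (vPre v z.1 z.2)
    have hy := bracket_pos (vsPre v z.1 z.2)
    simp only [hA, vPre_neg]
    rw [← ENNReal.ofReal_add (by positivity) (by positivity), ← ENNReal.ofReal_mul (by positivity)]
    refine ENNReal.ofReal_le_ofReal ?_
    grw [rpow_neg_mul_rpow_neg_le hx hy (s := bracket v + ‖v - z.1‖) (by positivity) (by linarith)
      (bracket_add_norm_sub_sq_le v z.1 z.2)]
    exact le_of_eq (by ring)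
  grw [lintegral_mono hpointwise, lintegral_const_mul' _ _ (by finiteness),
    lintegral_add_left hA_meas, lintegral_collMeasure_neg hA_meas, hbound v]
  exact le_of_eq (by ring)

lemma norm_sub_le_two_mul_bracket_mul_bracket (v w : Vel d) :
    ‖v - w‖ ≤ 2 * (bracket v * bracket w) := by
  nlinarith [norm_sub_le v w, norm_le_bracket v, norm_le_bracket w, one_le_bracket v,
    one_le_bracket w]

lemma lintegral_loss_kernel_le {β : ℝ} (hβ : (d : ℝ) + 1 < β) :
    ∃ K : ℝ≥0∞, K < ∞ ∧ ∀ v : Vel d,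
      ∫⁻ z, ENNReal.ofReal (‖v - z.1‖ * (bracket v ^ (-β) * bracket z.1 ^ (-β)))
        ∂(collMeasure d) ≤ K * ENNReal.ofReal (bracket v ^ (1 - β)) := by
  have htop : ∫⁻ w : Vel d, ENNReal.ofReal (bracket w ^ (1 - β)) < ∞ := by
    simpa using lintegral_bracket_rpow_neg_lt_top (d := d) (β := β - 1) (by linarith)
  have hmul : ∀ w : Vel d, bracket w ^ (1 - β) = bracket w * bracket w ^ (-β) := fun w => by
    rw [sub_eq_add_neg, Real.rpow_add (bracket_pos w), Real.rpow_one]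
  refine ⟨ENNReal.ofReal 2 * ((∫⁻ w : Vel d, ENNReal.ofReal (bracket w ^ (1 - β))) * sphereMass d),
    by have := sphereMass_lt_top (d := d); finiteness, fun v => ?_⟩
  have hpointwise : ∀ z : Vel d × Sph d,
      ENNReal.ofReal (‖v - z.1‖ * (bracket v ^ (-β) * bracket z.1 ^ (-β))) ≤
        ENNReal.ofReal 2 * ENNReal.ofReal (bracket v ^ (1 - β)) *
          ENNReal.ofReal (bracket z.1 ^ (1 - β)) := fun z => by
      have hv := bracket_pos v
      have hw := bracket_pos z.1
      rw [← ENNReal.ofReal_mul (by norm_num),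
        ← ENNReal.ofReal_mul (by positivity), hmul, hmul]
      refine ENNReal.ofReal_le_ofReal ?_
      grw [norm_sub_le_two_mul_bracket_mul_bracket v z.1]
      exact le_of_eq (by ring)
  have hprod : ∫⁻ z : Vel d × Sph d, ENNReal.ofReal (bracket z.1 ^ (1 - β)) ∂(collMeasure d) =
      (∫⁻ w : Vel d, ENNReal.ofReal (bracket w ^ (1 - β))) * sphereMass d := by
    rw [collMeasure, lintegral_prod _ (by fun_prop)]
    simp only [lintegral_const, sphereMass]
    exact lintegral_mul_const _ (by fun_prop)
  grw [lintegral_mono hpointwise, lintegral_const_mul' _ _ (by finiteness), hprod]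
  exact le_of_eq (by ring)

end Kernel

open Set Metric

variable {d : ℕ}

/-- The power `⟨v⟩^a` of the bracket, with values in `[0, ∞]`. -/
def wt (a : ℝ) (v : Vel d) : ℝ≥0∞ := ENNReal.ofReal (bracket v ^ a)

lemma wt_ne_top (a : ℝ) (v : Vel d) : wt a v ≠ ∞ := ENNReal.ofReal_ne_top

lemma wt_zero (v : Vel d) : wt 0 v = 1 := by simp [wt]

lemma wt_add (a b : ℝ) (v : Vel d) : wt (a + b) v = wt a v * wt b v := by
  rw [wt, Real.rpow_add (bracket_pos v),
    ENNReal.ofReal_mul (Real.rpow_nonneg (bracket_pos v).le _)]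
  rfl

lemma wt_mul_wt_neg (a : ℝ) (v : Vel d) : wt a v * wt (-a) v = 1 := by
  rw [← wt_add, add_neg_cancel, wt_zero]

lemma wt_rpow (a r : ℝ) (v : Vel d) : wt a v ^ r = wt (a * r) v := by
  rw [wt, wt, ENNReal.ofReal_rpow_of_pos (Real.rpow_pos_of_pos (bracket_pos v) a),
    ← Real.rpow_mul (bracket_pos v).le]

@[fun_prop]
lemma measurable_wt (a : ℝ) : Measurable (wt (d := d) a) := by
  unfold wt
  fun_prop

lemma enorm_le_wt_one (v : Vel d) : ‖v‖ₑ ≤ wt 1 v := by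
  rw [wt, Real.rpow_one, ← ofReal_norm]
  exact ENNReal.ofReal_le_ofReal (norm_le_bracket v)

lemma ofReal_mul_bracket (v w x y : Vel d) (a b : ℝ) :
    ENNReal.ofReal (‖v - w‖ * (bracket x ^ a * bracket y ^ b)) =
      ‖v - w‖ₑ * (wt a x * wt b y) := by
  rw [ENNReal.ofReal_mul (norm_nonneg _),
    ENNReal.ofReal_mul (Real.rpow_nonneg (bracket_pos x).le a), ofReal_norm]
  rfl

/-- The collision integral `∫ |v - v_*| φ ψ dσ dv_*` of two nonnegative functions, where `φ` and `ψ`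
are evaluated at the two components of `T (v, v_*, σ)`. -/
def collInt (T : Vel d × Vel d × Sph d → Vel d × Vel d) (φ ψ : Vel d → ℝ≥0∞) (v : Vel d) : ℝ≥0∞ :=
  ∫⁻ z, ‖v - z.1‖ₑ * (φ (T (v, z)).1 * ψ (T (v, z)).2) ∂(collMeasure d)

/-- The common properties of the maps `(v, v_*, σ) ↦ (v', v_*')` and `(v, v_*, σ) ↦ (v, v_*)` on
which the estimates of the gain and the loss part rest. -/
structure IsCollisionMap (T : Vel d × Vel d × Sph d → Vel d × Vel d) : Prop where
  measurable : Measurable T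
  lintegral_comp : ∀ {H : Vel d × Vel d → ℝ≥0∞}, Measurable H →
    ∫⁻ z, H (T z) ∂(volume.prod (collMeasure d)) =
      sphereMass d * ∫⁻ z, H z ∂((volume : Measure (Vel d)).prod volume)
  norm_sub : ∀ z, ‖(T z).1 - (T z).2‖ = ‖z.1 - z.2.1‖
  bracket_le : ∀ z, bracket z.1 ≤ bracket (T z).1 * bracket (T z).2
  kernel_le : ∀ β : ℝ, 2 + (d : ℝ) < β → ∃ K < ∞, ∀ v : Vel d,
    collInt T (wt (-β)) (wt (-β)) v ≤ K * wt (1 - β) v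

lemma bracket_le_bracket_vPre_mul_bracket_vsPre (v vs : Vel d) (σ : Sph d) :
    bracket v ≤ bracket (vPre v vs σ) * bracket (vsPre v vs σ) := by
  simp only [bracket]
  rw [← Real.sqrt_mul (by positivity)]
  refine Real.sqrt_le_sqrt ?_
  nlinarith [norm_sq_vPre_add_norm_sq_vsPre v vs σ, sq_nonneg ‖vs‖,
    mul_nonneg (sq_nonneg ‖vPre v vs σ‖) (sq_nonneg ‖vsPre v vs σ‖)]

lemma isCollisionMap_collMap (hd : 0 < d) : IsCollisionMap (collMap (d := d)) where
  measurable := measurable_collMap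
  lintegral_comp := lintegral_collMap hd
  norm_sub _ := norm_vPre_sub_vsPre _ _ _
  bracket_le _ := bracket_le_bracket_vPre_mul_bracket_vsPre _ _ _
  kernel_le β hβ := by
    have hd1 : (1 : ℝ) ≤ d := mod_cast hd
    obtain ⟨K, hK, h⟩ := lintegral_gain_kernel_le (d := d) (β := β) (by linarith) (by linarith)
    simp_rw [ofReal_mul_bracket] at h
    exact ⟨K, hK, h⟩

/-- The map `(v, v_*, σ) ↦ (v, v_*)`. -/
def lossMap (z : Vel d × Vel d × Sph d) : Vel d × Vel d := (z.1, z.2.1)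

lemma measurable_lossMap : Measurable (lossMap (d := d)) := by
  unfold lossMap; fun_prop

lemma lintegral_lossMap {H : Vel d × Vel d → ℝ≥0∞} (hH : Measurable H) :
    ∫⁻ z, H (lossMap z) ∂(volume.prod (collMeasure d)) =
      sphereMass d * ∫⁻ z, H z ∂((volume : Measure (Vel d)).prod volume) := by
  have hHloss : Measurable fun z : Vel d × Vel d × Sph d => H (lossMap z) :=
    hH.comp measurable_lossMap
  rw [lintegral_prod _ hHloss.aemeasurable,
    lintegral_prod _ hH.aemeasurable, ← lintegral_const_mul _ hH.lintegral_prod_right']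
  refine lintegral_congr fun v => ?_
  have hHv : Measurable fun w : Vel d => H (v, w) := hH.comp (by fun_prop)
  have hHvσ : Measurable fun y : Vel d × Sph d => H (v, y.1) := hH.comp (by fun_prop)
  simp only [lossMap]
  rw [collMeasure, lintegral_prod _ hHvσ.aemeasurable]
  simp only [lintegral_const]
  rw [lintegral_mul_const _ hHv, mul_comm]
  rfl

lemma isCollisionMap_lossMap : IsCollisionMap (lossMap (d := d)) where
  measurable := measurable_lossMap
  lintegral_comp := lintegral_lossMap
  norm_sub _ := rfl
  bracket_le _ := le_mul_of_one_le_right (bracket_pos _).le (one_le_bracket _)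
  kernel_le β hβ := by
    obtain ⟨K, hK, h⟩ := lintegral_loss_kernel_le (d := d) (β := β) (by linarith)
    simp_rw [ofReal_mul_bracket] at h
    exact ⟨K, hK, h⟩

namespace IsCollisionMap

variable {T : Vel d × Vel d × Sph d → Vel d × Vel d} {φ ψ φ' ψ' : Vel d → ℝ≥0∞}

lemma quasiMeasurePreserving (hT : IsCollisionMap T) :
    Measure.QuasiMeasurePreserving T (volume.prod (collMeasure d))
      ((volume : Measure (Vel d)).prod volume) := by
  refine ⟨hT.measurable, Measure.AbsolutelyContinuous.mk fun s hs hs0 => ?_⟩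
  rw [Measure.map_apply hT.measurable hs, ← lintegral_indicator_one (hT.measurable hs)]
  have hcomp := hT.lintegral_comp (H := s.indicator 1) (measurable_one.indicator hs)
  rwa [lintegral_indicator_one hs, hs0, mul_zero] at hcomp

lemma ae_ae (hT : IsCollisionMap T) {r q : Vel d → Prop} (hr : ∀ᵐ v, r v) (hq : ∀ᵐ v, q v) :
    ∀ᵐ v, ∀ᵐ z ∂(collMeasure d), r (T (v, z)).1 ∧ q (T (v, z)).2 := by
  refine Measure.ae_ae_of_ae_prod (p := fun z => r (T z).1 ∧ q (T z).2) ?_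
  filter_upwards [(Measure.quasiMeasurePreserving_fst.comp hT.quasiMeasurePreserving).ae hr,
    (Measure.quasiMeasurePreserving_snd.comp hT.quasiMeasurePreserving).ae hq] with z hz1 hz2
  exact ⟨hz1, hz2⟩

lemma wt_le (hT : IsCollisionMap T) {a : ℝ} (ha : 0 ≤ a) (z : Vel d × Vel d × Sph d) :
    wt a z.1 ≤ wt a (T z).1 * wt a (T z).2 := by
  unfold wt
  rw [← ENNReal.ofReal_mul (Real.rpow_nonneg (bracket_pos _).le _),
    ← Real.mul_rpow (bracket_pos _).le (bracket_pos _).le]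
  exact ENNReal.ofReal_le_ofReal (Real.rpow_le_rpow (bracket_pos _).le (hT.bracket_le z) ha)

lemma measurable_collInt (hT : IsCollisionMap T) (hφ : Measurable φ) (hψ : Measurable ψ) :
    Measurable (collInt T φ ψ) := by
  have := hT.measurable
  exact Measurable.lintegral_prod_right' (f := fun z : Vel d × Vel d × Sph d =>
    ‖z.1 - z.2.1‖ₑ * (φ (T z).1 * ψ (T z).2)) (by fun_prop)

lemma collInt_mono_ae (hT : IsCollisionMap T) (hφ : φ ≤ᵐ[volume] φ') (hψ : ψ ≤ᵐ[volume] ψ') :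
    collInt T φ ψ ≤ᵐ[volume] collInt T φ' ψ' := by
  filter_upwards [hT.ae_ae hφ hψ] with v hv
  refine lintegral_mono_ae ?_
  filter_upwards [hv] with z ⟨hz1, hz2⟩
  gcongr

lemma collInt_congr_ae (hT : IsCollisionMap T) (hφ : φ =ᵐ[volume] φ') (hψ : ψ =ᵐ[volume] ψ') :
    collInt T φ ψ =ᵐ[volume] collInt T φ' ψ' :=
  (hT.collInt_mono_ae hφ.le hψ.le).antisymm (hT.collInt_mono_ae hφ.symm.le hψ.symm.le)

lemma collInt_const_mul (hT : IsCollisionMap T) (hφ : Measurable φ) (hψ : Measurable ψ)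
    (a b : ℝ≥0∞) (v : Vel d) :
    collInt T (fun w => a * φ w) (fun w => b * ψ w) v = a * b * collInt T φ ψ v := by
  have := hT.measurable
  rw [collInt, collInt, ← lintegral_const_mul _ (by fun_prop)]
  refine lintegral_congr fun z => ?_
  ring

lemma collInt_eq_lintegral_withDensity (hT : IsCollisionMap T) (hφ : Measurable φ)
    (hψ : Measurable ψ) (v : Vel d) :
    collInt T φ ψ v = ∫⁻ z, φ (T (v, z)).1 * ψ (T (v, z)).2
      ∂(collMeasure d).withDensity (fun z => ‖v - z.1‖ₑ) := by
  have := hT.measurable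
  rw [lintegral_withDensity_eq_lintegral_mul _ (by fun_prop) (by fun_prop)]
  rfl

lemma collInt_mul_le (hT : IsCollisionMap T) {P P' : ℝ} (hP : P.HolderConjugate P')
    (hφ : Measurable φ) (hψ : Measurable ψ) (hφ' : Measurable φ') (hψ' : Measurable ψ')
    (v : Vel d) :
    collInt T (fun w => φ w * φ' w) (fun w => ψ w * ψ' w) v ≤
      collInt T (fun w => φ w ^ P) (fun w => ψ w ^ P) v ^ (1 / P) *
        collInt T (fun w => φ' w ^ P') (fun w => ψ' w ^ P') v ^ (1 / P') := by
  have := hT.measurable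
  have hholder := ENNReal.lintegral_mul_le_Lp_mul_Lq
    ((collMeasure d).withDensity fun z => ‖v - z.1‖ₑ) hP
    (f := fun z => φ (T (v, z)).1 * ψ (T (v, z)).2)
    (g := fun z => φ' (T (v, z)).1 * ψ' (T (v, z)).2) (by fun_prop) (by fun_prop)
  simp only [Pi.mul_apply, ENNReal.mul_rpow_of_nonneg _ _ hP.nonneg,
    ENNReal.mul_rpow_of_nonneg _ _ hP.symm.nonneg, mul_mul_mul_comm (φ _) (ψ _)] at hholder
  rwa [hT.collInt_eq_lintegral_withDensity (by fun_prop) (by fun_prop),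
    hT.collInt_eq_lintegral_withDensity (by fun_prop) (by fun_prop),
    hT.collInt_eq_lintegral_withDensity (by fun_prop) (by fun_prop)]

lemma collInt_mul_wt_le (hT : IsCollisionMap T) {α : ℝ} (hα : 0 ≤ α) (φ ψ : Vel d → ℝ≥0∞)
    (v : Vel d) :
    collInt T φ ψ v * wt α v ≤ collInt T (fun w => φ w * wt α w) (fun w => ψ w * wt α w) v := by
  rw [collInt, ← lintegral_mul_const' _ _ (wt_ne_top _ _)]
  refine lintegral_mono fun z => ?_
  grw [hT.wt_le hα (v, z)]
  exact le_of_eq (by ring)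

lemma collInt_mul_wt_rpow_le_of_holderConjugate (hT : IsCollisionMap T) {P P' α : ℝ}
    (hP : P.HolderConjugate P') (hα : 2 + (d : ℝ) * P'⁻¹ < α) :
    ∃ K < ∞, ∀ {φ ψ : Vel d → ℝ≥0∞}, Measurable φ → Measurable ψ → ∀ v,
      (collInt T φ ψ v * wt (α - P'⁻¹) v) ^ P ≤
        K * collInt T (fun w => (φ w * wt α w) ^ P) (fun w => (ψ w * wt α w) ^ P) v := by
  have hP0 := hP.pos
  have hP'0 := hP.symm.pos
  have hβ : 2 + (d : ℝ) < α * P' := by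
    calc 2 + (d : ℝ) ≤ 2 * P' + d := by linarith [hP.symm.lt]
      _ = (2 + (d : ℝ) * P'⁻¹) * P' := by field_simp
      _ < α * P' := by gcongr
  obtain ⟨K, hK, hker⟩ := hT.kernel_le _ hβ
  refine ⟨K ^ (P / P'), ENNReal.rpow_lt_top_of_nonneg (by positivity) hK.ne,
    fun {φ ψ} hφ hψ v => ?_⟩
  set J := collInt T (fun w => (φ w * wt α w) ^ P) (fun w => (ψ w * wt α w) ^ P) v
  have hholder : collInt T φ ψ v ≤ J ^ (1 / P) * (K * wt (1 - α * P') v) ^ (1 / P') := by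
    have h := hT.collInt_mul_le hP (φ := fun w => φ w * wt α w) (ψ := fun w => ψ w * wt α w)
      (by fun_prop) (by fun_prop) (measurable_wt (-α)) (measurable_wt (-α)) v
    simp only [mul_assoc, wt_mul_wt_neg, mul_one, wt_rpow, neg_mul] at h
    grw [h, hker v]
  calc (collInt T φ ψ v * wt (α - P'⁻¹) v) ^ P
      ≤ (J ^ (1 / P) * (K * wt (1 - α * P') v) ^ (1 / P') * wt (α - P'⁻¹) v) ^ P := by gcongr
    _ = (J ^ (1 / P) * K ^ (1 / P')) ^ P := by
        congr 1
        rw [ENNReal.mul_rpow_of_nonneg _ _ (by positivity), wt_rpow, mul_assoc, mul_assoc,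
          ← wt_add, show (1 - α * P') * (1 / P') + (α - P'⁻¹) = 0 by field_simp; ring, wt_zero,
          mul_one]
    _ = K ^ (P / P') * J := by
        rw [ENNReal.mul_rpow_of_nonneg _ _ hP0.le, ← ENNReal.rpow_mul, ← ENNReal.rpow_mul,
          one_div_mul_cancel hP0.ne', ENNReal.rpow_one, mul_comm, one_div_mul_eq_div]

lemma collInt_mul_wt_rpow_le (hT : IsCollisionMap T) {P α : ℝ} (hP : 1 ≤ P)
    (hα : 2 + (d : ℝ) * (1 - P⁻¹) < α) :
    ∃ K < ∞, ∀ {φ ψ : Vel d → ℝ≥0∞}, Measurable φ → Measurable ψ → ∀ v,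
      (collInt T φ ψ v * wt (α - (1 - P⁻¹)) v) ^ P ≤
        K * collInt T (fun w => (φ w * wt α w) ^ P) (fun w => (ψ w * wt α w) ^ P) v := by
  rcases hP.eq_or_lt with rfl | hP1
  · refine ⟨1, ENNReal.one_lt_top, fun {φ ψ} _ _ v => ?_⟩
    simp only [inv_one, sub_self, mul_zero, add_zero] at hα
    simpa only [inv_one, sub_self, sub_zero, ENNReal.rpow_one, one_mul] using
      hT.collInt_mul_wt_le (by linarith : 0 ≤ α) φ ψ v
  · have hconj := Real.HolderConjugate.conjExponent hP1
    rw [← eq_sub_of_add_eq' hconj.inv_add_inv_eq_one] at hα ⊢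
    exact hT.collInt_mul_wt_rpow_le_of_holderConjugate hconj hα

lemma lintegral_collInt_le (hT : IsCollisionMap T) (hφ : Measurable φ) (hψ : Measurable ψ) :
    ∫⁻ v, collInt T φ ψ v ≤ sphereMass d *
      ((∫⁻ v, φ v * wt 1 v) * (∫⁻ v, ψ v) + (∫⁻ v, φ v) * (∫⁻ v, ψ v * wt 1 v)) := by
  have hTm := hT.measurable
  calc ∫⁻ v, collInt T φ ψ v
      = ∫⁻ z, ‖(T z).1 - (T z).2‖ₑ * (φ (T z).1 * ψ (T z).2) ∂(volume.prod (collMeasure d)) := by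
        simp_rw [← ofReal_norm, hT.norm_sub, ofReal_norm]
        exact (lintegral_prod (fun z : Vel d × Vel d × Sph d =>
          ‖z.1 - z.2.1‖ₑ * (φ (T z).1 * ψ (T z).2)) (by fun_prop)).symm
    _ = sphereMass d * ∫⁻ y, ‖y.1 - y.2‖ₑ * (φ y.1 * ψ y.2)
          ∂((volume : Measure (Vel d)).prod volume) :=
        hT.lintegral_comp (H := fun y => ‖y.1 - y.2‖ₑ * (φ y.1 * ψ y.2)) (by fun_prop)
    _ ≤ sphereMass d * ∫⁻ y, ((φ y.1 * wt 1 y.1) * ψ y.2 + φ y.1 * (ψ y.2 * wt 1 y.2))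
          ∂((volume : Measure (Vel d)).prod volume) := by
        gcongr with y
        grw [enorm_sub_le, enorm_le_wt_one y.1, enorm_le_wt_one y.2]
        exact le_of_eq (by ring)
    _ = _ := by
        rw [lintegral_add_left (by fun_prop),
          lintegral_prod_mul (f := fun v => φ v * wt 1 v) (by fun_prop) (by fun_prop),
          lintegral_prod_mul (g := fun v => ψ v * wt 1 v) (by fun_prop) (by fun_prop)]

lemma lintegral_collInt_mul_wt_rpow_le (hT : IsCollisionMap T) {P α : ℝ} (hP : 1 ≤ P)
    (hα : 2 + (d : ℝ) * (1 - P⁻¹) < α) :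
    ∃ K < ∞, ∀ {φ ψ : Vel d → ℝ≥0∞}, Measurable φ → Measurable ψ →
      ∫⁻ v, (collInt T φ ψ v * wt (α - (1 - P⁻¹)) v) ^ P ≤ K *
        ((∫⁻ v, (φ v * wt α v) ^ P) * (∫⁻ v, (ψ v * wt (α + P⁻¹) v) ^ P) +
          (∫⁻ v, (φ v * wt (α + P⁻¹) v) ^ P) * (∫⁻ v, (ψ v * wt α v) ^ P)) := by
  have hP0 : 0 < P := by linarith
  obtain ⟨K, hK, hpointwise⟩ := hT.collInt_mul_wt_rpow_le hP hα
  refine ⟨K * sphereMass d, ENNReal.mul_lt_top hK sphereMass_lt_top, fun {φ ψ} hφ hψ => ?_⟩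
  have hweight (χ : Vel d → ℝ≥0∞) : (∫⁻ v, (χ v * wt α v) ^ P * wt 1 v) =
      ∫⁻ v, (χ v * wt (α + P⁻¹) v) ^ P := by
    refine lintegral_congr fun v => ?_
    rw [wt_add, ← mul_assoc, ENNReal.mul_rpow_of_nonneg _ (wt P⁻¹ v) hP0.le, wt_rpow,
      inv_mul_cancel₀ hP0.ne']
  have hφP : Measurable fun v => (φ v * wt α v) ^ P := by fun_prop
  have hψP : Measurable fun v => (ψ v * wt α v) ^ P := by fun_prop
  have hL1 := hT.lintegral_collInt_le hφP hψP
  rw [hweight, hweight, add_comm] at hL1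
  grw [lintegral_mono fun v => hpointwise hφ hψ v,
    lintegral_const_mul _ (hT.measurable_collInt hφP hψP), hL1, mul_assoc]

lemma eLpNorm_top_collInt_le (hT : IsCollisionMap T) {α : ℝ} (hα : 2 + (d : ℝ) < α) :
    ∃ C < ∞, ∀ φ ψ : Vel d → ℝ≥0∞, eLpNorm (fun v => collInt T φ ψ v * wt (α - 1) v) ∞ volume ≤
      C * (eLpNorm (fun v => φ v * wt α v) ∞ volume *
        eLpNorm (fun v => ψ v * wt α v) ∞ volume) := by
  obtain ⟨K, hK, hker⟩ := hT.kernel_le α hα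
  refine ⟨K, hK, fun φ ψ => ?_⟩
  have hbound (χ : Vel d → ℝ≥0∞) :
      χ ≤ᵐ[volume] fun v => eLpNorm (fun v => χ v * wt α v) ∞ volume * wt (-α) v := by
    filter_upwards [enorm_ae_le_eLpNormEssSup (fun v => χ v * wt α v) volume] with v hv
    calc χ v = χ v * wt α v * wt (-α) v := by rw [mul_assoc, wt_mul_wt_neg, mul_one]
      _ ≤ _ := by rw [eLpNorm_exponent_top]; gcongr; exact hv
  conv_lhs => rw [eLpNorm_exponent_top]
  refine eLpNormEssSup_le_of_ae_enorm_bound ?_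
  filter_upwards [hT.collInt_mono_ae (hbound φ) (hbound ψ)] with v hv
  rw [hT.collInt_const_mul (measurable_wt _) (measurable_wt _)] at hv
  rw [enorm_eq_self]
  grw [hv, hker v, mul_assoc, mul_assoc K, ← wt_add]
  rw [show 1 - α + (α - 1) = 0 by ring, wt_zero, mul_one, mul_comm]

lemma eLpNorm_collInt_le_of_ne_top (hT : IsCollisionMap T) {p : ℝ≥0∞} (hp1 : 1 ≤ p) (hp : p ≠ ∞)
    {α : ℝ} (hα : 2 + (d : ℝ) * (1 - p.toReal⁻¹) < α) :
    ∃ C < ∞, ∀ {φ ψ : Vel d → ℝ≥0∞}, Measurable φ → Measurable ψ →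
      eLpNorm (fun v => collInt T φ ψ v * wt (α - (1 - p.toReal⁻¹)) v) p volume ≤
        C * (eLpNorm (fun v => φ v * wt α v) p volume *
            eLpNorm (fun v => ψ v * wt (α + p.toReal⁻¹) v) p volume +
          eLpNorm (fun v => φ v * wt (α + p.toReal⁻¹) v) p volume *
            eLpNorm (fun v => ψ v * wt α v) p volume) := by
  have hp0 : p ≠ 0 := (zero_lt_one.trans_le hp1).ne'
  have hP1 : 1 ≤ p.toReal := by simpa using ENNReal.toReal_mono hp hp1
  obtain ⟨K, hK, hinteg⟩ := hT.lintegral_collInt_mul_wt_rpow_le hP1 hα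
  have hPinv : 0 ≤ p.toReal⁻¹ := by positivity
  refine ⟨K ^ p.toReal⁻¹, ENNReal.rpow_lt_top_of_nonneg hPinv hK.ne, fun {φ ψ} hφ hψ => ?_⟩
  simp only [eLpNorm_eq_lintegral_rpow_enorm_toReal hp0 hp, enorm_eq_self, one_div]
  grw [hinteg hφ hψ, ENNReal.mul_rpow_of_nonneg _ _ hPinv,
    ENNReal.rpow_add_le_add_rpow _ _ hPinv (inv_le_one_of_one_le₀ hP1)]
  simp only [ENNReal.mul_rpow_of_nonneg _ _ hPinv, le_refl]

lemma eLpNorm_collInt_le (hT : IsCollisionMap T) {p p' : ℝ≥0∞} (hp : p.HolderConjugate p') {α : ℝ}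
    (hα : 2 + (d : ℝ) * (p'⁻¹).toReal < α) :
    ∃ C < ∞, ∀ {φ ψ : Vel d → ℝ≥0∞}, AEMeasurable φ → AEMeasurable ψ →
      eLpNorm (fun v => collInt T φ ψ v * wt (α - (p'⁻¹).toReal) v) p volume ≤
        C * (eLpNorm (fun v => φ v * wt α v) p volume *
            eLpNorm (fun v => ψ v * wt (α + (p⁻¹).toReal) v) p volume +
          eLpNorm (fun v => φ v * wt (α + (p⁻¹).toReal) v) p volume *
            eLpNorm (fun v => ψ v * wt α v) p volume) := by
  have hsum := hp.inv_add_inv_eq_one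
  rcases eq_or_ne p ∞ with rfl | hpt
  · have hp'1 : p'⁻¹ = 1 := by simpa using hsum
    simp only [hp'1, ENNReal.toReal_one, mul_one, ENNReal.inv_top, ENNReal.toReal_zero,
      add_zero] at hα ⊢
    obtain ⟨C, hC, h⟩ := hT.eLpNorm_top_collInt_le hα
    exact ⟨C, hC, fun {φ ψ} _ _ => (h φ ψ).trans (by gcongr; exact le_self_add)⟩
  · have hp' : (p'⁻¹).toReal = 1 - p.toReal⁻¹ := by
      have hinv := congrArg ENNReal.toReal hsum
      rw [ENNReal.toReal_add (ENNReal.inv_ne_top.2 hp.ne_zero)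
        (ENNReal.inv_ne_top.2 hp.symm.ne_zero), ENNReal.toReal_inv p, ENNReal.toReal_one] at hinv
      linarith
    rw [hp'] at hα ⊢
    obtain ⟨C, hC, h⟩ := hT.eLpNorm_collInt_le_of_ne_top hp.one_le hpt hα
    refine ⟨C, hC, fun {φ ψ} hφ hψ => ?_⟩
    have hmk {χ : Vel d → ℝ≥0∞} (hχ : AEMeasurable χ) (a : ℝ) :
        eLpNorm (fun v => χ v * wt a v) p volume =
          eLpNorm (fun v => hχ.mk χ v * wt a v) p volume :=
      eLpNorm_congr_ae (hχ.ae_eq_mk.mul (ae_eq_refl (wt a)))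
    have hcoll : (fun v => collInt T φ ψ v * wt (α - (1 - p.toReal⁻¹)) v) =ᵐ[volume]
        fun v => collInt T (hφ.mk φ) (hψ.mk ψ) v * wt (α - (1 - p.toReal⁻¹)) v :=
      (hT.collInt_congr_ae hφ.ae_eq_mk hψ.ae_eq_mk).mul (ae_eq_refl (wt _))
    rw [ENNReal.toReal_inv p, hmk hφ, hmk hφ, hmk hψ, hmk hψ, eLpNorm_congr_ae hcoll]
    exact h hφ.measurable_mk hψ.measurable_mk

end IsCollisionMap

end Boltzmann

lemma integrable_exp_neg_mul_norm_sq {V : Type*} [NormedAddCommGroup V] [InnerProductSpace ℝ V]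
    [FiniteDimensional ℝ V] [MeasurableSpace V] [BorelSpace V] {b : ℝ} (hb : 0 < b) :
    Integrable fun v : V => Real.exp (-b * ‖v‖ ^ 2) := by
  have h := GaussianFourier.integrable_cexp_neg_mul_sq_norm_add (V := V) (b := b)
    (by simpa using hb) 0 0
  refine h.norm.congr (ae_of_all _ fun v => ?_)
  simp [Complex.norm_exp, ← Complex.ofReal_pow, ← Complex.ofReal_mul]

lemma norm_add_norm_le_norm_sub_add_norm_add {E : Type*} [NormedAddCommGroup E]
    [NormedSpace ℝ E] (v w : E) : ‖v‖ + ‖w‖ ≤ ‖v - w‖ + ‖v + w‖ := by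
  have hv := norm_add_le (v - w) (v + w)
  have hw := norm_sub_le (v + w) (v - w)
  rw [show v - w + (v + w) = (2 : ℝ) • v by module, norm_smul, Real.norm_ofNat] at hv
  rw [show v + w - (v - w) = (2 : ℝ) • w by module, norm_smul, Real.norm_ofNat] at hw
  linarith

namespace Boltzmann

variable {d : ℕ}

lemma maxwellian_pos (v : Vel d) : 0 < maxwellian v := by
  unfold maxwellian; positivity

lemma maxwellian_neg (v : Vel d) : maxwellian (-v) = maxwellian v := by
  simp [maxwellian]

@[fun_prop]
lemma measurable_maxwellian : Measurable (maxwellian (d := d)) := by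
  unfold maxwellian; fun_prop

lemma bracket_le_four_mul_exp (v : Vel d) : bracket v ≤ 4 * Real.exp (‖v‖ ^ 2 / 4) := by
  have hexp := Real.add_one_le_exp (‖v‖ ^ 2 / 4)
  nlinarith [bracket_sq v, one_le_bracket v]

lemma integrable_maxwellian_mul_bracket :
    Integrable fun v : Vel d => maxwellian v * bracket v := by
  refine ((integrable_exp_neg_mul_norm_sq (V := Vel d) (b := 1 / 4) (by norm_num)).const_mul
    ((2 * Real.pi) ^ (-(d : ℝ) / 2) * 4)).mono' (by fun_prop) (ae_of_all _ fun v => ?_)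
  rw [Real.norm_of_nonneg (mul_pos (maxwellian_pos v) (bracket_pos v)).le]
  calc maxwellian v * bracket v
      ≤ maxwellian v * (4 * Real.exp (‖v‖ ^ 2 / 4)) := by
        gcongr
        exacts [(maxwellian_pos v).le, bracket_le_four_mul_exp v]
    _ = (2 * Real.pi) ^ (-(d : ℝ) / 2) * 4 *
          (Real.exp (-‖v‖ ^ 2 / 2) * Real.exp (‖v‖ ^ 2 / 4)) := by
        rw [maxwellian]; ring
    _ = _ := by rw [← Real.exp_add]; ring_nf

lemma integrable_maxwellian : Integrable (maxwellian (d := d)) := by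
  refine integrable_maxwellian_mul_bracket.mono' (by fun_prop) (ae_of_all _ fun w => ?_)
  rw [Real.norm_of_nonneg (maxwellian_pos w).le]
  exact le_mul_of_one_le_right (maxwellian_pos w).le (one_le_bracket w)

lemma integrable_maxwellian_mul_norm_sub (v : Vel d) :
    Integrable fun w : Vel d => maxwellian w * ‖v - w‖ := by
  refine (integrable_maxwellian_mul_bracket.const_mul (2 * bracket v)).mono'
    (by fun_prop) (ae_of_all _ fun w => ?_)
  have hM := (maxwellian_pos w).le
  rw [Real.norm_of_nonneg (by positivity)]
  calc maxwellian w * ‖v - w‖ ≤ maxwellian w * (2 * (bracket v * bracket w)) := by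
        gcongr; exact norm_sub_le_two_mul_bracket_mul_bracket v w
    _ = 2 * bracket v * (maxwellian w * bracket w) := by ring

lemma integrable_maxwellian_mul_norm : Integrable fun w : Vel d => maxwellian w * ‖w‖ := by
  simpa using integrable_maxwellian_mul_norm_sub (0 : Vel d)

lemma integral_maxwellian_pos : 0 < ∫ w : Vel d, maxwellian w := by
  have hsupp : Function.support (maxwellian (d := d)) = Set.univ :=
    Set.eq_univ_of_forall fun w => (maxwellian_pos w).ne'
  rw [integral_pos_iff_support_of_nonneg (fun w => (maxwellian_pos w).le) integrable_maxwellian,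
    hsupp]
  exact NeZero.pos _

lemma integral_maxwellian_mul_norm_pos (hd : 0 < d) : 0 < ∫ w : Vel d, maxwellian w * ‖w‖ := by
  have : Nonempty (Fin d) := ⟨⟨0, hd⟩⟩
  have hsupp : Function.support (fun w : Vel d => maxwellian w * ‖w‖) = {0}ᶜ := by
    ext w; simp [(maxwellian_pos w).ne']
  rw [integral_pos_iff_support_of_nonneg
    (fun w => mul_nonneg (maxwellian_pos w).le (norm_nonneg w)) integrable_maxwellian_mul_norm,
    hsupp, measure_compl (measurableSet_singleton _) (by simp)]
  simp

/- Since `M` is even, `ν(v)` is also the integral of `M(w) |v + w|`; averaging both expressions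
removes the cancellation in `|v - w|`. -/
lemma add_le_two_mul_collFreq (v : Vel d) :
    (∫ w : Vel d, maxwellian w) * ‖v‖ + ∫ w : Vel d, maxwellian w * ‖w‖ ≤ 2 * collFreq v := by
  have hsub := integrable_maxwellian_mul_norm_sub v
  have hadd : Integrable fun w : Vel d => maxwellian w * ‖v + w‖ := by
    simpa [maxwellian_neg] using hsub.comp_neg
  have hsymm : ∫ w, maxwellian w * ‖v + w‖ = collFreq v := by
    rw [collFreq, ← integral_neg_eq_self]
    simp [maxwellian_neg, sub_eq_add_neg]
  calc (∫ w : Vel d, maxwellian w) * ‖v‖ + ∫ w : Vel d, maxwellian w * ‖w‖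
      = ∫ w : Vel d, maxwellian w * (‖v‖ + ‖w‖) := by
        simp_rw [mul_add]
        rw [integral_add (integrable_maxwellian.mul_const _) integrable_maxwellian_mul_norm,
          integral_mul_const]
    _ ≤ ∫ w : Vel d, (maxwellian w * ‖v - w‖ + maxwellian w * ‖v + w‖) := by
        simp_rw [← mul_add]
        refine integral_mono ?_ ?_ fun w => mul_le_mul_of_nonneg_left
          (norm_add_norm_le_norm_sub_add_norm_add v w) (maxwellian_pos w).le
        · simpa only [mul_add] using!
            (integrable_maxwellian.mul_const ‖v‖).add integrable_maxwellian_mul_norm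
        · simpa only [mul_add] using! hsub.add hadd
    _ = 2 * collFreq v := by rw [integral_add hsub hadd, hsymm, ← collFreq, two_mul]

lemma exists_mul_bracket_le_collFreq (hd : 0 < d) :
    ∃ c : ℝ, 0 < c ∧ ∀ v : Vel d, c * bracket v ≤ collFreq v := by
  set m₀ := ∫ w : Vel d, maxwellian w
  set m₁ := ∫ w : Vel d, maxwellian w * ‖w‖
  have hm : 0 < min m₀ m₁ :=
    lt_min integral_maxwellian_pos (integral_maxwellian_mul_norm_pos hd)
  refine ⟨min m₀ m₁ / 2, by positivity, fun v => ?_⟩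
  have hbracket : bracket v ≤ ‖v‖ + 1 := by
    simpa [bracket, add_comm] using bracket_le_bracket_add_norm_sub v 0
  calc min m₀ m₁ / 2 * bracket v ≤ (min m₀ m₁ * ‖v‖ + min m₀ m₁) / 2 := by nlinarith
    _ ≤ (m₀ * ‖v‖ + m₁) / 2 := by
        gcongr
        exacts [min_le_left _ _, min_le_right _ _]
    _ ≤ collFreq v := by linarith [add_le_two_mul_collFreq v]

lemma collFreq_nonneg (v : Vel d) : 0 ≤ collFreq v :=
  integral_nonneg fun w => mul_nonneg (maxwellian_pos w).le (norm_nonneg _)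

end Boltzmann

section Minkowski

variable {X Z : Type*} [MeasurableSpace X] [MeasurableSpace Z] {μ : Measure X} {ν : Measure Z}

lemma eLpNorm_two_eq {E : Type*} [TopologicalSpace E] [ContinuousENorm E] (f : X → E) :
    eLpNorm f 2 μ = (∫⁻ x, ‖f x‖ₑ ^ 2 ∂μ) ^ (1 / 2 : ℝ) := by
  simp [eLpNorm_eq_lintegral_rpow_enorm_toReal]

lemma eLpNorm_two_sq {E : Type*} [TopologicalSpace E] [ContinuousENorm E] (f : X → E) :
    eLpNorm f 2 μ ^ 2 = ∫⁻ x, ‖f x‖ₑ ^ 2 ∂μ := by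
  rw [eLpNorm_two_eq, ← ENNReal.rpow_natCast, ← ENNReal.rpow_mul]
  norm_num

lemma lintegral_mul_le_eLpNorm_two_mul_eLpNorm_two {f g : X → ℝ≥0∞} (hf : AEMeasurable f μ)
    (hg : AEMeasurable g μ) : ∫⁻ x, f x * g x ∂μ ≤ eLpNorm f 2 μ * eLpNorm g 2 μ := by
  simpa [eLpNorm_two_eq] using
    ENNReal.lintegral_mul_le_Lp_mul_Lq μ Real.HolderConjugate.two_two hf hg

/- Expand the square, exchange the integrals and apply Cauchy–Schwarz in `x`. -/
lemma eLpNorm_two_lintegral_le_of_measurable [SFinite μ] [SFinite ν] {f : X × Z → ℝ≥0∞}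
    (hf : Measurable f) :
    eLpNorm (fun x => ∫⁻ z, f (x, z) ∂ν) 2 μ ≤ ∫⁻ z, eLpNorm (fun x => f (x, z)) 2 μ ∂ν := by
  set N : Z → ℝ≥0∞ := fun z => eLpNorm (fun x => f (x, z)) 2 μ
  have hN : Measurable N := by
    have : Measurable fun z => ∫⁻ x, f (x, z) ^ 2 ∂μ := (hf.pow_const 2).lintegral_prod_left'
    simp only [N, eLpNorm_two_eq, enorm_eq_self]
    fun_prop
  refine (ENNReal.pow_right_strictMono two_ne_zero).le_iff_le.1 ?_
  calc eLpNorm (fun x => ∫⁻ z, f (x, z) ∂ν) 2 μ ^ 2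
      = ∫⁻ x, ∫⁻ z, ∫⁻ z', f (x, z) * f (x, z') ∂ν ∂ν ∂μ := by
        simp only [eLpNorm_two_sq, enorm_eq_self]
        refine lintegral_congr fun x => ?_
        have hfx : Measurable fun z => f (x, z) := by fun_prop
        rw [sq, ← lintegral_mul_const _ hfx]
        exact lintegral_congr fun z => (lintegral_const_mul _ hfx).symm
    _ = ∫⁻ z, ∫⁻ z', ∫⁻ x, f (x, z) * f (x, z') ∂μ ∂ν ∂ν := by
        have hff : Measurable fun q : (X × Z) × Z => f (q.1.1, q.1.2) * f (q.1.1, q.2) := by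
          fun_prop
        rw [lintegral_lintegral_swap hff.lintegral_prod_right'.aemeasurable]
        refine lintegral_congr fun z => lintegral_lintegral_swap ?_
        exact Measurable.aemeasurable (by fun_prop)
    _ ≤ ∫⁻ z, ∫⁻ z', N z * N z' ∂ν ∂ν := by
        refine lintegral_mono fun z => lintegral_mono fun z' => ?_
        exact lintegral_mul_le_eLpNorm_two_mul_eLpNorm_two (by fun_prop) (by fun_prop)
    _ = (∫⁻ z, N z ∂ν) ^ 2 := by
        simp_rw [lintegral_const_mul _ hN]
        rw [lintegral_mul_const _ hN, sq]

theorem eLpNorm_two_lintegral_le [SFinite μ] [SFinite ν] {f : X × Z → ℝ≥0∞}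
    (hf : AEMeasurable f (μ.prod ν)) :
    eLpNorm (fun x => ∫⁻ z, f (x, z) ∂ν) 2 μ ≤ ∫⁻ z, eLpNorm (fun x => f (x, z)) 2 μ ∂ν := by
  have hfst := Measure.ae_ae_of_ae_prod hf.ae_eq_mk
  have hsnd := Measure.ae_ae_of_ae_prod
    (Measure.measurePreserving_swap.quasiMeasurePreserving.ae hf.ae_eq_mk :
      ∀ᵐ z ∂(ν.prod μ), f z.swap = hf.mk f z.swap)
  calc eLpNorm (fun x => ∫⁻ z, f (x, z) ∂ν) 2 μ
      = eLpNorm (fun x => ∫⁻ z, hf.mk f (x, z) ∂ν) 2 μ :=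
        eLpNorm_congr_ae (hfst.mono fun _ hx => lintegral_congr_ae hx)
    _ ≤ ∫⁻ z, eLpNorm (fun x => hf.mk f (x, z)) 2 μ ∂ν :=
        eLpNorm_two_lintegral_le_of_measurable hf.measurable_mk
    _ = ∫⁻ z, eLpNorm (fun x => f (x, z)) 2 μ ∂ν :=
        lintegral_congr_ae (hsnd.mono fun _ hz => (eLpNorm_congr_ae hz).symm)

end Minkowski

section Dual

variable {𝕜 H : Type*} [RCLike 𝕜] [NormedAddCommGroup H] [InnerProductSpace 𝕜 H]

lemma exists_mem_closedBall_enorm_inner_eq (g : H) :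
    ∃ y ∈ Metric.closedBall (0 : H) 1, ‖inner 𝕜 y g‖ₑ = ‖g‖ₑ := by
  rcases eq_or_ne g 0 with rfl | hg
  · exact ⟨0, by simp⟩
  · have hg' : ‖g‖ ≠ 0 := norm_ne_zero_iff.2 hg
    refine ⟨((‖g‖⁻¹ : ℝ) : 𝕜) • g, ?_, ?_⟩
    · simp [norm_smul, hg']
    · rw [← ofReal_norm, ← ofReal_norm, inner_smul_left, inner_self_eq_norm_sq_to_K]
      congr 1
      simp only [norm_mul, RCLike.norm_conj, RCLike.norm_ofReal, norm_pow, abs_norm, abs_inv]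
      field_simp

variable (𝕜) in
lemma exists_seq_enorm_eq_iSup_inner (H : Type*) [NormedAddCommGroup H] [InnerProductSpace 𝕜 H]
    [SecondCountableTopology H] :
    ∃ ψ : ℕ → H, ∀ g : H, ‖g‖ₑ = ⨆ k, ‖inner 𝕜 (ψ k) g‖ₑ := by
  let B := Metric.closedBall (0 : H) 1
  have : Nonempty B := ⟨⟨0, by simp [B]⟩⟩
  refine ⟨fun k => (TopologicalSpace.denseSeq B k : H), fun g =>
    le_antisymm ?_ (iSup_le fun k => ?_)⟩
  · obtain ⟨y, hy, hyg⟩ := exists_mem_closedBall_enorm_inner_eq (𝕜 := 𝕜) g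
    rw [← hyg]
    refine (TopologicalSpace.denseRange_denseSeq B).induction_on
      (p := fun y : B => ‖inner 𝕜 (y : H) g‖ₑ ≤ _) ⟨y, hy⟩ ?_
      (le_iSup fun k => ‖inner 𝕜 (TopologicalSpace.denseSeq B k : H) g‖ₑ)
    exact isClosed_le (by fun_prop) continuous_const
  · have hk := mem_closedBall_zero_iff.1 (TopologicalSpace.denseSeq B k).2
    rw [← ofReal_norm, ← ofReal_norm]
    exact ENNReal.ofReal_le_ofReal
      ((norm_inner_le_norm _ _).trans (mul_le_of_le_one_left (norm_nonneg _) hk))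

variable {X K : Type*} [MeasurableSpace X] [MeasurableSpace K] {vol : Measure X} {μ : Measure K}

lemma exists_seq_enorm_apply_eq_iSup_integral [CompleteSpace H] [SecondCountableTopology H]
    (A : Lp 𝕜 2 vol →L[𝕜] H) :
    ∃ χ : ℕ → X → 𝕜, (∀ k, MemLp (χ k) 2 vol) ∧
      ∀ u : Lp 𝕜 2 vol, ‖A u‖ₑ = ⨆ k, ‖∫ x, χ k x * u x ∂vol‖ₑ := by
  obtain ⟨ψ, hψ⟩ := exists_seq_enorm_eq_iSup_inner 𝕜 H
  refine ⟨fun k => star (A.adjoint (ψ k)), fun k => (Lp.memLp _).star, fun u => ?_⟩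
  rw [hψ]
  refine iSup_congr fun k => ?_
  rw [← ContinuousLinearMap.adjoint_inner_left, L2.inner_def]
  simp [mul_comm]

lemma iSup_ofReal_min_sqrt_sq {b : ℝ} (hb : 0 ≤ b) :
    ⨆ n : ℕ, ENNReal.ofReal (min (√b) n ^ 2) = ENNReal.ofReal b := by
  refine le_antisymm (iSup_le fun n => ENNReal.ofReal_le_ofReal ?_) ?_
  · calc min (√b) n ^ 2 ≤ √b ^ 2 := by gcongr; exact min_le_left _ _
      _ = b := Real.sq_sqrt hb
  · obtain ⟨n, hn⟩ := exists_nat_ge (√b)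
    refine le_iSup_of_le n ?_
    rw [min_eq_left hn, Real.sq_sqrt hb]

lemma lintegral_ofReal_mul_eq_iSup {b : K → ℝ} (hb : Measurable b) (hb0 : ∀ ξ, 0 ≤ b ξ)
    {g : K → ℝ≥0∞} (hg : AEMeasurable g μ) :
    ∫⁻ ξ, ENNReal.ofReal (b ξ) * g ξ ∂μ =
      ⨆ n : ℕ, ∫⁻ ξ, ENNReal.ofReal (min (√(b ξ)) n ^ 2) * g ξ ∂μ := by
  rw [← lintegral_iSup' (fun n => by fun_prop) (ae_of_all _ fun ξ m n hmn => ?_)]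
  · exact lintegral_congr fun ξ => by rw [← ENNReal.iSup_mul, iSup_ofReal_min_sqrt_sq (hb0 ξ)]
  · dsimp only
    gcongr

lemma exists_continuousLinearMap_enorm_apply_eq {w : K → ℝ} (hw : Measurable w) {C : ℝ}
    (hC : ∀ ξ, |w ξ| ≤ C) :
    ∃ A : Lp ℂ 2 μ →L[ℂ] Lp ℂ 2 μ, ∀ g,
      ‖A g‖ₑ = (∫⁻ ξ, ENNReal.ofReal (w ξ ^ 2) * ‖g ξ‖ₑ ^ 2 ∂μ) ^ (1 / 2 : ℝ) := by
  have hw' : MemLp (fun ξ => (w ξ : ℂ)) ∞ μ :=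
    memLp_top_of_bound (by fun_prop) C (ae_of_all _ fun ξ => by simpa using hC ξ)
  refine ⟨(ContinuousLinearMap.mul ℂ ℂ).holderL μ ∞ 2 2 (hw'.toLp _), fun g => ?_⟩
  have hmul : (ContinuousLinearMap.mul ℂ ℂ).holderL μ ∞ 2 2 (hw'.toLp _) g =ᵐ[μ]
      fun ξ => (w ξ : ℂ) * g ξ := by
    filter_upwards [(ContinuousLinearMap.mul ℂ ℂ).coeFn_holder (r := 2) (hw'.toLp _) g,
      hw'.coeFn_toLp] with ξ hξ hwξ
    rw [← hwξ]
    exact hξ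
  rw [Lp.enorm_def, eLpNorm_congr_ae hmul, eLpNorm_two_eq]
  congr 1
  refine lintegral_congr fun ξ => ?_
  rw [enorm_mul, mul_pow, ← sq_abs, ENNReal.ofReal_pow (abs_nonneg _), ← ofReal_norm (w ξ : ℂ),
    Complex.norm_real, Real.norm_eq_abs]

/- The weight `b` need not be bounded, hence the truncations `min √b n` of its square root. -/
theorem exists_seq_sqrt_lintegral_eq_iSup_integral [SecondCountableTopology (Lp ℂ 2 μ)]
    (F : Lp ℂ 2 vol →L[ℂ] Lp ℂ 2 μ) {b : K → ℝ} (hb : Measurable b) (hb0 : ∀ ξ, 0 ≤ b ξ) :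
    ∃ χ : ℕ × ℕ → X → ℂ, (∀ k, MemLp (χ k) 2 vol) ∧ ∀ u : Lp ℂ 2 vol,
      (∫⁻ ξ, ENNReal.ofReal (b ξ) * ‖F u ξ‖ₑ ^ 2 ∂μ) ^ (1 / 2 : ℝ) =
        ⨆ k, ‖∫ x, χ k x * u x ∂vol‖ₑ := by
  have hbound : ∀ (n : ℕ) ξ, |min (√(b ξ)) n| ≤ n := fun n ξ => by
    rw [abs_of_nonneg (by positivity)]; exact min_le_right _ _
  choose A hA using fun n : ℕ =>
    exists_continuousLinearMap_enorm_apply_eq (μ := μ) (w := fun ξ => min (√(b ξ)) n)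
      (by fun_prop) (hbound n)
  choose χ hχ hAχ using fun n => exists_seq_enorm_apply_eq_iSup_integral ((A n).comp F)
  refine ⟨fun k => χ k.1 k.2, fun k => hχ k.1 k.2, fun u => ?_⟩
  have hFu : AEMeasurable (fun ξ => ‖F u ξ‖ₑ ^ 2) μ :=
    (Lp.aestronglyMeasurable (F u)).enorm.pow_const 2
  rw [lintegral_ofReal_mul_eq_iSup hb hb0 hFu, iSup_prod]
  refine ((ENNReal.orderIsoRpow (1 / 2) (by norm_num)).map_iSup _).trans (iSup_congr fun n => ?_)
  rw [← hAχ]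
  exact (hA n (F u)).symm

end Dual

section Algebra

variable {K : Type*} [MeasurableSpace K] [AddCommGroup K] {μ : Measure K}

open scoped Convolution

/-- The weights `β` for which the functions `u` with `β û ∈ L²` form an algebra under
multiplication: `β⁻¹ ∈ L²` makes `û` integrable, and quasi-subadditivity distributes the weight
over the two factors of a convolution. -/
structure IsAlgebraWeight (μ : Measure K) (β : K → ℝ) (C : ℝ) : Prop where
  measurable : Measurable β
  one_le : ∀ ξ, 1 ≤ β ξ
  add_le : ∀ ξ η, β (ξ + η) ≤ C * (β ξ + β η)
  inv_memLp : MemLp (fun ξ => (β ξ)⁻¹) 2 μ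

namespace IsAlgebraWeight

variable {β : K → ℝ} {C : ℝ} (hβ : IsAlgebraWeight μ β C)

include hβ

lemma enorm_add_le (ξ η : K) : ‖β (ξ + η)‖ₑ ≤ ENNReal.ofReal C * (‖β ξ‖ₑ + ‖β η‖ₑ) := by
  have hnonneg : ∀ ξ, 0 ≤ β ξ := fun ξ => zero_le_one.trans (hβ.one_le ξ)
  have hC : 0 ≤ C := by
    by_contra! hC
    nlinarith [hβ.add_le ξ η, hβ.one_le (ξ + η), hβ.one_le ξ, hβ.one_le η]
  simp only [Real.enorm_of_nonneg (hnonneg _)]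
  rw [← ENNReal.ofReal_add (hnonneg _) (hnonneg _), ← ENNReal.ofReal_mul hC]
  exact ENNReal.ofReal_le_ofReal (hβ.add_le ξ η)

lemma inv_smul_smul (U : K → ℂ) : (fun ξ => (β ξ)⁻¹) • β • U = U :=
  funext fun ξ => inv_smul_smul₀ (zero_lt_one.trans_le (hβ.one_le ξ)).ne' _

lemma eLpNorm_one_le {U : K → ℂ} (hU : AEStronglyMeasurable U μ) :
    eLpNorm U 1 μ ≤ eLpNorm (fun ξ => (β ξ)⁻¹) 2 μ * eLpNorm (fun ξ => β ξ • U ξ) 2 μ := by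
  have h := eLpNorm_smul_le_mul_eLpNorm (p := 2) (q := 2) (r := 1)
    (hβ.measurable.aestronglyMeasurable.smul hU) hβ.inv_memLp.aestronglyMeasurable
  rwa [hβ.inv_smul_smul] at h

lemma eLpNorm_two_le_eLpNorm_smul (U : K → ℂ) :
    eLpNorm U 2 μ ≤ eLpNorm (fun ξ => β ξ • U ξ) 2 μ :=
  eLpNorm_mono fun ξ => by
    rw [norm_smul]
    exact le_mul_of_one_le_left (norm_nonneg _) ((hβ.one_le ξ).trans (le_abs_self _))

end IsAlgebraWeight

variable {X : Type*} [MeasurableSpace X] {vol : Measure X}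

/-- `F` is a Fourier–Plancherel transform for the characters `e`: it inverts the synthesis operator
`G ↦ ∫ G(ξ) e_ξ dξ` on `L¹ ∩ L²`. -/
structure IsPlancherelTransform (F : Lp ℂ 2 vol →ₗᵢ[ℂ] Lp ℂ 2 μ) (e : K → X → ℂ) : Prop where
  measurable_char : ∀ x, Measurable fun ξ => e ξ x
  norm_char : ∀ ξ x, ‖e ξ x‖ = 1
  char_add : ∀ ξ η x, e (ξ + η) x = e ξ x * e η x
  apply_synthesis : ∀ G : K → ℂ, Integrable G μ → ∀ hG : MemLp G 2 μ,
    ∃ hu : MemLp (fun x => ∫ ξ, G ξ * e ξ x ∂μ) 2 vol, F (hu.toLp _) = hG.toLp G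

namespace IsPlancherelTransform

variable {F : Lp ℂ 2 vol →ₗᵢ[ℂ] Lp ℂ 2 μ} {e : K → X → ℂ}

lemma ae_eq_integral (hF : IsPlancherelTransform F e) {u : Lp ℂ 2 vol}
    (hu : Integrable (F u) μ) : u =ᵐ[vol] fun x => ∫ ξ, F u ξ * e ξ x ∂μ := by
  obtain ⟨hv, hFv⟩ := hF.apply_synthesis (F u) hu (Lp.memLp (F u))
  rw [Lp.toLp_coeFn] at hFv
  have h := hv.coeFn_toLp
  rwa [F.injective hFv] at h

end IsPlancherelTransform

variable [MeasurableAdd₂ K] [MeasurableNeg K]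

theorem eLpNorm_two_lintegral_sub_mul_le [SFinite μ] [μ.IsAddLeftInvariant] {A B : K → ℝ≥0∞}
    (hA : Measurable A) (hB : Measurable B) :
    eLpNorm (fun ξ => ∫⁻ η, A (ξ - η) * B η ∂μ) 2 μ ≤ eLpNorm A 2 μ * ∫⁻ η, B η ∂μ := by
  rw [← lintegral_const_mul _ hB]
  refine (eLpNorm_two_lintegral_le (f := fun z : K × K => A (z.1 - z.2) * B z.2)
    (by fun_prop)).trans (lintegral_mono fun η => le_of_eq ?_)
  simp only [eLpNorm_two_eq, enorm_eq_self, mul_pow]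
  rw [lintegral_mul_const _ (by fun_prop), lintegral_sub_right_eq_self (fun ξ => A ξ ^ 2) η,
    ENNReal.mul_rpow_of_nonneg _ _ (by norm_num), ← ENNReal.rpow_natCast (B η),
    ← ENNReal.rpow_mul]
  norm_num

lemma integral_convolution_mul_char [SFinite μ] [μ.IsAddLeftInvariant] {e : K → ℂ}
    (hem : Measurable e) (hen : ∀ ξ, ‖e ξ‖ = 1) (hea : ∀ ξ η, e (ξ + η) = e ξ * e η) {U W : K → ℂ}
    (hU : Integrable U μ) (hW : Integrable W μ) :
    ∫ ξ, (U ⋆[ContinuousLinearMap.mul ℂ ℂ, μ] W) ξ * e ξ ∂μ =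
      (∫ ξ, U ξ * e ξ ∂μ) * ∫ ξ, W ξ * e ξ ∂μ := by
  have hmul : ∀ {V : K → ℂ}, Integrable V μ → Integrable (fun ξ => V ξ * e ξ) μ := fun hV =>
    hV.mul_bdd (c := 1) hem.aestronglyMeasurable (ae_of_all _ fun ξ => (hen ξ).le)
  rw [← ContinuousLinearMap.mul_apply' ℂ ℂ (∫ ξ, U ξ * e ξ ∂μ),
    ← integral_convolution (ContinuousLinearMap.mul ℂ ℂ) (hmul hU) (hmul hW)]
  refine integral_congr_ae (ae_of_all _ fun ξ => ?_)
  simp only [convolution_def, ContinuousLinearMap.mul_apply', ← integral_mul_const]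
  refine integral_congr_ae (ae_of_all _ fun η => ?_)
  have hξ : e ξ = e η * e (ξ - η) := by rw [← hea, add_sub_cancel]
  simp only [hξ]
  ring

namespace IsAlgebraWeight

variable {β : K → ℝ} {C : ℝ} (hβ : IsAlgebraWeight μ β C)

include hβ

lemma enorm_smul_convolution_le [μ.IsAddLeftInvariant] [μ.IsNegInvariant] {U W : K → ℂ}
    (hU : Measurable U) (hW : Measurable W) (ξ : K) :
    ‖β ξ • (U ⋆[ContinuousLinearMap.mul ℂ ℂ, μ] W) ξ‖ₑ ≤
      ENNReal.ofReal C * ((∫⁻ η, ‖β (ξ - η) • U (ξ - η)‖ₑ * ‖W η‖ₑ ∂μ) +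
        ∫⁻ η, ‖β (ξ - η) • W (ξ - η)‖ₑ * ‖U η‖ₑ ∂μ) := by
  have := hβ.measurable
  have hswap : ∫⁻ η, ‖β (ξ - η) • U (ξ - η)‖ₑ * ‖W η‖ₑ ∂μ =
      ∫⁻ η, ‖β η • U η‖ₑ * ‖W (ξ - η)‖ₑ ∂μ := by
    rw [← lintegral_sub_left_eq_self _ ξ]
    simp only [sub_sub_cancel]
  rw [hswap, ← lintegral_add_left (by fun_prop), ← lintegral_const_mul' _ _ ENNReal.ofReal_ne_top,
    enorm_smul]
  calc ‖β ξ‖ₑ * ‖(U ⋆[ContinuousLinearMap.mul ℂ ℂ, μ] W) ξ‖ₑ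
      ≤ ‖β ξ‖ₑ * ∫⁻ η, ‖U η * W (ξ - η)‖ₑ ∂μ := by
        gcongr; exact enorm_integral_le_lintegral_enorm _
    _ = ∫⁻ η, ‖β (η + (ξ - η))‖ₑ * (‖U η‖ₑ * ‖W (ξ - η)‖ₑ) ∂μ := by
        rw [← lintegral_const_mul' _ _ enorm_ne_top]
        simp only [add_sub_cancel, enorm_mul]
    _ ≤ ∫⁻ η, ENNReal.ofReal C * (‖β η • U η‖ₑ * ‖W (ξ - η)‖ₑ +
          ‖β (ξ - η) • W (ξ - η)‖ₑ * ‖U η‖ₑ) ∂μ := by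
        refine lintegral_mono fun η => ?_
        dsimp only
        grw [hβ.enorm_add_le η (ξ - η)]
        simp only [enorm_smul]
        exact le_of_eq (by ring)

lemma eLpNorm_smul_convolution_le [SFinite μ] [μ.IsAddLeftInvariant] [μ.IsNegInvariant]
    {U W : K → ℂ} (hU : Measurable U) (hW : Measurable W) :
    eLpNorm (fun ξ => β ξ • (U ⋆[ContinuousLinearMap.mul ℂ ℂ, μ] W) ξ) 2 μ ≤
      2 * ENNReal.ofReal C * eLpNorm (fun ξ => (β ξ)⁻¹) 2 μ *
        (eLpNorm (fun ξ => β ξ • U ξ) 2 μ * eLpNorm (fun ξ => β ξ • W ξ) 2 μ) := by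
  have := hβ.measurable
  have hmeas : ∀ {A B : K → ℂ}, Measurable A → Measurable B →
      Measurable fun ξ => ∫⁻ η, ‖β (ξ - η) • A (ξ - η)‖ₑ * ‖B η‖ₑ ∂μ := fun {A B} hA hB => by
    have : Measurable fun z : K × K => ‖β (z.1 - z.2) • A (z.1 - z.2)‖ₑ * ‖B z.2‖ₑ := by fun_prop
    exact this.lintegral_prod_right'
  have hyoung : ∀ {A B : K → ℂ}, Measurable A → Measurable B →
      eLpNorm (fun ξ => ∫⁻ η, ‖β (ξ - η) • A (ξ - η)‖ₑ * ‖B η‖ₑ ∂μ) 2 μ ≤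
        eLpNorm (fun ξ => β ξ • A ξ) 2 μ *
          (eLpNorm (fun ξ => (β ξ)⁻¹) 2 μ * eLpNorm (fun ξ => β ξ • B ξ) 2 μ) :=
    fun {A B} hA hB => by
    refine (eLpNorm_two_lintegral_sub_mul_le (A := fun ξ => ‖β ξ • A ξ‖ₑ)
      (by fun_prop) hB.enorm).trans ?_
    rw [eLpNorm_enorm, ← eLpNorm_one_eq_lintegral_enorm]
    gcongr
    exact hβ.eLpNorm_one_le hB.aestronglyMeasurable
  refine (eLpNorm_le_mul_eLpNorm_of_ae_le_mul' (c := C.toNNReal)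
    (ae_of_all _ fun ξ => (hβ.enorm_smul_convolution_le hU hW ξ).trans_eq
      (congrArg _ (enorm_eq_self _).symm)) 2).trans ?_
  refine (mul_le_mul_right ((eLpNorm_add_le (hmeas hU hW).aestronglyMeasurable
    (hmeas hW hU).aestronglyMeasurable one_le_two).trans
      (add_le_add (hyoung hU hW) (hyoung hW hU))) _).trans_eq ?_
  change ENNReal.ofReal C * _ = _
  ring

end IsAlgebraWeight

theorem IsPlancherelTransform.exists_memLp_mul_eLpNorm_le
    [SFinite μ] [μ.IsAddLeftInvariant] [μ.IsNegInvariant]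
    {F : Lp ℂ 2 vol →ₗᵢ[ℂ] Lp ℂ 2 μ} {e : K → X → ℂ} (hF : IsPlancherelTransform F e)
    {β : K → ℝ} {C : ℝ} (hβ : IsAlgebraWeight μ β C)
    {u w : Lp ℂ 2 vol} (hu : eLpNorm (fun ξ => β ξ • F u ξ) 2 μ < ∞)
    (hw : eLpNorm (fun ξ => β ξ • F w ξ) 2 μ < ∞) :
    ∃ h : MemLp (fun x => u x * w x) 2 vol,
      eLpNorm (fun ξ => β ξ • F (h.toLp _) ξ) 2 μ ≤
        2 * ENNReal.ofReal C * eLpNorm (fun ξ => (β ξ)⁻¹) 2 μ *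
          (eLpNorm (fun ξ => β ξ • F u ξ) 2 μ * eLpNorm (fun ξ => β ξ • F w ξ) 2 μ) := by
  have hinteg : ∀ {u : Lp ℂ 2 vol}, eLpNorm (fun ξ => β ξ • F u ξ) 2 μ < ∞ → Integrable (F u) μ :=
    fun hu => memLp_one_iff_integrable.1 ⟨Lp.aestronglyMeasurable _,
      (hβ.eLpNorm_one_le (Lp.aestronglyMeasurable _)).trans_lt
        (ENNReal.mul_lt_top hβ.inv_memLp.2 hu)⟩
  set G : K → ℂ := F u ⋆[ContinuousLinearMap.mul ℂ ℂ, μ] F w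
  have hG : Integrable G μ :=
    (hinteg hu).integrable_convolution (ContinuousLinearMap.mul ℂ ℂ) (hinteg hw)
  have hbound := hβ.eLpNorm_smul_convolution_le (Lp.stronglyMeasurable (F u)).measurable
    (Lp.stronglyMeasurable (F w)).measurable
  have hG2 : MemLp G 2 μ := ⟨hG.aestronglyMeasurable, (hβ.eLpNorm_two_le_eLpNorm_smul G).trans_lt
    (hbound.trans_lt (ENNReal.mul_lt_top (ENNReal.mul_lt_top (by finiteness) hβ.inv_memLp.2)
      (ENNReal.mul_lt_top hu hw)))⟩
  obtain ⟨hv, hFv⟩ := hF.apply_synthesis G hG hG2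
  have hmul : (fun x => ∫ ξ, G ξ * e ξ x ∂μ) =ᵐ[vol] fun x => u x * w x := by
    filter_upwards [hF.ae_eq_integral (hinteg hu), hF.ae_eq_integral (hinteg hw)] with x hux hwx
    rw [hux, hwx]
    exact integral_convolution_mul_char (hF.measurable_char x) (fun ξ => hF.norm_char ξ x)
      (fun ξ η => hF.char_add ξ η x) (hinteg hu) (hinteg hw)
  have hFmul : F ((hv.ae_eq hmul).toLp _) =ᵐ[μ] G := by
    rw [MemLp.toLp_congr _ hv hmul.symm, hFv]
    exact hG2.coeFn_toLp
  exact ⟨hv.ae_eq hmul, (eLpNorm_congr_ae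
    (hFmul.mono fun ξ hξ => congrArg (β ξ • ·) hξ)).trans_le hbound⟩

end Algebra

section WholeSpace

variable {V : Type*} [NormedAddCommGroup V] [InnerProductSpace ℝ V] [FiniteDimensional ℝ V]
  [MeasurableSpace V] [BorelSpace V]

open scoped ContDiff SchwartzMap

lemma integral_fourierInv_mul_eq_integral_mul_fourierInv {f g : V → ℂ} (hf : Integrable f)
    (hg : Integrable g) : ∫ ξ, 𝓕⁻ f ξ * g ξ = ∫ x, f x * 𝓕⁻ g x := by
  have h := VectorFourier.integral_fourierIntegral_smul_eq_flip (μ := (volume : Measure V))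
    (ν := (volume : Measure V)) (L := -innerₗ V) Real.continuous_fourierChar
    continuous_inner.neg hf hg
  have hflip : (-innerₗ V).flip = -innerₗ V := by
    ext x y; simp [real_inner_comm]
  rwa [hflip] at h

theorem fourierInv_toLp_ae_eq {G : V → ℂ} (hG : Integrable G) (hG2 : MemLp G 2) :
    ⇑(𝓕⁻ (hG2.toLp G) : Lp ℂ 2 (volume : Measure V)) =ᵐ[volume] 𝓕⁻ G := by
  set U : Lp ℂ 2 (volume : Measure V) := 𝓕⁻ (hG2.toLp G) with hU
  have hcont : Continuous (𝓕⁻ G) :=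
    VectorFourier.fourierIntegral_continuous Real.continuous_fourierChar
      (L := -innerₗ V) continuous_inner.neg hG
  refine ae_eq_of_integral_contDiff_smul_eq ((Lp.memLp U).locallyIntegrable (by norm_num))
    hcont.locallyIntegrable fun g g_smooth g_cpt => ?_
  have hg_cpt : HasCompactSupport (Complex.ofRealCLM ∘ g) := g_cpt.comp_left rfl
  have hg_smooth : ContDiff ℝ ∞ (Complex.ofRealCLM ∘ g) := by fun_prop
  set φ : 𝓢(V, ℂ) := hg_cpt.toSchwartzMap hg_smooth with hφ
  have hφ_smul : ∀ (k : V → ℂ) x, φ x * k x = g x • k x := fun k x => by simp [hφ]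
  have hdistrib : (U : 𝓢'(V, ℂ)) φ = (hG2.toLp G : 𝓢'(V, ℂ)) (𝓕⁻ φ) := by
    rw [hU, ← Lp.fourierInv_toTemperedDistribution_eq]
    rfl
  have hpairing : ∫ x, (𝓕⁻ φ : 𝓢(V, ℂ)) x • (hG2.toLp G) x = ∫ ξ, 𝓕⁻ (φ : V → ℂ) ξ * G ξ := by
    refine integral_congr_ae ?_
    filter_upwards [hG2.coeFn_toLp] with x hx
    rw [hx, SchwartzMap.fourierInv_coe, smul_eq_mul]
  rw [Lp.toTemperedDistribution_apply, Lp.toTemperedDistribution_apply, hpairing,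
    integral_fourierInv_mul_eq_integral_mul_fourierInv φ.integrable hG] at hdistrib
  simpa only [smul_eq_mul, hφ_smul] using hdistrib

theorem isPlancherelTransform_fourierTransform :
    IsPlancherelTransform (Lp.fourierTransformₗᵢ V ℂ).toLinearIsometry
      fun ξ x => (Real.fourierChar (inner ℝ ξ x) : ℂ) where
  measurable_char x := (continuous_subtype_val.comp
    (Real.continuous_fourierChar.comp (by fun_prop))).measurable
  norm_char _ _ := Circle.norm_coe _
  char_add ξ η x := by rw [inner_add_left, AddChar.map_add_eq_mul, Circle.coe_mul]
  apply_synthesis G hG hG2 := by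
    have hinv := fourierInv_toLp_ae_eq hG hG2
    have hsynthesis : (fun x => ∫ ξ, G ξ * (Real.fourierChar (inner ℝ ξ x) : ℂ)) = 𝓕⁻ G := by
      funext x
      simp only [Real.fourierInv_eq, Circle.smul_def, smul_eq_mul, mul_comm]
    have hmem : MemLp (𝓕⁻ G) 2 := (memLp_congr_ae hinv).1 (Lp.memLp _)
    rw [hsynthesis]
    refine ⟨hmem, ?_⟩
    rw [show hmem.toLp (𝓕⁻ G) = (Lp.fourierTransformₗᵢ V ℂ).symm (hG2.toLp G) from
      Lp.ext (hmem.coeFn_toLp.trans hinv.symm)]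
    exact LinearIsometryEquiv.apply_symm_apply _ _

end WholeSpace

section CountingMeasure

variable {I E : Type*} [Countable I] [MeasurableSpace I] [MeasurableSingletonClass I]
  [NormedAddCommGroup E] {p : ℝ≥0∞}

lemma memLp_count_iff_memℓp (hp0 : p ≠ 0) (hp : p ≠ ∞) {f : I → E} :
    MemLp f p .count ↔ Memℓp f p := by
  rw [memℓp_gen_iff (ENNReal.toReal_pos hp0 hp), ← integrable_norm_rpow_iff .of_discrete hp0 hp,
    integrable_count_iff]
  simp only [Real.norm_of_nonneg (Real.rpow_nonneg (norm_nonneg _) _)]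

lemma toReal_eLpNorm_count (hp0 : p ≠ 0) (hp : p ≠ ∞) (f : lp (fun _ : I => E) p) :
    (eLpNorm f p (.count : Measure I)).toReal = ‖f‖ := by
  have hf := (memLp_count_iff_memℓp hp0 hp).2 (lp.memℓp f)
  rw [hf.eLpNorm_eq_integral_rpow_norm hp0 hp,
    integral_countable ((integrable_norm_rpow_iff .of_discrete hp0 hp).2 hf),
    lp.norm_eq_tsum_rpow (ENNReal.toReal_pos hp0 hp), ENNReal.toReal_ofReal (by positivity)]
  simp

lemma memLp_two_count (f : lp (fun _ : I => E) 2) : MemLp f 2 .count :=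
  (memLp_count_iff_memℓp two_ne_zero ENNReal.ofNat_ne_top).2 (lp.memℓp f)

/-- The identity of `ℓ²` with `L²` of the counting measure, as an isometry: it brings the Fourier
coefficients on the torus into the common framework of Plancherel transforms between `L²` spaces. -/
def lpToLpCount : lp (fun _ : I => ℂ) 2 →ₗᵢ[ℂ] Lp ℂ 2 (.count : Measure I) where
  toFun f := (memLp_two_count f).toLp f
  map_add' _ _ := rfl
  map_smul' _ _ := rfl
  norm_map' f := by
    change ‖(memLp_two_count f).toLp f‖ = ‖f‖
    rw [Lp.norm_toLp, toReal_eLpNorm_count two_ne_zero ENNReal.ofNat_ne_top]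

lemma lpToLpCount_ae_eq (f : lp (fun _ : I => ℂ) 2) : lpToLpCount f =ᵐ[Measure.count] f :=
  (memLp_two_count f).coeFn_toLp

end CountingMeasure

section Torus

variable {d : ℕ}

/-- The Haar probability measure of the torus. -/
abbrev torusMeasure (d : ℕ) : Measure (UnitAddTorus (Fin d)) :=
  Measure.pi fun _ : Fin d => (AddCircle.haarAddCircle : Measure UnitAddCircle)

/-- The Fourier coefficients on the torus, as an isometry into `L²` of the counting measure. -/
def torusFourier (d : ℕ) :
    Lp ℂ 2 (torusMeasure d) →ₗᵢ[ℂ] Lp ℂ 2 (.count : Measure (Fin d → ℤ)) :=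
  lpToLpCount.comp (UnitAddTorus.mFourierBasis (d := Fin d)).repr.toLinearIsometry

lemma torusFourier_ae_eq (f : Lp ℂ 2 (torusMeasure d)) :
    ⇑(torusFourier d f) =ᵐ[Measure.count] UnitAddTorus.mFourierCoeff f := by
  filter_upwards [lpToLpCount_ae_eq (UnitAddTorus.mFourierBasis.repr f)] with n hn
  exact hn.trans (UnitAddTorus.mFourierBasis_repr f n)

lemma norm_mFourier_apply (n : Fin d → ℤ) (x : UnitAddTorus (Fin d)) :
    ‖UnitAddTorus.mFourier n x‖ = 1 := by
  simp only [UnitAddTorus.mFourier, fourier_apply, ContinuousMap.coe_mk, norm_prod,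
    Circle.norm_coe, Finset.prod_const_one]

lemma integral_count_mul_mFourier {G : (Fin d → ℤ) → ℂ} (hG : Integrable G .count)
    (hsum : Summable fun n => G n • UnitAddTorus.mFourier n) (x : UnitAddTorus (Fin d)) :
    ∫ n, G n * UnitAddTorus.mFourier n x ∂.count =
      (∑' n, G n • UnitAddTorus.mFourier n : C(UnitAddTorus (Fin d), ℂ)) x := by
  have hinteg : Integrable (fun n => G n * UnitAddTorus.mFourier n x) .count :=
    hG.mul_bdd (c := 1) .of_discrete (ae_of_all _ fun n => (norm_mFourier_apply n x).le)
  simp [integral_countable hinteg, ← ContinuousMap.tsum_apply hsum x]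

lemma toLp_tsum_smul_mFourier {G : (Fin d → ℤ) → ℂ}
    (hsum : Summable fun n => G n • UnitAddTorus.mFourier (d := Fin d) n) (hG : Memℓp G 2) :
    ContinuousMap.toLp (E := ℂ) 2 (torusMeasure d) ℂ (∑' n, G n • UnitAddTorus.mFourier n) =
      UnitAddTorus.mFourierBasis.repr.symm ⟨G, hG⟩ := by
  have hterm : (fun n => ContinuousMap.toLp (E := ℂ) 2 (torusMeasure d) ℂ
      (G n • UnitAddTorus.mFourier n)) = fun n => G n • UnitAddTorus.mFourierBasis n := by
    funext n
    rw [map_smul, UnitAddTorus.coe_mFourierBasis]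
    rfl
  have hleft := (ContinuousMap.toLp (E := ℂ) 2 (torusMeasure d) ℂ).hasSum hsum.hasSum
  rw [hterm] at hleft
  exact hleft.unique (UnitAddTorus.mFourierBasis.hasSum_repr_symm ⟨G, hG⟩)

theorem isPlancherelTransform_torusFourier :
    IsPlancherelTransform (torusFourier d) fun n x => UnitAddTorus.mFourier n x where
  measurable_char _ := measurable_of_countable _
  norm_char := norm_mFourier_apply
  char_add _ _ _ := UnitAddTorus.mFourier_add
  apply_synthesis G hG hG2 := by
    have hsum : Summable fun n => G n • UnitAddTorus.mFourier (d := Fin d) n :=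
      .of_norm (by simpa [norm_smul, UnitAddTorus.mFourier_norm] using integrable_count_iff.1 hG)
    have hG' : Memℓp G 2 := (memLp_count_iff_memℓp two_ne_zero ENNReal.ofNat_ne_top).1 hG2
    set c : C(UnitAddTorus (Fin d), ℂ) := ∑' n, G n • UnitAddTorus.mFourier n
    have hc := ContinuousMap.coeFn_toLp (p := 2) (𝕜 := ℂ) (torusMeasure d) c
    have hmem : MemLp c 2 (torusMeasure d) := (memLp_congr_ae hc).1 (Lp.memLp _)
    have htoLp : hmem.toLp c = UnitAddTorus.mFourierBasis.repr.symm ⟨G, hG'⟩ :=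
      (Lp.ext (hmem.coeFn_toLp.trans hc.symm)).trans (toLp_tsum_smul_mFourier hsum hG')
    simp only [integral_count_mul_mFourier hG hsum]
    refine ⟨hmem, ?_⟩
    rw [htoLp]
    exact congrArg lpToLpCount (LinearIsometryEquiv.apply_symm_apply _ _)

end Torus

lemma summable_one_add_sum_sq_rpow {ι : Type*} [Fintype ι] {s : ℝ}
    (hs : (Fintype.card ι : ℝ) / 2 < s) :
    Summable fun n : ι → ℤ => (1 + ∑ i, (n i : ℝ) ^ 2) ^ (-s) := by
  have hs0 : 0 < s := (by positivity : (0 : ℝ) ≤ Fintype.card ι / 2).trans_lt hs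
  let b := (EuclideanSpace.basisFun ι ℝ).toBasis
  let e := (b.restrictScalars ℤ).equivFun
  have hcoord : ∀ n i, (e.symm n : EuclideanSpace ℝ ι) i = n i := fun n i => by
    have h := b.restrictScalars_repr_apply ℤ (e.symm n) i
    rw [show (b.restrictScalars ℤ).repr (e.symm n) i = n i from
      congrFun (e.apply_symm_apply n) i] at h
    simpa [b] using h.symm
  have hnorm : ∀ n, ‖e.symm n‖ ^ 2 = ∑ i, (n i : ℝ) ^ 2 := fun n => by
    simp only [← hcoord, Submodule.coe_norm, EuclideanSpace.real_norm_sq_eq]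
  have hrank : -(2 * s) < -Module.finrank ℤ (Submodule.span ℤ (Set.range b)) := by
    rw [e.finrank_eq, Module.finrank_fintype_fun_eq_card]
    linarith
  refine ((ZLattice.summable_norm_rpow _ _ hrank).comp_injective
    e.symm.injective).of_norm_bounded_eventually ?_
  filter_upwards [(Set.finite_singleton 0).compl_mem_cofinite] with n hn
  have hpos : 0 < ‖e.symm n‖ := by simpa using hn
  rw [Real.norm_of_nonneg (by positivity), ← hnorm, Function.comp_apply, ← mul_neg,
    Real.rpow_mul hpos.le, Real.rpow_two]
  exact Real.rpow_le_rpow_of_nonpos (by positivity) (by linarith) (by linarith)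

lemma isAlgebraWeight_sqrt_one_add_rpow {K : Type*} [MeasurableSpace K] [AddCommGroup K]
    {μ : Measure K} {q : K → ℝ} {s : ℝ} (hq : Measurable q) (hq0 : ∀ ξ, 0 ≤ q ξ)
    (hq_add : ∀ ξ η, q (ξ + η) ≤ 2 * (q ξ + q η)) (hs : 0 ≤ s)
    (hinteg : Integrable (fun ξ => (1 + q ξ) ^ (-s)) μ) :
    IsAlgebraWeight μ (fun ξ => √((1 + q ξ) ^ s)) √(4 ^ s) where
  measurable := ((hq.const_add 1).pow_const s).sqrt
  one_le ξ := Real.one_le_sqrt.2 (Real.one_le_rpow (le_add_of_nonneg_right (hq0 ξ)) hs)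
  add_le ξ η := by
    wlog h : q ξ ≤ q η generalizing ξ η
    · rw [add_comm ξ, add_comm √((1 + q ξ) ^ s)]
      exact this η ξ (le_of_not_ge h)
    have hpow : (1 + q (ξ + η)) ^ s ≤ 4 ^ s * (1 + q η) ^ s := by
      rw [← Real.mul_rpow (by norm_num) (by linarith [hq0 η])]
      exact Real.rpow_le_rpow (by linarith [hq0 (ξ + η)]) (by linarith [hq_add ξ η]) hs
    refine (Real.sqrt_le_sqrt hpow).trans ?_
    rw [Real.sqrt_mul (by positivity)]
    gcongr
    exact le_add_of_nonneg_left (Real.sqrt_nonneg _)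
  inv_memLp := by
    refine (memLp_two_iff_integrable_sq
      ((hq.const_add 1).pow_const s).sqrt.inv.aestronglyMeasurable).2
      (hinteg.congr (ae_of_all _ fun ξ => ?_))
    have hpos : 0 ≤ 1 + q ξ := by linarith [hq0 ξ]
    simp only [Pi.inv_apply, inv_pow, Real.sq_sqrt (Real.rpow_nonneg hpos s), Real.rpow_neg hpos]

namespace SpatialDomain

instance instSigmaFiniteVol (d : ℕ) : (Ω : SpatialDomain) → SigmaFinite (Ω.vol d)
  | wholeSpace => inferInstanceAs (SigmaFinite (volume : Measure (EuclideanSpace ℝ (Fin d))))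
  | torus => inferInstanceAs (SigmaFinite (torusMeasure d))

/-- The Fourier–Plancherel transform of the domain, as an isometry of complex `L²` spaces. -/
def plancherel (d : ℕ) : (Ω : SpatialDomain) → Lp ℂ 2 (Ω.vol d) →ₗᵢ[ℂ] Lp ℂ 2 (Ω.freqVol d)
  | wholeSpace => (Lp.fourierTransformₗᵢ (EuclideanSpace ℝ (Fin d)) ℂ).toLinearIsometry
  | torus => torusFourier d

lemma fourier_ae_eq (d : ℕ) (Ω : SpatialDomain) {u : Ω.Pt d → ℝ}
    (hu : MemLp (fun x => (u x : ℂ)) 2 (Ω.vol d)) :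
    Ω.fourier d u =ᵐ[Ω.freqVol d] Ω.plancherel d (hu.toLp _) := by
  cases Ω with
  | wholeSpace => exact .of_eq (dif_pos hu)
  | torus =>
    refine .trans (.of_eq ?_) (torusFourier_ae_eq (hu.toLp _)).symm
    funext n
    exact integral_congr_ae (Filter.EventuallyEq.rfl.smul hu.coeFn_toLp.symm)

lemma measurable_freqSq (d : ℕ) (Ω : SpatialDomain) : Measurable (Ω.freqSq d) := by
  cases Ω with
  | wholeSpace => exact (continuous_norm.pow 2).measurable
  | torus => exact .of_discrete

lemma freqSq_nonneg (d : ℕ) (Ω : SpatialDomain) (ξ : Ω.Freq d) : 0 ≤ Ω.freqSq d ξ := by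
  cases Ω with
  | wholeSpace => exact sq_nonneg _
  | torus => exact Finset.sum_nonneg fun _ _ => sq_nonneg _

lemma measurable_besselWeight (d : ℕ) (Ω : SpatialDomain) (s : ℝ) :
    Measurable (Ω.besselWeight d s) :=
  (((Ω.measurable_freqSq d).const_mul _).const_add _).pow_const s

lemma one_le_besselWeight (d : ℕ) (Ω : SpatialDomain) {s : ℝ} (hs : 0 ≤ s) (ξ : Ω.Freq d) :
    1 ≤ Ω.besselWeight d s ξ :=
  Real.one_le_rpow (le_add_of_nonneg_right
    (mul_nonneg (sq_nonneg _) (Ω.freqSq_nonneg d ξ))) hs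

lemma integrable_one_add_freqSq_rpow {d : ℕ} (Ω : SpatialDomain) {s : ℝ} (hs : (d : ℝ) / 2 < s) :
    Integrable (fun ξ => (1 + Ω.freqSq d ξ) ^ (-s)) (Ω.freqVol d) := by
  cases Ω with
  | wholeSpace =>
    have h := integrable_rpow_neg_one_add_norm_sq (E := EuclideanSpace ℝ (Fin d))
      (μ := volume) (r := 2 * s) (by simp; linarith)
    rwa [show -(2 * s) / 2 = -s by ring] at h
  | torus =>
    exact integrable_count_iff.2 (summable_one_add_sum_sq_rpow (by simpa using hs)).norm

lemma integrable_one_add_mul_freqSq_rpow {d : ℕ} (Ω : SpatialDomain) {s : ℝ}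
    (hs : (d : ℝ) / 2 < s) :
    Integrable (fun ξ => (1 + (2 * Real.pi) ^ 2 * Ω.freqSq d ξ) ^ (-s)) (Ω.freqVol d) := by
  have hs0 : 0 ≤ s := (by positivity : (0 : ℝ) ≤ d / 2).trans hs.le
  have hmeas := Ω.measurable_freqSq d
  refine (Ω.integrable_one_add_freqSq_rpow hs).mono'
    (((hmeas.const_mul _).const_add _).pow_const _).aestronglyMeasurable (ae_of_all _ fun ξ => ?_)
  have hξ := Ω.freqSq_nonneg d ξ
  have hpi : 1 ≤ (2 * Real.pi) ^ 2 := by nlinarith [Real.pi_gt_three]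
  rw [Real.norm_of_nonneg (by positivity)]
  exact Real.rpow_le_rpow_of_nonpos (by positivity) (by nlinarith) (by linarith)

lemma isAlgebraWeight_sqrt_besselWeight {d : ℕ} {Ω : SpatialDomain} [AddCommGroup (Ω.Freq d)]
    {s : ℝ} (hs : (d : ℝ) / 2 < s)
    (hadd : ∀ ξ η, Ω.freqSq d (ξ + η) ≤ 2 * (Ω.freqSq d ξ + Ω.freqSq d η)) :
    IsAlgebraWeight (Ω.freqVol d) (fun ξ => √(Ω.besselWeight d s ξ)) √(4 ^ s) :=
  isAlgebraWeight_sqrt_one_add_rpow ((Ω.measurable_freqSq d).const_mul _)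
    (fun ξ => mul_nonneg (sq_nonneg _) (Ω.freqSq_nonneg d ξ))
    (fun ξ η => by nlinarith [hadd ξ η, sq_nonneg (2 * Real.pi)])
    ((by positivity : (0 : ℝ) ≤ d / 2).trans hs.le) (Ω.integrable_one_add_mul_freqSq_rpow hs)

theorem exists_plancherel_mul_le {d : ℕ} (Ω : SpatialDomain) {s : ℝ} (hs : (d : ℝ) / 2 < s) :
    ∃ C < ∞, ∀ {u w : Lp ℂ 2 (Ω.vol d)},
      eLpNorm (fun ξ => √(Ω.besselWeight d s ξ) • Ω.plancherel d u ξ) 2 (Ω.freqVol d) < ∞ →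
      eLpNorm (fun ξ => √(Ω.besselWeight d s ξ) • Ω.plancherel d w ξ) 2 (Ω.freqVol d) < ∞ →
      ∃ h : MemLp (fun x => u x * w x) 2 (Ω.vol d),
        eLpNorm (fun ξ => √(Ω.besselWeight d s ξ) • Ω.plancherel d (h.toLp _) ξ) 2 (Ω.freqVol d) ≤
          C * (eLpNorm (fun ξ => √(Ω.besselWeight d s ξ) • Ω.plancherel d u ξ) 2 (Ω.freqVol d) *
            eLpNorm (fun ξ => √(Ω.besselWeight d s ξ) • Ω.plancherel d w ξ) 2 (Ω.freqVol d)) := by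
  cases Ω with
  | wholeSpace =>
    have hweight := isAlgebraWeight_sqrt_besselWeight (Ω := wholeSpace) hs fun ξ η => by
      change ‖ξ + η‖ ^ 2 ≤ 2 * (‖ξ‖ ^ 2 + ‖η‖ ^ 2)
      nlinarith [norm_add_le ξ η, sq_nonneg (‖ξ‖ - ‖η‖), norm_nonneg (ξ + η)]
    exact ⟨_, ENNReal.mul_lt_top (by finiteness) hweight.inv_memLp.2, fun hu hw =>
      isPlancherelTransform_fourierTransform.exists_memLp_mul_eLpNorm_le hweight hu hw⟩
  | torus =>
    have hweight := isAlgebraWeight_sqrt_besselWeight (Ω := torus) hs fun n m => by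
      change ∑ i, (((n + m) i : ℤ) : ℝ) ^ 2 ≤ 2 * (∑ i, (n i : ℝ) ^ 2 + ∑ i, (m i : ℝ) ^ 2)
      rw [← Finset.sum_add_distrib, Finset.mul_sum]
      refine Finset.sum_le_sum fun i _ => ?_
      push_cast [Pi.add_apply]
      nlinarith [sq_nonneg ((n i : ℝ) - m i)]
    exact ⟨_, ENNReal.mul_lt_top (by finiteness) hweight.inv_memLp.2, fun hu hw =>
      isPlancherelTransform_torusFourier.exists_memLp_mul_eLpNorm_le hweight hu hw⟩

end SpatialDomain

section DualNorm

variable {X Z : Type*} [MeasurableSpace X] [MeasurableSpace Z] {μ : Measure X} {ν : Measure Z}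

lemma measurableSet_memLp_two_section {E : Type*} [NormedAddCommGroup E] [SFinite μ]
    {g : X × Z → E} (hg : StronglyMeasurable g) :
    MeasurableSet {z | MemLp (fun x => g (x, z)) 2 μ} := by
  have hset : {z | MemLp (fun x => g (x, z)) 2 μ} = {z | ∫⁻ x, ‖g (x, z)‖ₑ ^ 2 ∂μ < ∞} := by
    ext z
    have hgz : AEStronglyMeasurable (fun x => g (x, z)) μ :=
      (hg.comp_measurable measurable_prodMk_right).aestronglyMeasurable
    simp only [Set.mem_ofPred_eq, MemLp, hgz, true_and, eLpNorm_two_eq,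
      ENNReal.rpow_lt_top_iff_of_pos (by norm_num : (0 : ℝ) < 1 / 2)]
  rw [hset]
  exact measurableSet_lt ((hg.enorm.pow_const 2).lintegral_prod_left') measurable_const

lemma memLp_two_lintegral_enorm [SFinite μ] [SFinite ν] {E : Type*} [NormedAddCommGroup E]
    {f : X × Z → E} (hf : AEStronglyMeasurable f (μ.prod ν))
    (hfin : ∫⁻ z, eLpNorm (fun x => f (x, z)) 2 μ ∂ν ≠ ∞) :
    MemLp (fun x => ∫⁻ z, ‖f (x, z)‖ₑ ∂ν) 2 μ := by
  refine ⟨hf.enorm.lintegral_prod_right'.aestronglyMeasurable, ?_⟩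
  refine (eLpNorm_two_lintegral_le hf.enorm).trans_lt (lt_of_le_of_lt ?_ hfin.lt_top)
  simp only [eLpNorm_enorm, le_refl]

lemma ae_integrable_of_lintegral_eLpNorm_two_ne_top [SFinite μ] [SFinite ν] {E : Type*}
    [NormedAddCommGroup E] {f : X × Z → E} (hf : AEStronglyMeasurable f (μ.prod ν))
    (hfin : ∫⁻ z, eLpNorm (fun x => f (x, z)) 2 μ ∂ν ≠ ∞) :
    ∀ᵐ x ∂μ, Integrable (fun z => f (x, z)) ν := by
  have hsq := (memLp_two_lintegral_enorm hf hfin).2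
  replace hsq := ENNReal.pow_lt_top hsq (n := 2)
  simp only [eLpNorm_two_sq, enorm_eq_self] at hsq
  filter_upwards [ae_lt_top' (hf.enorm.lintegral_prod_right'.pow_const 2) hsq.ne,
    hf.prodMk_left] with x hx hxm
  exact ⟨hxm, by simpa [HasFiniteIntegral] using hx⟩

lemma memLp_two_integral [SFinite μ] [SFinite ν] {E : Type*} [NormedAddCommGroup E]
    [NormedSpace ℝ E] {f : X × Z → E} (hf : AEStronglyMeasurable f (μ.prod ν))
    (hfin : ∫⁻ z, eLpNorm (fun x => f (x, z)) 2 μ ∂ν ≠ ∞) :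
    MemLp (fun x => ∫ z, f (x, z) ∂ν) 2 μ :=
  ⟨hf.integral_prod_right', (eLpNorm_mono_enorm fun _ =>
    enorm_integral_le_lintegral_enorm _).trans_lt (memLp_two_lintegral_enorm hf hfin).2⟩

lemma integrable_prod_mul_of_memLp_two [SFinite μ] [SFinite ν] {f : X × Z → ℂ} {χ : X → ℂ}
    (hχ : MemLp χ 2 μ) (hf : AEStronglyMeasurable f (μ.prod ν))
    (hfin : ∫⁻ z, eLpNorm (fun x => f (x, z)) 2 μ ∂ν ≠ ∞) :
    Integrable (fun y : X × Z => χ y.1 * f y) (μ.prod ν) := by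
  have hmeas : AEStronglyMeasurable (fun y : X × Z => χ y.1 * f y) (μ.prod ν) :=
    hχ.1.comp_fst.mul hf
  refine ⟨hmeas, ?_⟩
  calc ∫⁻ y, ‖χ y.1 * f y‖ₑ ∂(μ.prod ν)
      = ∫⁻ x, ‖χ x‖ₑ * ∫⁻ z, ‖f (x, z)‖ₑ ∂ν ∂μ := by
        rw [lintegral_prod _ hmeas.enorm]
        simp only [enorm_mul, lintegral_const_mul' _ _ enorm_ne_top]
    _ ≤ eLpNorm (fun x => ‖χ x‖ₑ) 2 μ * eLpNorm (fun x => ∫⁻ z, ‖f (x, z)‖ₑ ∂ν) 2 μ :=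
        lintegral_mul_le_eLpNorm_two_mul_eLpNorm_two hχ.1.enorm hf.enorm.lintegral_prod_right'
    _ < ∞ := ENNReal.mul_lt_top (by simpa only [eLpNorm_enorm] using hχ.2)
        (memLp_two_lintegral_enorm hf hfin).2

/-- An extended norm on real functions which is finite only on `L²`, dominates the `L²` norm, and
is a countable supremum of moduli of `L²` pairings. The last property makes it measurable in
parameters and subject to Minkowski's integral inequality. -/
structure IsDualNorm (μ : Measure X) (N : (X → ℝ) → ℝ≥0∞) : Prop where
  eq_top : ∀ u, ¬ MemLp u 2 μ → N u = ∞
  eLpNorm_le : ∀ u, eLpNorm u 2 μ ≤ N u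
  exists_dual : ∃ χ : ℕ × ℕ → X → ℂ, (∀ k, MemLp (χ k) 2 μ) ∧
    ∀ u, MemLp u 2 μ → N u = ⨆ k, ‖∫ x, χ k x * (u x : ℂ) ∂μ‖ₑ

namespace IsDualNorm

variable {N : (X → ℝ) → ℝ≥0∞}

lemma memLp (hN : IsDualNorm μ N) {u : X → ℝ} (hu : N u ≠ ∞) : MemLp u 2 μ := by
  by_contra h
  exact hu (hN.eq_top u h)

lemma congr_ae (hN : IsDualNorm μ N) {u w : X → ℝ} (h : u =ᵐ[μ] w) : N u = N w := by
  obtain ⟨χ, -, hdual⟩ := hN.exists_dual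
  by_cases hu : MemLp u 2 μ
  · rw [hdual u hu, hdual w ((memLp_congr_ae h).1 hu)]
    refine iSup_congr fun k => congrArg _ (integral_congr_ae ?_)
    filter_upwards [h] with x hx
    rw [hx]
  · rw [hN.eq_top u hu, hN.eq_top w fun hw => hu ((memLp_congr_ae h).2 hw)]

lemma zero (hN : IsDualNorm μ N) : N (fun _ => 0) = 0 := by
  obtain ⟨χ, -, hdual⟩ := hN.exists_dual
  rw [hdual _ MemLp.zero']
  simp

lemma ae_eq_zero (hN : IsDualNorm μ N) {u : X → ℝ} (hu : N u = 0) : u =ᵐ[μ] 0 := by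
  have h := hN.eLpNorm_le u
  rw [hu, nonpos_iff_eq_zero] at h
  exact (eLpNorm_eq_zero_iff (hN.memLp (by simp [hu])).1 two_ne_zero).1 h

lemma mul_const (hN : IsDualNorm μ N) (u : X → ℝ) (c : ℝ) :
    N (fun x => u x * c) = N u * ‖c‖ₑ := by
  rcases eq_or_ne c 0 with rfl | hc
  · simp [hN.zero]
  obtain ⟨χ, -, hdual⟩ := hN.exists_dual
  by_cases hu : MemLp u 2 μ
  · rw [hdual u hu, hdual _ (hu.mul_const c), ENNReal.iSup_mul]
    refine iSup_congr fun k => ?_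
    simp only [Complex.ofReal_mul, ← mul_assoc]
    rw [integral_mul_const, enorm_mul, ← ofReal_norm (c : ℂ), Complex.norm_real, ofReal_norm]
  · rw [hN.eq_top u hu, ENNReal.top_mul (by simpa using hc)]
    refine hN.eq_top _ fun h => hu ?_
    simpa [hc] using h.mul_const c⁻¹

lemma add_le (hN : IsDualNorm μ N) (u w : X → ℝ) : N (fun x => u x + w x) ≤ N u + N w := by
  by_cases hu : N u = ∞
  · simp [hu]
  by_cases hw : N w = ∞
  · simp [hw]
  replace hu := hN.memLp hu
  replace hw := hN.memLp hw
  obtain ⟨χ, hχ, hdual⟩ := hN.exists_dual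
  rw [hdual u hu, hdual w hw, hdual (fun x => u x + w x) (hu.add hw)]
  refine iSup_le fun k => ?_
  have hinteg : ∀ {y : X → ℝ}, MemLp y 2 μ → Integrable (fun x => χ k x * (y x : ℂ)) μ :=
    fun hy => (hχ k).integrable_mul hy.ofReal
  simp only [Complex.ofReal_add, mul_add]
  rw [integral_add (hinteg hu) (hinteg hw)]
  exact (enorm_add_le _ _).trans (add_le_add
    (le_iSup (fun k => ‖∫ x, χ k x * (u x : ℂ) ∂μ‖ₑ) k)
    (le_iSup (fun k => ‖∫ x, χ k x * (w x : ℂ) ∂μ‖ₑ) k))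

lemma sub_le (hN : IsDualNorm μ N) (u w : X → ℝ) : N (fun x => u x - w x) ≤ N u + N w := by
  have h := hN.add_le u fun x => w x * (-1)
  rw [hN.mul_const] at h
  simpa [sub_eq_add_neg] using h

lemma measurable_section (hN : IsDualNorm μ N) [SFinite μ] {g : X × Z → ℝ}
    (hg : StronglyMeasurable g) : Measurable fun z => N fun x => g (x, z) := by
  obtain ⟨χ, hχ, hdual⟩ := hN.exists_dual
  replace hχ := fun k => (hχ k).aestronglyMeasurable
  have hpair : ∀ k, Measurable fun z => ‖∫ x, (hχ k).mk (χ k) x * (g (x, z) : ℂ) ∂μ‖ₑ := by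
    intro k
    refine StronglyMeasurable.enorm (StronglyMeasurable.integral_prod_left'
      (f := fun y : X × Z => (hχ k).mk (χ k) y.1 * (g y : ℂ)) ?_)
    exact ((hχ k).stronglyMeasurable_mk.comp_measurable measurable_fst).mul
      (Complex.continuous_ofReal.comp_stronglyMeasurable hg)
  classical
  set S : Set Z := {z | MemLp (fun x => g (x, z)) 2 μ}
  have hS : MeasurableSet S := measurableSet_memLp_two_section hg
  suffices (fun z => N fun x => g (x, z)) = S.piecewise
      (fun z => ⨆ k, ‖∫ x, (hχ k).mk (χ k) x * (g (x, z) : ℂ) ∂μ‖ₑ) fun _ => ∞ by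
    rw [this]
    exact (Measurable.iSup hpair).piecewise hS measurable_const
  ext z
  by_cases hz : z ∈ S
  · rw [Set.piecewise_eq_of_mem _ _ _ hz, hdual _ hz]
    refine iSup_congr fun k => congrArg _ (integral_congr_ae ?_)
    filter_upwards [(hχ k).ae_eq_mk] with x hx
    rw [hx]
  · rw [Set.piecewise_eq_of_notMem _ _ _ hz, hN.eq_top _ hz]

lemma aemeasurable (hN : IsDualNorm μ N) [SFinite μ] [SFinite ν] {f : X → Z → ℝ}
    (hf : AEStronglyMeasurable (Function.uncurry f) (μ.prod ν)) :
    AEMeasurable (fun z => N fun x => f x z) ν := by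
  have hmk : ∀ᵐ z ∂ν, ∀ᵐ x ∂μ, f x z = hf.mk _ (x, z) := Measure.ae_ae_of_ae_prod
    ((Measure.measurePreserving_swap (μ := ν) (ν := μ)).quasiMeasurePreserving.ae hf.ae_eq_mk)
  refine ⟨_, hN.measurable_section hf.stronglyMeasurable_mk, ?_⟩
  filter_upwards [hmk] with z hz
  exact hN.congr_ae hz

theorem integral_le (hN : IsDualNorm μ N) [SFinite μ] [SFinite ν] {f : X → Z → ℝ}
    (hf : AEStronglyMeasurable (Function.uncurry f) (μ.prod ν))
    (hfin : ∫⁻ z, N (fun x => f x z) ∂ν ≠ ∞) :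
    N (fun x => ∫ z, f x z ∂ν) ≤ ∫⁻ z, N (fun x => f x z) ∂ν := by
  obtain ⟨χ, hχ, hdual⟩ := hN.exists_dual
  have hL2 : ∫⁻ z, eLpNorm (fun x => f x z) 2 μ ∂ν ≠ ∞ :=
    ne_top_of_le_ne_top hfin (lintegral_mono fun z => hN.eLpNorm_le _)
  rw [hdual (fun x => ∫ z, f x z ∂ν) (memLp_two_integral hf hL2)]
  refine iSup_le fun k => ?_
  have hinteg : Integrable (Function.uncurry fun x z => χ k x * (f x z : ℂ)) (μ.prod ν) :=
    integrable_prod_mul_of_memLp_two (hχ k) (Complex.continuous_ofReal.comp_aestronglyMeasurable hf)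
      (by simpa [eLpNorm, eLpNorm', ← ofReal_norm] using hL2)
  calc ‖∫ x, χ k x * ((∫ z, f x z ∂ν : ℝ) : ℂ) ∂μ‖ₑ
      = ‖∫ z, ∫ x, χ k x * (f x z : ℂ) ∂μ ∂ν‖ₑ := by
        simp only [← integral_integral_swap hinteg, integral_const_mul, integral_complex_ofReal]
    _ ≤ ∫⁻ z, ‖∫ x, χ k x * (f x z : ℂ) ∂μ‖ₑ ∂ν := enorm_integral_le_lintegral_enorm _
    _ ≤ ∫⁻ z, N (fun x => f x z) ∂ν := lintegral_mono fun z => ?_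
  by_cases hz : MemLp (fun x => f x z) 2 μ
  · rw [hdual _ hz]
    exact le_iSup (fun k => ‖∫ x, χ k x * (f x z : ℂ) ∂μ‖ₑ) k
  · simp only [hN.eq_top _ hz, le_top]

lemma ae_integrable (hN : IsDualNorm μ N) [SFinite μ] [SFinite ν] {f : X → Z → ℝ}
    (hf : AEStronglyMeasurable (Function.uncurry f) (μ.prod ν))
    (hfin : ∫⁻ z, N (fun x => f x z) ∂ν ≠ ∞) : ∀ᵐ x ∂μ, Integrable (f x) ν :=
  ae_integrable_of_lintegral_eLpNorm_two_ne_top hf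
    (ne_top_of_le_ne_top hfin (lintegral_mono fun _ => hN.eLpNorm_le _))

end IsDualNorm

end DualNorm

lemma integral_norm_sq_eq_eLpNorm_two_sq {X E : Type*} [MeasurableSpace X] {μ : Measure X}
    [NormedAddCommGroup E] {ψ : X → E} (hψ : MemLp ψ 2 μ) :
    ∫ x, ‖ψ x‖ ^ 2 ∂μ = (eLpNorm ψ 2 μ).toReal ^ 2 := by
  have h := ENNReal.pow_lt_top hψ.2 (n := 2)
  rw [eLpNorm_two_sq] at h
  rw [← ENNReal.toReal_pow, eLpNorm_two_sq, ← integral_toReal (hψ.1.enorm.pow_const 2)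
    (ae_lt_top' (hψ.1.enorm.pow_const 2) h.ne)]
  simp only [ENNReal.toReal_pow, toReal_enorm]

namespace SpatialDomain

instance instSecondCountableTopologyLpFreq (d : ℕ) (Ω : SpatialDomain) :
    SecondCountableTopology (Lp ℂ 2 (Ω.freqVol d)) := by
  have : Fact ((2 : ℝ≥0∞) ≠ ∞) := ⟨by simp⟩
  cases Ω
  · change SecondCountableTopology (Lp ℂ 2 (volume : Measure (EuclideanSpace ℝ (Fin d))))
    infer_instance
  · change SecondCountableTopology (Lp ℂ 2 (Measure.count : Measure (Fin d → ℤ)))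
    infer_instance

variable {d : ℕ} {Ω : SpatialDomain} {s : ℝ}

lemma besselWeight_nonneg (ξ : Ω.Freq d) : 0 ≤ Ω.besselWeight d s ξ := by
  have := Ω.freqSq_nonneg d ξ
  unfold besselWeight
  positivity

lemma ofReal_besselWeight_mul_enorm_sq (ξ : Ω.Freq d) (z : ℂ) :
    ENNReal.ofReal (Ω.besselWeight d s ξ) * ‖z‖ₑ ^ 2 = ‖√(Ω.besselWeight d s ξ) • z‖ₑ ^ 2 := by
  rw [enorm_smul, mul_pow, Real.enorm_of_nonneg (Real.sqrt_nonneg _),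
    ← ENNReal.ofReal_pow (Real.sqrt_nonneg _), Real.sq_sqrt (besselWeight_nonneg ξ)]

lemma memLp_of_hsNorm_ne_top {u : Ω.Pt d → ℝ} (hu : Ω.hsNorm d s u ≠ ∞) :
    MemLp u 2 (Ω.vol d) := by
  by_contra h
  exact hu (if_neg h)

lemma hsNorm_eq_eLpNorm_fourier {u : Ω.Pt d → ℝ} (hu : MemLp u 2 (Ω.vol d)) :
    Ω.hsNorm d s u =
      eLpNorm (fun ξ => √(Ω.besselWeight d s ξ) • Ω.fourier d u ξ) 2 (Ω.freqVol d) := by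
  simp only [hsNorm, if_pos hu, eLpNorm_two_eq, ofReal_besselWeight_mul_enorm_sq]

lemma hsNorm_eq_eLpNorm_plancherel {u : Ω.Pt d → ℝ}
    (hu : MemLp (fun x => (u x : ℂ)) 2 (Ω.vol d)) :
    Ω.hsNorm d s u = eLpNorm
      (fun ξ => √(Ω.besselWeight d s ξ) • Ω.plancherel d (hu.toLp _) ξ) 2 (Ω.freqVol d) := by
  rw [hsNorm_eq_eLpNorm_fourier (by simpa using hu.re)]
  refine eLpNorm_congr_ae ?_
  filter_upwards [Ω.fourier_ae_eq d hu] with ξ hξ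
  rw [hξ]

theorem isDualNorm_hsNorm (hs : 0 ≤ s) : IsDualNorm (Ω.vol d) (Ω.hsNorm d s) where
  eq_top u hu := if_neg hu
  eLpNorm_le u := by
    by_cases hu : MemLp u 2 (Ω.vol d)
    · have huc : MemLp (fun x => (u x : ℂ)) 2 (Ω.vol d) := hu.ofReal
      calc eLpNorm u 2 (Ω.vol d)
          = ‖Ω.plancherel d (huc.toLp _)‖ₑ := by
            rw [LinearIsometry.enorm_map, Lp.enorm_toLp]
            exact eLpNorm_congr_norm_ae (ae_of_all _ fun x => (Complex.norm_real _).symm)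
        _ = eLpNorm (Ω.plancherel d (huc.toLp _)) 2 (Ω.freqVol d) := Lp.enorm_def _
        _ ≤ Ω.hsNorm d s u := by
            rw [hsNorm_eq_eLpNorm_plancherel huc]
            refine eLpNorm_mono fun ξ => ?_
            rw [norm_smul, Real.norm_of_nonneg (Real.sqrt_nonneg _)]
            exact le_mul_of_one_le_left (norm_nonneg _)
              (Real.one_le_sqrt.2 (Ω.one_le_besselWeight d hs ξ))
    · rw [hsNorm, if_neg hu]
      exact le_top
  exists_dual := by
    obtain ⟨χ, hχ, h⟩ := exists_seq_sqrt_lintegral_eq_iSup_integral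
      (Ω.plancherel d).toContinuousLinearMap (Ω.measurable_besselWeight d s) besselWeight_nonneg
    refine ⟨χ, hχ, fun u hu => ?_⟩
    have huc : MemLp (fun x => (u x : ℂ)) 2 (Ω.vol d) := hu.ofReal
    simp only [ofReal_besselWeight_mul_enorm_sq, ← eLpNorm_two_eq,
      LinearIsometry.coe_toContinuousLinearMap] at h
    rw [hsNorm_eq_eLpNorm_plancherel huc, h]
    refine iSup_congr fun k => congrArg _ (integral_congr_ae ?_)
    filter_upwards [huc.coeFn_toLp] with x hx
    rw [hx]

lemma exists_hsNorm_mul_le_of_ne_top (Ω : SpatialDomain) (hs : (d : ℝ) / 2 < s) :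
    ∃ C : ℝ≥0∞, C ≠ ∞ ∧ ∀ u w : Ω.Pt d → ℝ, Ω.hsNorm d s u ≠ ∞ → Ω.hsNorm d s w ≠ ∞ →
      Ω.hsNorm d s (fun x => u x * w x) ≤ C * (Ω.hsNorm d s u * Ω.hsNorm d s w) := by
  obtain ⟨C, hC, hmul⟩ := Ω.exists_plancherel_mul_le hs
  refine ⟨C, hC.ne, fun u w hu hw => ?_⟩
  have huc : MemLp (fun x => (u x : ℂ)) 2 (Ω.vol d) := (memLp_of_hsNorm_ne_top hu).ofReal
  have hwc : MemLp (fun x => (w x : ℂ)) 2 (Ω.vol d) := (memLp_of_hsNorm_ne_top hw).ofReal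
  rw [hsNorm_eq_eLpNorm_plancherel huc] at hu ⊢
  rw [hsNorm_eq_eLpNorm_plancherel hwc] at hw ⊢
  obtain ⟨hprod, hle⟩ := hmul hu.lt_top hw.lt_top
  have hae : (fun x => huc.toLp _ x * hwc.toLp _ x) =ᵐ[Ω.vol d] fun x => ((u x * w x : ℝ) : ℂ) := by
    filter_upwards [huc.coeFn_toLp, hwc.coeFn_toLp] with x hx hy
    rw [hx, hy, Complex.ofReal_mul]
  have huwc : MemLp (fun x => ((u x * w x : ℝ) : ℂ)) 2 (Ω.vol d) := (memLp_congr_ae hae).1 hprod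
  rwa [hsNorm_eq_eLpNorm_plancherel huwc, ← (MemLp.toLp_eq_toLp_iff hprod huwc).2 hae]

theorem exists_hsNorm_mul_le (Ω : SpatialDomain) (hs : (d : ℝ) / 2 < s) :
    ∃ C : ℝ≥0∞, C ≠ ∞ ∧ ∀ u w : Ω.Pt d → ℝ,
      Ω.hsNorm d s (fun x => u x * w x) ≤ C * (Ω.hsNorm d s u * Ω.hsNorm d s w) := by
  have hN := isDualNorm_hsNorm (d := d) (Ω := Ω) ((by positivity : (0 : ℝ) ≤ d / 2).trans hs.le)
  obtain ⟨C, hC, hmul⟩ := exists_hsNorm_mul_le_of_ne_top Ω hs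
  -- replacing `C` by `max C 1` makes the right-hand side infinite when one norm is
  refine ⟨max C 1, by simp [hC], fun u w => ?_⟩
  have hC0 : max C 1 ≠ 0 := (zero_lt_one.trans_le (le_max_right _ _)).ne'
  have hzero : ∀ y : Ω.Pt d → ℝ, y =ᵐ[Ω.vol d] 0 → Ω.hsNorm d s y = 0 := fun y hy =>
    (hN.congr_ae hy).trans hN.zero
  by_cases hu0 : Ω.hsNorm d s u = 0
  · rw [hzero _ ((hN.ae_eq_zero hu0).mono fun x hx => by simp [hx])]
    exact zero_le
  by_cases hw0 : Ω.hsNorm d s w = 0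
  · rw [hzero _ ((hN.ae_eq_zero hw0).mono fun x hx => by simp [hx])]
    exact zero_le
  by_cases hu : Ω.hsNorm d s u = ∞
  · simp [hu, hw0, hC0]
  by_cases hw : Ω.hsNorm d s w = ∞
  · simp [hw, hu0, hC0]
  exact (hmul u w hu hw).trans (by gcongr; exact le_max_left _ _)

lemma memLp_sqrt_besselWeight_smul_fourier {u : Ω.Pt d → ℝ} (hu : Ω.hsNorm d s u ≠ ∞) :
    MemLp (fun ξ => √(Ω.besselWeight d s ξ) • Ω.fourier d u ξ) 2 (Ω.freqVol d) := by
  have huL2 := memLp_of_hsNorm_ne_top hu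
  refine ⟨(Ω.measurable_besselWeight d s).sqrt.aestronglyMeasurable.smul
    ((Lp.aestronglyMeasurable _).congr (Ω.fourier_ae_eq d huL2.ofReal).symm), ?_⟩
  rw [← hsNorm_eq_eLpNorm_fourier huL2]
  exact hu.lt_top

lemma besselWeight_mul_norm_sq (ξ : Ω.Freq d) (z : ℂ) :
    Ω.besselWeight d s ξ * ‖z‖ ^ 2 = ‖√(Ω.besselWeight d s ξ) • z‖ ^ 2 := by
  rw [norm_smul, mul_pow, Real.norm_of_nonneg (Real.sqrt_nonneg _),
    Real.sq_sqrt (besselWeight_nonneg ξ)]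

lemma integrable_besselWeight_mul_norm_fourier_sq {u : Ω.Pt d → ℝ} (hu : Ω.hsNorm d s u ≠ ∞) :
    Integrable (fun ξ => Ω.besselWeight d s ξ * ‖Ω.fourier d u ξ‖ ^ 2) (Ω.freqVol d) := by
  simp only [besselWeight_mul_norm_sq]
  exact (memLp_sqrt_besselWeight_smul_fourier hu).integrable_norm_pow two_ne_zero

lemma integral_besselWeight_mul_norm_fourier_sq {u : Ω.Pt d → ℝ} (hu : Ω.hsNorm d s u ≠ ∞) :
    ∫ ξ, Ω.besselWeight d s ξ * ‖Ω.fourier d u ξ‖ ^ 2 ∂Ω.freqVol d =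
      (Ω.hsNorm d s u).toReal ^ 2 := by
  simp only [besselWeight_mul_norm_sq, hsNorm_eq_eLpNorm_fourier (memLp_of_hsNorm_ne_top hu)]
  exact integral_norm_sq_eq_eLpNorm_two_sq (memLp_sqrt_besselWeight_smul_fourier hu)

lemma fourier_add_ae_eq {u w : Ω.Pt d → ℝ} (hu : MemLp u 2 (Ω.vol d)) (hw : MemLp w 2 (Ω.vol d)) :
    Ω.fourier d (fun x => u x + w x) =ᵐ[Ω.freqVol d]
      fun ξ => Ω.fourier d u ξ + Ω.fourier d w ξ := by
  have huc : MemLp (fun x => (u x : ℂ)) 2 (Ω.vol d) := hu.ofReal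
  have hwc : MemLp (fun x => (w x : ℂ)) 2 (Ω.vol d) := hw.ofReal
  have hsum : MemLp (fun x => ((u x + w x : ℝ) : ℂ)) 2 (Ω.vol d) := (hu.add hw).ofReal
  have hadd : hsum.toLp _ = huc.toLp _ + hwc.toLp _ := by
    rw [← MemLp.toLp_add, MemLp.toLp_eq_toLp_iff]
    exact ae_of_all _ fun _ => Complex.ofReal_add _ _
  filter_upwards [Ω.fourier_ae_eq d huc, Ω.fourier_ae_eq d hwc, Ω.fourier_ae_eq d hsum,
    Lp.coeFn_add (Ω.plancherel d (huc.toLp _)) (Ω.plancherel d (hwc.toLp _))] with ξ hu hw hs ha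
  rw [hu, hw, hs, hadd, map_add, ha, Pi.add_apply]

lemma fourier_sub_ae_eq {u w : Ω.Pt d → ℝ} (hu : MemLp u 2 (Ω.vol d)) (hw : MemLp w 2 (Ω.vol d)) :
    Ω.fourier d (fun x => u x - w x) =ᵐ[Ω.freqVol d]
      fun ξ => Ω.fourier d u ξ - Ω.fourier d w ξ := by
  have h := fourier_add_ae_eq (hu.sub hw) hw
  simp only [Pi.sub_apply, sub_add_cancel] at h
  filter_upwards [h] with ξ hξ
  rw [hξ]
  simp [Pi.sub_def]

theorem hsInner_eq_polarization (hs : 0 ≤ s) {u w : Ω.Pt d → ℝ} (hu : Ω.hsNorm d s u ≠ ∞)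
    (hw : Ω.hsNorm d s w ≠ ∞) :
    Ω.hsInner d s u w = ((Ω.hsNorm d s fun x => u x + w x).toReal ^ 2 -
      (Ω.hsNorm d s fun x => u x - w x).toReal ^ 2) / 4 := by
  have hN := isDualNorm_hsNorm (d := d) (Ω := Ω) hs
  have hfin := ENNReal.add_ne_top.2 ⟨hu, hw⟩
  have hadd := ne_top_of_le_ne_top hfin (hN.add_le u w)
  have hsub := ne_top_of_le_ne_top hfin (hN.sub_le u w)
  rw [← integral_besselWeight_mul_norm_fourier_sq hadd,
    ← integral_besselWeight_mul_norm_fourier_sq hsub,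
    ← integral_sub (integrable_besselWeight_mul_norm_fourier_sq hadd)
      (integrable_besselWeight_mul_norm_fourier_sq hsub), ← integral_div, hsInner]
  refine integral_congr_ae ?_
  filter_upwards [fourier_add_ae_eq (hN.memLp hu) (hN.memLp hw),
    fourier_sub_ae_eq (hN.memLp hu) (hN.memLp hw)] with ξ hplus hminus
  rw [hplus, hminus, ← Complex.normSq_eq_norm_sq, ← Complex.normSq_eq_norm_sq,
    Complex.normSq_add, Complex.normSq_sub]
  ring

theorem enorm_hsInner_le {u w : Ω.Pt d → ℝ} (hu : Ω.hsNorm d s u ≠ ∞)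
    (hw : Ω.hsNorm d s w ≠ ∞) :
    ‖Ω.hsInner d s u w‖ₑ ≤ Ω.hsNorm d s u * Ω.hsNorm d s w := by
  have hcs := lintegral_mul_le_eLpNorm_two_mul_eLpNorm_two
    (memLp_sqrt_besselWeight_smul_fourier hu).1.enorm
    (memLp_sqrt_besselWeight_smul_fourier hw).1.enorm
  simp only [eLpNorm_enorm] at hcs
  rw [hsNorm_eq_eLpNorm_fourier (memLp_of_hsNorm_ne_top hu),
    hsNorm_eq_eLpNorm_fourier (memLp_of_hsNorm_ne_top hw)]
  refine ((enorm_integral_le_lintegral_enorm _).trans (lintegral_mono fun ξ => ?_)).trans hcs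
  rw [← enorm_mul, ← ofReal_norm, ← ofReal_norm]
  refine ENNReal.ofReal_le_ofReal ?_
  calc ‖Ω.besselWeight d s ξ * (Ω.fourier d u ξ * starRingEnd ℂ (Ω.fourier d w ξ)).re‖
      ≤ Ω.besselWeight d s ξ * (‖Ω.fourier d u ξ‖ * ‖Ω.fourier d w ξ‖) := by
        rw [norm_mul, Real.norm_of_nonneg (besselWeight_nonneg ξ)]
        gcongr
        · exact besselWeight_nonneg ξ
        · exact (Complex.abs_re_le_norm _).trans (by simp)
    _ = _ := by
        rw [norm_mul, norm_smul, norm_smul, mul_mul_mul_comm,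
          Real.norm_of_nonneg (Real.sqrt_nonneg _), Real.mul_self_sqrt (besselWeight_nonneg ξ)]

end SpatialDomain

section Measurability

variable {X Y Z E : Type*} [MeasurableSpace X] [MeasurableSpace Y] [MeasurableSpace Z]
  [NormedAddCommGroup E] {μ : Measure X} {ρ : Measure Y} {ν : Measure Z}

lemma ae_ne_top_of_eLpNorm_ne_top {p : ℝ≥0∞} (hp : p ≠ 0) {φ : X → ℝ≥0∞} (hφ : AEMeasurable φ μ)
    (h : eLpNorm φ p μ ≠ ∞) : ∀ᵐ x ∂μ, φ x ≠ ∞ := by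
  rcases eq_or_ne p ∞ with rfl | hp_top
  · rw [eLpNorm_exponent_top] at h
    filter_upwards [ae_le_eLpNormEssSup (f := φ) (μ := μ)] with x hx
    exact ne_top_of_le_ne_top h hx
  · have hinteg := lintegral_rpow_enorm_lt_top_of_eLpNorm_lt_top hp hp_top h.lt_top
    filter_upwards [ae_lt_top' (hφ.pow_const _) hinteg.ne] with x hx hx_top
    simp [hx_top, ENNReal.toReal_pos hp hp_top] at hx

variable [SFinite μ] [SFinite ρ] [SFinite ν]

lemma ae_ae_swap_of_ae_prod {r : X × Y → Prop} (h : ∀ᵐ w ∂μ.prod ρ, r w) :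
    ∀ᵐ y ∂ρ, ∀ᵐ x ∂μ, r (x, y) :=
  Measure.ae_ae_of_ae_prod
    ((Measure.measurePreserving_swap (μ := ρ) (ν := μ)).quasiMeasurePreserving.ae h)

lemma ae_prod_integrable_of_ae_ae_integrable {F : (X × Y) × Z → E}
    (hF : AEStronglyMeasurable F ((μ.prod ρ).prod ν))
    (h : ∀ᵐ y ∂ρ, ∀ᵐ x ∂μ, Integrable (fun z => F ((x, y), z)) ν) :
    ∀ᵐ w ∂μ.prod ρ, Integrable (fun z => F (w, z)) ν := by
  have hmk : ∀ᵐ w ∂μ.prod ρ, (fun z => F (w, z)) =ᵐ[ν] fun z => hF.mk F (w, z) :=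
    Measure.ae_ae_of_ae_prod hF.ae_eq_mk
  have hset : MeasurableSet {w : X × Y | Integrable (fun z => hF.mk F (w, z)) ν} :=
    measurableSet_integrable (f := fun w z => hF.mk F (w, z)) hF.stronglyMeasurable_mk
  have hmk_int : ∀ᵐ y ∂ρ, ∀ᵐ x ∂μ, Integrable (fun z => hF.mk F ((x, y), z)) ν := by
    filter_upwards [h, ae_ae_swap_of_ae_prod hmk] with y hy hmky
    filter_upwards [hy, hmky] with x hx hmkx
    exact hx.congr hmkx
  filter_upwards [hmk, (Measure.ae_prod_iff_ae_ae hset).2 ((Measure.ae_ae_comm hset).2 hmk_int)]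
    with w hmkw hw
  exact hw.congr hmkw.symm

end Measurability

namespace Boltzmann

section CollisionIntegral

variable {d : ℕ} {X : Type*} {T : Vel d × Vel d × Sph d → Vel d × Vel d}

/-- The integrand `|v - v_*| f g` along a collision map: the gain part for `collMap`, the loss part
for `lossMap`. -/
def collIntegrand (T : Vel d × Vel d × Sph d → Vel d × Vel d) (f g : X → Vel d → ℝ) (x : X)
    (v : Vel d) (z : Vel d × Sph d) : ℝ :=
  ‖v - z.1‖ * (f x (T (v, z)).1 * g x (T (v, z)).2)

/-- The gain or loss part of the collision operator, according to the collision map. -/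
def collTerm (T : Vel d × Vel d × Sph d → Vel d × Vel d) (f g : X → Vel d → ℝ) (x : X)
    (v : Vel d) : ℝ :=
  ∫ z, collIntegrand T f g x v z ∂(collMeasure d)

variable [MeasurableSpace X] {μ : Measure X} {N : (X → ℝ) → ℝ≥0∞} {f g : X → Vel d → ℝ}

lemma lintegral_collIntegrand_le (hN : IsDualNorm μ N) {C : ℝ≥0∞} (hC : C ≠ ∞)
    (hmul : ∀ u w : X → ℝ, N (fun x => u x * w x) ≤ C * (N u * N w)) (v : Vel d) :
    ∫⁻ z, N (fun x => collIntegrand T f g x v z) ∂(collMeasure d) ≤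
      C * collInt T (fun w => N fun x => f x w) (fun w => N fun x => g x w) v := by
  rw [collInt, ← lintegral_const_mul' _ _ hC]
  refine lintegral_mono fun z => ?_
  calc N (fun x => collIntegrand T f g x v z)
      = N (fun x => f x (T (v, z)).1 * g x (T (v, z)).2) * ‖v - z.1‖ₑ := by
        simp only [collIntegrand, mul_comm ‖v - z.1‖]
        rw [hN.mul_const (fun x => f x (T (v, z)).1 * g x (T (v, z)).2), enorm_norm]
    _ ≤ C * (N (fun x => f x (T (v, z)).1) * N (fun x => g x (T (v, z)).2)) * ‖v - z.1‖ₑ := by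
        gcongr
        exact hmul _ _
    _ = _ := by ring

variable [SFinite μ]

lemma aestronglyMeasurable_collIntegrand (hT : IsCollisionMap T)
    (hf : AEStronglyMeasurable (Function.uncurry f) (μ.prod volume))
    (hg : AEStronglyMeasurable (Function.uncurry g) (μ.prod volume)) :
    AEStronglyMeasurable (fun q : (X × Vel d) × Vel d × Sph d =>
      collIntegrand T f g q.1.1 q.1.2 q.2) ((μ.prod volume).prod (collMeasure d)) := by
  have hassoc := (measurePreserving_prodAssoc μ (volume : Measure (Vel d))
    (collMeasure d)).quasiMeasurePreserving
  have hfst := QuasiMeasurePreserving.prodMap (Measure.QuasiMeasurePreserving.id μ)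
    (Measure.quasiMeasurePreserving_fst.comp hT.quasiMeasurePreserving)
  have hsnd := QuasiMeasurePreserving.prodMap (Measure.QuasiMeasurePreserving.id μ)
    (Measure.quasiMeasurePreserving_snd.comp hT.quasiMeasurePreserving)
  have hkernel : AEStronglyMeasurable (fun q : (X × Vel d) × Vel d × Sph d => ‖q.1.2 - q.2.1‖)
      ((μ.prod volume).prod (collMeasure d)) :=
    Measurable.aestronglyMeasurable (by fun_prop)
  exact hkernel.mul ((hf.comp_quasiMeasurePreserving (hfst.comp hassoc)).mul
    (hg.comp_quasiMeasurePreserving (hsnd.comp hassoc)))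

lemma ae_aestronglyMeasurable_collIntegrand (hT : IsCollisionMap T)
    (hf : AEStronglyMeasurable (Function.uncurry f) (μ.prod volume))
    (hg : AEStronglyMeasurable (Function.uncurry g) (μ.prod volume)) :
    ∀ᵐ v : Vel d, AEStronglyMeasurable (Function.uncurry fun x z => collIntegrand T f g x v z)
      (μ.prod (collMeasure d)) := by
  have hassoc := (measurePreserving_prodAssoc (volume : Measure (Vel d)) μ
    (collMeasure d)).symm
  exact ((aestronglyMeasurable_collIntegrand hT hf hg).comp_measurePreserving
    ((Measure.measurePreserving_swap.prod (MeasurePreserving.id _)).comp hassoc)).prodMk_left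

lemma aestronglyMeasurable_collTerm (hT : IsCollisionMap T)
    (hf : AEStronglyMeasurable (Function.uncurry f) (μ.prod volume))
    (hg : AEStronglyMeasurable (Function.uncurry g) (μ.prod volume)) :
    AEStronglyMeasurable (Function.uncurry (collTerm T f g)) (μ.prod volume) :=
  (aestronglyMeasurable_collIntegrand hT hf hg).integral_prod_right'

lemma ae_norm_collTerm_le (hN : IsDualNorm μ N) {C : ℝ≥0∞} (hC : C ≠ ∞)
    (hmul : ∀ u w : X → ℝ, N (fun x => u x * w x) ≤ C * (N u * N w)) (hT : IsCollisionMap T)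
    (hf : AEStronglyMeasurable (Function.uncurry f) (μ.prod volume))
    (hg : AEStronglyMeasurable (Function.uncurry g) (μ.prod volume))
    (hfin : ∀ᵐ v : Vel d, collInt T (fun w => N fun x => f x w) (fun w => N fun x => g x w) v ≠ ∞) :
    ∀ᵐ v : Vel d, N (fun x => collTerm T f g x v) ≤
      C * collInt T (fun w => N fun x => f x w) (fun w => N fun x => g x w) v := by
  filter_upwards [ae_aestronglyMeasurable_collIntegrand hT hf hg, hfin] with v hv hvfin
  have hle := lintegral_collIntegrand_le (T := T) (f := f) (g := g) hN hC hmul v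
  exact (hN.integral_le hv (ne_top_of_le_ne_top (ENNReal.mul_ne_top hC hvfin) hle)).trans hle

lemma ae_integrable_collIntegrand (hN : IsDualNorm μ N) {C : ℝ≥0∞} (hC : C ≠ ∞)
    (hmul : ∀ u w : X → ℝ, N (fun x => u x * w x) ≤ C * (N u * N w)) (hT : IsCollisionMap T)
    (hf : AEStronglyMeasurable (Function.uncurry f) (μ.prod volume))
    (hg : AEStronglyMeasurable (Function.uncurry g) (μ.prod volume))
    (hfin : ∀ᵐ v : Vel d, collInt T (fun w => N fun x => f x w) (fun w => N fun x => g x w) v ≠ ∞) :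
    ∀ᵐ w ∂μ.prod (volume : Measure (Vel d)),
      Integrable (collIntegrand T f g w.1 w.2) (collMeasure d) := by
  refine ae_prod_integrable_of_ae_ae_integrable (aestronglyMeasurable_collIntegrand hT hf hg) ?_
  filter_upwards [ae_aestronglyMeasurable_collIntegrand hT hf hg, hfin] with v hv hvfin
  exact hN.ae_integrable hv (ne_top_of_le_ne_top (ENNReal.mul_ne_top hC hvfin)
    (lintegral_collIntegrand_le hN hC hmul v))

end CollisionIntegral

variable {d : ℕ} {Ω : SpatialDomain} {s : ℝ} {p p' : ℝ≥0∞} {α : ℝ}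

/-- The product of the norms of `f` and `g`, symmetrized in which of the two carries the weight
`ν^{1/p}`. It controls every part of the collision operator. -/
def crossNorm (d : ℕ) (Ω : SpatialDomain) (s : ℝ) (p : ℝ≥0∞) (α : ℝ)
    (f g : Ω.Pt d → Vel d → ℝ) : ℝ≥0∞ :=
  polyNorm d Ω s p α f * polyNormNu d Ω s p α g + polyNormNu d Ω s p α f * polyNorm d Ω s p α g

lemma crossNorm_comm (f g : Ω.Pt d → Vel d → ℝ) :
    crossNorm d Ω s p α f g = crossNorm d Ω s p α g f := by
  rw [crossNorm, crossNorm]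
  ring

lemma MemPolyNu.crossNorm_ne_top {f g : Ω.Pt d → Vel d → ℝ} (hf : MemPolyNu d Ω s p α f)
    (hg : MemPolyNu d Ω s p α g) : crossNorm d Ω s p α f g ≠ ∞ :=
  ENNReal.add_ne_top.2 ⟨ENNReal.mul_ne_top hf.2.1.ne hg.2.2.ne,
    ENNReal.mul_ne_top hf.2.2.ne hg.2.1.ne⟩

lemma MemPolyNu.toReal_crossNorm {f g : Ω.Pt d → Vel d → ℝ} (hf : MemPolyNu d Ω s p α f)
    (hg : MemPolyNu d Ω s p α g) :
    (crossNorm d Ω s p α f g).toReal =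
      (polyNorm d Ω s p α f).toReal * (polyNormNu d Ω s p α g).toReal +
        (polyNormNu d Ω s p α f).toReal * (polyNorm d Ω s p α g).toReal := by
  rw [crossNorm, ENNReal.toReal_add (ENNReal.mul_ne_top hf.2.1.ne hg.2.2.ne)
    (ENNReal.mul_ne_top hf.2.2.ne hg.2.1.ne), ENNReal.toReal_mul, ENNReal.toReal_mul]

lemma polyNorm_eq (hs : 0 ≤ s) (f : Ω.Pt d → Vel d → ℝ) :
    polyNorm d Ω s p α f = eLpNorm (fun v => Ω.hsNorm d s (fun x => f x v) * wt α v) p volume := by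
  rw [polyNorm, lpHsNorm]
  congr 1
  funext v
  rw [(SpatialDomain.isDualNorm_hsNorm hs).mul_const (fun x => f x v),
    Real.enorm_of_nonneg (Real.rpow_nonneg (bracket_pos v).le _)]
  rfl

lemma exists_wt_le_mul_collFreq_rpow (hd : 0 < d) {r : ℝ} (hr : 0 ≤ r) :
    ∃ c : NNReal, ∀ v : Vel d, wt r v ≤ c * ENNReal.ofReal (collFreq v ^ r) := by
  obtain ⟨c, hc, hν⟩ := exists_mul_bracket_le_collFreq hd
  refine ⟨(c ^ (-r)).toNNReal, fun v => ?_⟩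
  rw [wt, ← ENNReal.ofReal, ← ENNReal.ofReal_mul (by positivity)]
  refine ENNReal.ofReal_le_ofReal ?_
  calc bracket v ^ r = c ^ (-r) * (c * bracket v) ^ r := by
        rw [Real.mul_rpow hc.le (bracket_pos v).le, ← mul_assoc, ← Real.rpow_add hc]
        simp
    _ ≤ c ^ (-r) * collFreq v ^ r := by
        gcongr
        · exact mul_nonneg hc.le (bracket_pos v).le
        · exact hν v

lemma exists_eLpNorm_hsNorm_mul_wt_add_le (hd : 0 < d) (Ω : SpatialDomain) (hs : 0 ≤ s)
    (p : ℝ≥0∞) (α : ℝ) :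
    ∃ c : NNReal, ∀ f : Ω.Pt d → Vel d → ℝ,
      eLpNorm (fun v => Ω.hsNorm d s (fun x => f x v) * wt (α + (p⁻¹).toReal) v) p volume ≤
        c * polyNormNu d Ω s p α f := by
  obtain ⟨c, hc⟩ := exists_wt_le_mul_collFreq_rpow hd (r := (p⁻¹).toReal) ENNReal.toReal_nonneg
  refine ⟨c, fun f => ?_⟩
  rw [polyNormNu, polyNorm_eq hs]
  refine eLpNorm_le_mul_eLpNorm_of_ae_le_mul' (ae_of_all _ fun v => ?_) p
  simp only [enorm_eq_self]
  rw [(SpatialDomain.isDualNorm_hsNorm hs).mul_const (fun x => f x v), wt_add,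
    Real.enorm_of_nonneg (Real.rpow_nonneg (collFreq_nonneg v) _)]
  calc Ω.hsNorm d s (fun x => f x v) * (wt α v * wt (p⁻¹).toReal v)
      ≤ Ω.hsNorm d s (fun x => f x v) *
          (wt α v * (c * ENNReal.ofReal (collFreq v ^ (p⁻¹).toReal))) := by
        gcongr
        exact hc v
    _ = _ := by ring

lemma ae_ne_top_of_eLpNorm_mul_wt_ne_top (hp : p ≠ 0) {φ : Vel d → ℝ≥0∞} (hφ : AEMeasurable φ)
    (h : eLpNorm (fun v => φ v * wt α v) p volume ≠ ∞) : ∀ᵐ v, φ v ≠ ∞ := by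
  filter_upwards [ae_ne_top_of_eLpNorm_ne_top hp (hφ.mul (measurable_wt α).aemeasurable) h]
    with v hv hφv
  have hwt : wt α v ≠ 0 := left_ne_zero_of_mul_eq_one (wt_mul_wt_neg α v)
  exact hv (by rw [Pi.mul_apply, hφv, ENNReal.top_mul hwt])

lemma ae_hsNorm_ne_top (hs : 0 ≤ s) (hp : p ≠ 0) {f : Ω.Pt d → Vel d → ℝ}
    (hf : JointlyMeasurable d Ω f) (hfin : polyNorm d Ω s p α f ≠ ∞) :
    ∀ᵐ v, Ω.hsNorm d s (fun x => f x v) ≠ ∞ :=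
  ae_ne_top_of_eLpNorm_mul_wt_ne_top hp ((SpatialDomain.isDualNorm_hsNorm hs).aemeasurable hf)
    (by rwa [polyNorm_eq hs] at hfin)

lemma polyNorm_le_add (hs : 0 ≤ s) (hp : 1 ≤ p) {f g k : Ω.Pt d → Vel d → ℝ}
    (hf : JointlyMeasurable d Ω f) (hg : JointlyMeasurable d Ω g)
    (hk : ∀ v, Ω.hsNorm d s (fun x => k x v) ≤
      Ω.hsNorm d s (fun x => f x v) + Ω.hsNorm d s (fun x => g x v)) :
    polyNorm d Ω s p α k ≤ polyNorm d Ω s p α f + polyNorm d Ω s p α g := by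
  have hN := SpatialDomain.isDualNorm_hsNorm (d := d) (Ω := Ω) hs
  rw [polyNorm_eq hs, polyNorm_eq hs, polyNorm_eq hs]
  refine le_trans (eLpNorm_mono_enorm fun v => ?_) (eLpNorm_add_le
    ((hN.aemeasurable hf).mul (measurable_wt α).aemeasurable).aestronglyMeasurable
    ((hN.aemeasurable hg).mul (measurable_wt α).aemeasurable).aestronglyMeasurable hp)
  simp only [enorm_eq_self, Pi.add_apply]
  rw [← add_mul]
  gcongr
  exact hk v

lemma polyNorm_mul_const_le (hs : 0 ≤ s) (f : Ω.Pt d → Vel d → ℝ) (c : ℝ) :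
    polyNorm d Ω s p α (fun x v => f x v * c) ≤ ‖c‖ₑ * polyNorm d Ω s p α f := by
  rw [polyNorm_eq hs, polyNorm_eq hs]
  refine eLpNorm_le_mul_eLpNorm_of_ae_le_mul' (c := ‖c‖₊) (ae_of_all _ fun v => le_of_eq ?_) p
  simp only [enorm_eq_self]
  rw [(SpatialDomain.isDualNorm_hsNorm hs).mul_const (fun x => f x v), mul_right_comm, mul_comm]
  rfl

section CollTerm

variable {T : Vel d × Vel d × Sph d → Vel d × Vel d}

lemma aemeasurable_collInt (hT : IsCollisionMap T) {φ ψ : Vel d → ℝ≥0∞} (hφ : AEMeasurable φ)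
    (hψ : AEMeasurable ψ) : AEMeasurable (collInt T φ ψ) :=
  ⟨_, hT.measurable_collInt hφ.measurable_mk hψ.measurable_mk,
    hT.collInt_congr_ae hφ.ae_eq_mk hψ.ae_eq_mk⟩

lemma exists_eLpNorm_collInt_hsNorm_le (hd : 0 < d) (Ω : SpatialDomain) (hs : 0 ≤ s)
    (hpp' : p.HolderConjugate p') (hα : 2 + (d : ℝ) * (p'⁻¹).toReal < α)
    (hT : IsCollisionMap T) :
    ∃ K : ℝ≥0∞, K ≠ ∞ ∧ ∀ f g : Ω.Pt d → Vel d → ℝ,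
      JointlyMeasurable d Ω f → JointlyMeasurable d Ω g →
      eLpNorm (fun v => collInt T (fun w => Ω.hsNorm d s fun x => f x w)
        (fun w => Ω.hsNorm d s fun x => g x w) v * wt (α - (p'⁻¹).toReal) v) p volume ≤
      K * crossNorm d Ω s p α f g := by
  obtain ⟨C, hC, hle⟩ := hT.eLpNorm_collInt_le hpp' hα
  obtain ⟨c, hc⟩ := exists_eLpNorm_hsNorm_mul_wt_add_le hd Ω hs p α
  have hN := SpatialDomain.isDualNorm_hsNorm (d := d) (Ω := Ω) hs
  refine ⟨C * c, ENNReal.mul_ne_top hC.ne ENNReal.coe_ne_top, fun f g hf hg => ?_⟩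
  refine (hle (hN.aemeasurable hf) (hN.aemeasurable hg)).trans ?_
  rw [crossNorm, mul_assoc C, polyNorm_eq hs, polyNorm_eq hs, mul_add (c : ℝ≥0∞), mul_left_comm,
    ← mul_assoc (c : ℝ≥0∞) (polyNormNu d Ω s p α f)]
  gcongr
  exacts [hc g, hc f]

variable {f g : Ω.Pt d → Vel d → ℝ}

lemma ae_collInt_hsNorm_ne_top (hd : 0 < d) (hs : 0 ≤ s) (hpp' : p.HolderConjugate p')
    (hα : 2 + (d : ℝ) * (p'⁻¹).toReal < α) (hT : IsCollisionMap T)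
    (hf : MemPolyNu d Ω s p α f) (hg : MemPolyNu d Ω s p α g) :
    ∀ᵐ v, collInt T (fun w => Ω.hsNorm d s fun x => f x w)
      (fun w => Ω.hsNorm d s fun x => g x w) v ≠ ∞ := by
  obtain ⟨K, hK, hle⟩ := exists_eLpNorm_collInt_hsNorm_le hd Ω hs hpp' hα hT
  have hN := SpatialDomain.isDualNorm_hsNorm (d := d) (Ω := Ω) hs
  exact ae_ne_top_of_eLpNorm_mul_wt_ne_top hpp'.ne_zero
    (aemeasurable_collInt hT (hN.aemeasurable hf.1) (hN.aemeasurable hg.1))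
    (ne_top_of_le_ne_top (ENNReal.mul_ne_top hK (hf.crossNorm_ne_top hg)) (hle f g hf.1 hg.1))

lemma MemPolyNu.ae_integrable_collIntegrand (hd : 0 < d) (hs : (d : ℝ) / 2 < s)
    (hpp' : p.HolderConjugate p') (hα : 2 + (d : ℝ) * (p'⁻¹).toReal < α) (hT : IsCollisionMap T)
    (hf : MemPolyNu d Ω s p α f) (hg : MemPolyNu d Ω s p α g) :
    ∀ᵐ z ∂(Ω.vol d).prod (volume : Measure (Vel d)),
      Integrable (collIntegrand T f g z.1 z.2) (collMeasure d) := by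
  have hs₀ : 0 ≤ s := (by positivity : (0 : ℝ) ≤ d / 2).trans hs.le
  obtain ⟨C, hC, hmul⟩ := SpatialDomain.exists_hsNorm_mul_le Ω hs
  exact Boltzmann.ae_integrable_collIntegrand (SpatialDomain.isDualNorm_hsNorm hs₀) hC hmul hT
    hf.1 hg.1 (ae_collInt_hsNorm_ne_top hd hs₀ hpp' hα hT hf hg)

lemma exists_polyNorm_collTerm_le (hd : 0 < d) (Ω : SpatialDomain) (hs : (d : ℝ) / 2 < s)
    (hpp' : p.HolderConjugate p') (hα : 2 + (d : ℝ) * (p'⁻¹).toReal < α)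
    (hT : IsCollisionMap T) :
    ∃ K : ℝ≥0∞, K ≠ ∞ ∧ ∀ f g : Ω.Pt d → Vel d → ℝ,
      MemPolyNu d Ω s p α f → MemPolyNu d Ω s p α g →
      polyNorm d Ω s p (α - (p'⁻¹).toReal) (collTerm T f g) ≤ K * crossNorm d Ω s p α f g := by
  have hs₀ : 0 ≤ s := (by positivity : (0 : ℝ) ≤ d / 2).trans hs.le
  obtain ⟨C, hC, hmul⟩ := SpatialDomain.exists_hsNorm_mul_le Ω hs
  obtain ⟨K, hK, hle⟩ := exists_eLpNorm_collInt_hsNorm_le hd Ω hs₀ hpp' hα hT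
  refine ⟨C * K, ENNReal.mul_ne_top hC hK, fun f g hf hg => ?_⟩
  have hpointwise := ae_norm_collTerm_le (SpatialDomain.isDualNorm_hsNorm hs₀) hC hmul hT hf.1 hg.1
    (ae_collInt_hsNorm_ne_top hd hs₀ hpp' hα hT hf hg)
  lift C to NNReal using hC
  rw [polyNorm_eq hs₀, mul_assoc]
  refine le_trans ?_ (mul_le_mul_right (hle f g hf.1 hg.1) _)
  refine eLpNorm_le_mul_eLpNorm_of_ae_le_mul' (hpointwise.mono fun v hv => ?_) p
  simp only [enorm_eq_self]
  rw [← mul_assoc]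
  gcongr

end CollTerm

section CollisionOperator

variable {f g : Ω.Pt d → Vel d → ℝ}

lemma Q_eq_collTerm (f g : Ω.Pt d → Vel d → ℝ) :
    Q f g = fun x v => (collTerm collMap f g x v - collTerm lossMap f g x v +
      (collTerm collMap g f x v - collTerm lossMap g f x v)) * (1 / 2) := by
  funext x v
  change (1 / 2) * (Qgain (f x) (g x) v - Qloss (f x) (g x) v + Qgain (g x) (f x) v -
    Qloss (g x) (f x) v) = (Qgain (f x) (g x) v - Qloss (f x) (g x) v +
    (Qgain (g x) (f x) v - Qloss (g x) (f x) v)) * (1 / 2)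
  ring

lemma MemPolyNu.ae_qConverges (hd : 0 < d) (hs : (d : ℝ) / 2 < s) (hpp' : p.HolderConjugate p')
    (hα : 2 + (d : ℝ) * (p'⁻¹).toReal < α) (hf : MemPolyNu d Ω s p α f)
    (hg : MemPolyNu d Ω s p α g) :
    ∀ᵐ z ∂(Ω.vol d).prod (volume : Measure (Vel d)), QConverges (f z.1) (g z.1) z.2 := by
  have hgain := isCollisionMap_collMap hd
  have hloss := isCollisionMap_lossMap (d := d)
  filter_upwards [hf.ae_integrable_collIntegrand hd hs hpp' hα hgain hg,
    hf.ae_integrable_collIntegrand hd hs hpp' hα hloss hg,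
    hg.ae_integrable_collIntegrand hd hs hpp' hα hgain hf,
    hg.ae_integrable_collIntegrand hd hs hpp' hα hloss hf] with z hfg hfg' hgf hgf'
  exact ⟨hfg, hfg', hgf, hgf'⟩

lemma jointlyMeasurable_collTerm_sub (hd : 0 < d) (hf : JointlyMeasurable d Ω f)
    (hg : JointlyMeasurable d Ω g) :
    JointlyMeasurable d Ω fun x v => collTerm collMap f g x v - collTerm lossMap f g x v :=
  (aestronglyMeasurable_collTerm (isCollisionMap_collMap hd) hf hg).sub
    (aestronglyMeasurable_collTerm isCollisionMap_lossMap hf hg)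

lemma jointlyMeasurable_Q (hd : 0 < d) (hf : JointlyMeasurable d Ω f)
    (hg : JointlyMeasurable d Ω g) : JointlyMeasurable d Ω (Q f g) := by
  rw [Q_eq_collTerm]
  exact ((jointlyMeasurable_collTerm_sub hd hf hg).add
    (jointlyMeasurable_collTerm_sub hd hg hf)).mul_const (1 / 2)

lemma exists_polyNorm_collTerm_sub_le (hd : 0 < d) (Ω : SpatialDomain) (hs : (d : ℝ) / 2 < s)
    (hpp' : p.HolderConjugate p') (hα : 2 + (d : ℝ) * (p'⁻¹).toReal < α) :
    ∃ K : ℝ≥0∞, K ≠ ∞ ∧ ∀ f g : Ω.Pt d → Vel d → ℝ,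
      MemPolyNu d Ω s p α f → MemPolyNu d Ω s p α g →
      polyNorm d Ω s p (α - (p'⁻¹).toReal)
        (fun x v => collTerm collMap f g x v - collTerm lossMap f g x v) ≤
          K * crossNorm d Ω s p α f g := by
  have hs₀ : 0 ≤ s := (by positivity : (0 : ℝ) ≤ d / 2).trans hs.le
  have hgain := isCollisionMap_collMap hd
  obtain ⟨K₁, hK₁, hle₁⟩ := exists_polyNorm_collTerm_le hd Ω hs hpp' hα hgain
  obtain ⟨K₂, hK₂, hle₂⟩ := exists_polyNorm_collTerm_le hd Ω hs hpp' hα isCollisionMap_lossMap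
  refine ⟨K₁ + K₂, ENNReal.add_ne_top.2 ⟨hK₁, hK₂⟩, fun f g hf hg => ?_⟩
  rw [add_mul]
  exact (polyNorm_le_add hs₀ hpp'.one_le (aestronglyMeasurable_collTerm hgain hf.1 hg.1)
    (aestronglyMeasurable_collTerm isCollisionMap_lossMap hf.1 hg.1) fun v =>
      (SpatialDomain.isDualNorm_hsNorm hs₀).sub_le _ _).trans
    (add_le_add (hle₁ f g hf hg) (hle₂ f g hf hg))

theorem exists_polyNorm_Q_le (hd : 0 < d) (Ω : SpatialDomain) (hs : (d : ℝ) / 2 < s)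
    (hpp' : p.HolderConjugate p') (hα : 2 + (d : ℝ) * (p'⁻¹).toReal < α) :
    ∃ K : NNReal, ∀ f g : Ω.Pt d → Vel d → ℝ,
      MemPolyNu d Ω s p α f → MemPolyNu d Ω s p α g →
      polyNorm d Ω s p (α - (p'⁻¹).toReal) (Q f g) ≤ K * crossNorm d Ω s p α f g := by
  have hs₀ : 0 ≤ s := (by positivity : (0 : ℝ) ≤ d / 2).trans hs.le
  obtain ⟨K, hK, hle⟩ := exists_polyNorm_collTerm_sub_le hd Ω hs hpp' hα
  lift K to NNReal using hK
  refine ⟨‖(1 / 2 : ℝ)‖₊ * (K + K), fun f g hf hg => ?_⟩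
  have hsum := (polyNorm_le_add hs₀ hpp'.one_le (jointlyMeasurable_collTerm_sub hd hf.1 hg.1)
    (jointlyMeasurable_collTerm_sub hd hg.1 hf.1) fun v =>
      (SpatialDomain.isDualNorm_hsNorm hs₀).add_le _ _).trans
    (add_le_add (hle f g hf hg) (hle g f hg hf))
  rw [Q_eq_collTerm, ENNReal.coe_mul, ENNReal.coe_add, mul_assoc, add_mul]
  rw [crossNorm_comm g f] at hsum
  exact (polyNorm_mul_const_le hs₀ _ _).trans (mul_le_mul_right hsum _)

end CollisionOperator

end Boltzmann

lemma integral_le_toReal_of_lintegral_enorm_le {X : Type*} [MeasurableSpace X] {μ : Measure X}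
    {f : X → ℝ} {B : ℝ≥0∞} (hB : B ≠ ∞) (h : ∫⁻ x, ‖f x‖ₑ ∂μ ≤ B) : ∫ x, f x ∂μ ≤ B.toReal := by
  refine (Real.le_norm_self _).trans ?_
  rw [← toReal_enorm]
  exact ENNReal.toReal_mono hB ((enorm_integral_le_lintegral_enorm f).trans h)

lemma lintegral_mul_rpow_le_eLpNorm_mul {X : Type*} [MeasurableSpace X] {μ : Measure X}
    {p : ℝ≥0∞} (hp : 1 ≤ p) (hp_top : p ≠ ∞) {φ ψ : X → ℝ≥0∞} (hφ : AEMeasurable φ μ)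
    (hψ : AEMeasurable ψ μ) :
    ∫⁻ x, φ x * ψ x ^ (p.toReal - 1) ∂μ ≤ eLpNorm φ p μ * eLpNorm ψ p μ ^ (p.toReal - 1) := by
  have hp₀ : p ≠ 0 := (one_pos.trans_le hp).ne'
  rw [eLpNorm_eq_lintegral_rpow_enorm_toReal hp₀ hp_top,
    eLpNorm_eq_lintegral_rpow_enorm_toReal hp₀ hp_top]
  simp only [enorm_eq_self]
  have hp_one : 1 ≤ p.toReal := by simpa using ENNReal.toReal_mono hp_top hp
  rcases hp_one.eq_or_lt with hp_eq | hp_lt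
  · simp [← hp_eq]
  have hconj := Real.HolderConjugate.conjExponent hp_lt
  refine (ENNReal.lintegral_mul_le_Lp_mul_Lq μ hconj hφ (hψ.pow_const _)).trans_eq ?_
  simp only [← ENNReal.rpow_mul, hconj.sub_one_mul_conj]
  congr 2
  rw [Real.conjExponent]
  have := sub_pos.2 hp_lt
  field_simp

namespace Boltzmann

variable {d : ℕ} {Ω : SpatialDomain} {s : ℝ} {p p' : ℝ≥0∞} {α : ℝ}

lemma lintegral_mul_rpow_mul_wt_le (hpp' : p.HolderConjugate p') (hp : p ≠ ∞)
    {φ ψ : Vel d → ℝ≥0∞} (hφ : AEMeasurable φ) (hψ : AEMeasurable ψ) :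
    ∫⁻ v, φ v * ψ v ^ (p.toReal - 1) * wt (p.toReal * α) v ≤
      eLpNorm (fun v => φ v * wt (α - (p'⁻¹).toReal) v) p volume *
        eLpNorm (fun v => ψ v * wt (α + (p⁻¹).toReal) v) p volume ^ (p.toReal - 1) := by
  have hp_one : 1 ≤ p.toReal := by simpa using ENNReal.toReal_mono hp hpp'.one_le
  have hsum : (p⁻¹).toReal + (p'⁻¹).toReal = 1 := by
    rw [← ENNReal.toReal_add (by simp [hpp'.ne_zero]) (by simp [hpp'.symm.ne_zero]),
      hpp'.inv_add_inv_eq_one, ENNReal.toReal_one]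
  have hinv : p.toReal * (p⁻¹).toReal = 1 := by
    rw [ENNReal.toReal_inv, mul_inv_cancel₀ (by positivity)]
  -- The weights match: `(α - 1/p') + (p - 1)(α + 1/p) = pα`.
  have hweight : ∀ v, φ v * ψ v ^ (p.toReal - 1) * wt (p.toReal * α) v =
      φ v * wt (α - (p'⁻¹).toReal) v * (ψ v * wt (α + (p⁻¹).toReal) v) ^ (p.toReal - 1) := by
    intro v
    rw [ENNReal.mul_rpow_of_nonneg _ _ (sub_nonneg.2 hp_one), wt_rpow, mul_mul_mul_comm, ← wt_add]
    congr 2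
    linear_combination hsum - hinv
  simp only [hweight]
  exact lintegral_mul_rpow_le_eLpNorm_mul hpp'.one_le hp
    (hφ.mul (measurable_wt _).aemeasurable) (hψ.mul (measurable_wt _).aemeasurable)

lemma enorm_dualIntegrand_le {q h : Ω.Pt d → Vel d → ℝ} {v : Vel d}
    (hq : Ω.hsNorm d s (fun x => q x v) ≠ ∞) (hh : Ω.hsNorm d s (fun x => h x v) ≠ ∞) :
    ‖dualIntegrand d Ω s p α q h v‖ₑ ≤ Ω.hsNorm d s (fun x => q x v) *
      Ω.hsNorm d s (fun x => h x v) ^ (p.toReal - 1) * wt (p.toReal * α) v := by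
  have hcauchy_schwarz := SpatialDomain.enorm_hsInner_le hq hh
  rw [dualIntegrand, enorm_mul, enorm_mul,
    Real.enorm_of_nonneg (Real.rpow_nonneg (bracket_pos v).le _)]
  refine mul_le_mul_left ?_ _
  rcases eq_or_ne (Ω.hsNorm d s fun x => h x v) 0 with hzero | hzero
  · rw [hzero, mul_zero, nonpos_iff_eq_zero] at hcauchy_schwarz
    simp [hcauchy_schwarz]
  · have hpos := ENNReal.toReal_pos hzero hh
    rw [Real.enorm_of_nonneg (Real.rpow_nonneg hpos.le _), ← ENNReal.ofReal_rpow_of_pos hpos,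
      ENNReal.ofReal_toReal hh, show p.toReal - 1 = 1 + (p.toReal - 2) by ring,
      ENNReal.rpow_add _ _ hzero hh, ENNReal.rpow_one, ← mul_assoc]
    gcongr

section DualBound

variable {q h : Ω.Pt d → Vel d → ℝ}

lemma aemeasurable_dualIntegrand (hs : 0 ≤ s) (hq : JointlyMeasurable d Ω q)
    (hh : JointlyMeasurable d Ω h) (hq_fin : ∀ᵐ v, Ω.hsNorm d s (fun x => q x v) ≠ ∞)
    (hh_fin : ∀ᵐ v, Ω.hsNorm d s (fun x => h x v) ≠ ∞) :
    AEMeasurable (dualIntegrand d Ω s p α q h) := by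
  have hN := SpatialDomain.isDualNorm_hsNorm (d := d) (Ω := Ω) hs
  have hadd := (hN.aemeasurable (f := fun x v => q x v + h x v) (hq.add hh)).ennreal_toReal
  have hsub := (hN.aemeasurable (f := fun x v => q x v - h x v) (hq.sub hh)).ennreal_toReal
  have hinner : AEMeasurable fun v => Ω.hsInner d s (fun x => q x v) fun x => h x v := by
    refine (((hadd.pow_const 2).sub (hsub.pow_const 2)).div_const 4).congr ?_
    filter_upwards [hq_fin, hh_fin] with v hqv hhv
    exact (SpatialDomain.hsInner_eq_polarization hs hqv hhv).symm
  exact (hinner.mul ((hN.aemeasurable hh).ennreal_toReal.pow_const _)).mul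
    (measurable_bracket.pow_const _).aemeasurable

lemma lintegral_enorm_dualIntegrand_le (hs : 0 ≤ s) (hpp' : p.HolderConjugate p') (hp : p ≠ ∞)
    (hq : JointlyMeasurable d Ω q) (hh : JointlyMeasurable d Ω h)
    (hq_fin : ∀ᵐ v, Ω.hsNorm d s (fun x => q x v) ≠ ∞)
    (hh_fin : ∀ᵐ v, Ω.hsNorm d s (fun x => h x v) ≠ ∞) :
    ∫⁻ v, ‖dualIntegrand d Ω s p α q h v‖ₑ ≤ polyNorm d Ω s p (α - (p'⁻¹).toReal) q *
      eLpNorm (fun v => Ω.hsNorm d s (fun x => h x v) * wt (α + (p⁻¹).toReal) v) p volume ^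
        (p.toReal - 1) := by
  have hN := SpatialDomain.isDualNorm_hsNorm (d := d) (Ω := Ω) hs
  rw [polyNorm_eq hs]
  refine (lintegral_mono_ae ?_).trans
    (lintegral_mul_rpow_mul_wt_le (α := α) hpp' hp (hN.aemeasurable hq) (hN.aemeasurable hh))
  filter_upwards [hq_fin, hh_fin] with v hqv hhv
  exact enorm_dualIntegrand_le hqv hhv

theorem exists_integral_dualIntegrand_le (hd : 0 < d) (Ω : SpatialDomain) (hs : 0 ≤ s)
    (hpp' : p.HolderConjugate p') (α : ℝ) :
    ∃ c : NNReal, p ≠ ∞ → ∀ q h : Ω.Pt d → Vel d → ℝ, JointlyMeasurable d Ω q →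
      polyNorm d Ω s p (α - (p'⁻¹).toReal) q ≠ ∞ → MemPolyNu d Ω s p α h →
      Integrable (dualIntegrand d Ω s p α q h) volume ∧
      ∫ v, dualIntegrand d Ω s p α q h v ≤ c * (polyNorm d Ω s p (α - (p'⁻¹).toReal) q).toReal *
        (polyNormNu d Ω s p α h).toReal ^ (p.toReal - 1) := by
  obtain ⟨c, hc⟩ := exists_eLpNorm_hsNorm_mul_wt_add_le hd Ω hs p α
  refine ⟨c ^ (p.toReal - 1), fun hp q h hq hq_fin hh => ?_⟩
  have hp_one : 0 ≤ p.toReal - 1 := by simpa using ENNReal.toReal_mono hp hpp'.one_le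
  have hq_ae := ae_hsNorm_ne_top hs hpp'.ne_zero hq hq_fin
  have hh_ae := ae_hsNorm_ne_top hs hpp'.ne_zero hh.1 hh.2.1.ne
  have hbound : ∫⁻ v, ‖dualIntegrand d Ω s p α q h v‖ₑ ≤
      polyNorm d Ω s p (α - (p'⁻¹).toReal) q *
        (c * polyNormNu d Ω s p α h) ^ (p.toReal - 1) := by
    refine (lintegral_enorm_dualIntegrand_le hs hpp' hp hq hh.1 hq_ae hh_ae).trans ?_
    gcongr
    exact hc h
  have hbound_fin : polyNorm d Ω s p (α - (p'⁻¹).toReal) q *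
      (c * polyNormNu d Ω s p α h) ^ (p.toReal - 1) ≠ ∞ :=
    ENNReal.mul_ne_top hq_fin (ENNReal.rpow_ne_top_of_nonneg hp_one
      (ENNReal.mul_ne_top ENNReal.coe_ne_top hh.2.2.ne))
  refine ⟨⟨(aemeasurable_dualIntegrand hs hq hh.1 hq_ae hh_ae).aestronglyMeasurable,
    hbound.trans_lt hbound_fin.lt_top⟩, ?_⟩
  refine (integral_le_toReal_of_lintegral_enorm_le hbound_fin hbound).trans_eq ?_
  rw [ENNReal.toReal_mul, ← ENNReal.toReal_rpow, ENNReal.toReal_mul, ENNReal.coe_toReal,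
    Real.mul_rpow c.coe_nonneg ENNReal.toReal_nonneg, NNReal.coe_rpow]
  ring

end DualBound

end Boltzmann

end

theorem mainTheorem2_general (d : ℕ) (hd : 0 < d) (Ω : SpatialDomain)
    (s : ℝ) (hs : (d : ℝ) / 2 < s)
    (p p' : ℝ≥0∞) (hpp' : ENNReal.HolderConjugate p p')
    (α : ℝ) (hα : 2 + (d : ℝ) * (p'⁻¹).toReal < α) :
    ∃ C : ℝ, 0 < C ∧
      ∀ f g : Ω.Pt d → Boltzmann.Vel d → ℝ,
        Boltzmann.MemPolyNu d Ω s p α f → Boltzmann.MemPolyNu d Ω s p α g →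
        (∀ᵐ z ∂((Ω.vol d).prod (volume : Measure (Boltzmann.Vel d))),
          Boltzmann.QConverges (f z.1) (g z.1) z.2) ∧
        Boltzmann.JointlyMeasurable d Ω (Boltzmann.Q f g) ∧
        Boltzmann.polyNorm d Ω s p (α - (p'⁻¹).toReal) (Boltzmann.Q f g) ≤
          ENNReal.ofReal C *
            (Boltzmann.polyNorm d Ω s p α f * Boltzmann.polyNormNu d Ω s p α g
              + Boltzmann.polyNormNu d Ω s p α f * Boltzmann.polyNorm d Ω s p α g) ∧
        (p ≠ ∞ → ∀ h : Ω.Pt d → Boltzmann.Vel d → ℝ, Boltzmann.MemPolyNu d Ω s p α h →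
          Integrable (Boltzmann.dualIntegrand d Ω s p α (Boltzmann.Q f g) h) volume ∧
          ∫ v, Boltzmann.dualIntegrand d Ω s p α (Boltzmann.Q f g) h v ≤
            C * ((Boltzmann.polyNorm d Ω s p α f).toReal
                    * (Boltzmann.polyNormNu d Ω s p α g).toReal
                  + (Boltzmann.polyNormNu d Ω s p α f).toReal
                    * (Boltzmann.polyNorm d Ω s p α g).toReal)
              * (Boltzmann.polyNormNu d Ω s p α h).toReal ^ (p.toReal - 1)) := by
  have hs₀ : 0 ≤ s := (by positivity : (0 : ℝ) ≤ d / 2).trans hs.le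
  obtain ⟨K, hK⟩ := Boltzmann.exists_polyNorm_Q_le hd Ω hs hpp' hα
  obtain ⟨c, hc⟩ := Boltzmann.exists_integral_dualIntegrand_le hd Ω hs₀ hpp' α
  refine ⟨(1 + c) * K + 1, by positivity, fun f g hf hg => ?_⟩
  have hmeas := Boltzmann.jointlyMeasurable_Q hd hf.1 hg.1
  have hfin := hf.crossNorm_ne_top hg
  refine ⟨hf.ae_qConverges hd hs hpp' hα hg, hmeas, (hK f g hf hg).trans ?_, fun hp h hh => ?_⟩
  · rw [Boltzmann.crossNorm, ← ENNReal.ofReal_coe_nnreal]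
    gcongr
    nlinarith [mul_nonneg c.coe_nonneg K.coe_nonneg]
  · obtain ⟨hinteg, hle⟩ := hc hp (Boltzmann.Q f g) h hmeas
      (ne_top_of_le_ne_top (ENNReal.mul_ne_top ENNReal.coe_ne_top hfin) (hK f g hf hg)) hh
    refine ⟨hinteg, hle.trans ?_⟩
    have hQ : _ ≤ ((K : ℝ≥0∞) * _).toReal := ENNReal.toReal_mono
      (ENNReal.mul_ne_top ENNReal.coe_ne_top hfin) (hK f g hf hg)
    rw [ENNReal.toReal_mul, ENNReal.coe_toReal, hf.toReal_crossNorm hg] at hQ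
    refine mul_le_mul_of_nonneg_right ((mul_le_mul_of_nonneg_left hQ c.coe_nonneg).trans ?_)
      (by positivity)
    rw [← mul_assoc]
    gcongr
    linarith [K.coe_nonneg]

theorem mainTheorem2 (d : ℕ) (hd : d = 2 ∨ d = 3) (Ω : SpatialDomain)
    (s : ℝ) (hs : (d : ℝ) / 2 < s)
    (p p' : ℝ≥0∞) (hpp' : ENNReal.HolderConjugate p p')
    (α : ℝ) (hα : 2 + (d : ℝ) * (p'⁻¹).toReal < α) :
    ∃ C : ℝ, 0 < C ∧
      ∀ f g : Ω.Pt d → Boltzmann.Vel d → ℝ,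
        Boltzmann.MemPolyNu d Ω s p α f → Boltzmann.MemPolyNu d Ω s p α g →
        -- `Q(f, g)` is well defined almost everywhere, and measurable
        (∀ᵐ z ∂((Ω.vol d).prod (volume : Measure (Boltzmann.Vel d))),
          Boltzmann.QConverges (f z.1) (g z.1) z.2) ∧
        Boltzmann.JointlyMeasurable d Ω (Boltzmann.Q f g) ∧
        -- the norm bound
        Boltzmann.polyNorm d Ω s p (α - (p'⁻¹).toReal) (Boltzmann.Q f g) ≤
          ENNReal.ofReal C *
            (Boltzmann.polyNorm d Ω s p α f * Boltzmann.polyNormNu d Ω s p α g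
              + Boltzmann.polyNormNu d Ω s p α f * Boltzmann.polyNorm d Ω s p α g) ∧
        -- the dual bound
        (p ≠ ∞ → ∀ h : Ω.Pt d → Boltzmann.Vel d → ℝ, Boltzmann.MemPolyNu d Ω s p α h →
          Integrable (Boltzmann.dualIntegrand d Ω s p α (Boltzmann.Q f g) h) volume ∧
          ∫ v, Boltzmann.dualIntegrand d Ω s p α (Boltzmann.Q f g) h v ≤
            C * ((Boltzmann.polyNorm d Ω s p α f).toReal
                    * (Boltzmann.polyNormNu d Ω s p α g).toReal
                  + (Boltzmann.polyNormNu d Ω s p α f).toReal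
                    * (Boltzmann.polyNorm d Ω s p α g).toReal)
              * (Boltzmann.polyNormNu d Ω s p α h).toReal ^ (p.toReal - 1)) := by
  exact mainTheorem2_general d (by omega) Ω s hs p p' hpp' α hα
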